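/- **Game.** Let $n,m\ge 2$. A finite game has players $1,\dots,n$, each with $m$ pure strategies $s_{i1},\dots,s_{im}$, and real payoffs $u_i(s)$ for every player $i$ and every combination $s$ of pure strategies. Let $P$ be the set of profiles $p=(p_{ij})$ of mixed strategies ($p_{ij}\ge 0$, $\sum_j p_{ij}=1$ for every $i$), with the Euclidean distance of $\mathbb R^{nm}$; $\pi_i(p)$ is the expected payoff of player $i$ and $\pi_i(s_{ij},p_{-i})$ his expected payoff when he plays $s_{ij}$ and the others play as in $p$. Put $g_{ij}(p)=\max(\pi_i(s_{ij},p_{-i})-\pi_i(p),0)$ and $$\psi_{ij}(p)=\frac{p_{ij}+g_{ij}(p)}{\sum_{k=1}^m\bigl(p_{ik}+g_{ik}(p)\bigr)} .$$ A Nash equilibrium is a $p\in P$ such that no player $i$ can increase $\pi_i$ by replacing his mixed strategy by another one. **Sequential local non-constancy.** The payoff functions are *sequentially locally non-constant* if 1. there is a homeomorphism $h$ from the simplex $\Delta$ of dimension $n(m-1)$ onto $P$ that makes boundary points (points with some zero coordinate) correspond to boundary points, maps no vertex of $\Delta$ to a vertex of $P$ (a profile of pure strategies), and is such that at every $p=h(v)$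 with $v$ a vertex of $\Delta$ one has $\pi_i(s_{ij},p_{-i})-\pi_i(p)>0$ for some $i$ and $j$; 2. for every $F\subseteq P$ that is a face in which the players of some non-empty set play prescribed pure strategies, there is $\bar\varepsilon>0$ such that for every $0<\varepsilon<\bar\varepsilon$ the set $F$ is a finite union of totally bounded sets $H_1,\dots,H_N$ of diameter at most $\varepsilon$ with the following property for each $H_r$: if $(p_t)$ and $(q_t)$ are sequences in $H_r$ with $g_{ij}(p_t)\to0$ and $g_{ij}(q_t)\to 0$ for all $i,j$, then $|p_t-q_t|\to 0$; 3. the same as in 2 holds for $F=P$. **Algorithms.** A *name* of a game is a sequence whose $k$-th term lists, in a fixed order, integers $z$ with $|u_i(s)-z/2^k|\le 2^{-k}$ for all payoffs. An algorithm *finds* $p\in P$ from a name if, for each requested precision $k$, after reading some finite initial segment of the name it answers with natural numbers $y_{ij}$, and every answer it gives on an initial segment of the name satisfies $|p_{ij}-y_{ij}/2^k|\le 2^{-k}$ for all $i,j$. **Theorem.** In every finite game with sequentially locally non-constant payoff functions there is a profile $p\in P$ with $\psi(p)=p$, and this profile is a Nash equilibrium. Moreover such a profile can be found constructively, in the following sense: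 there is a single algorithm (a computable function of $n$, $m$, the requested precision and a finite initial segment of a name, whose value is an answer or a request for more input) which, for all $n,m\ge 2$, every such game and every name of it, finds a profile $p\in P$ (possibly depending on the name) with $\psi(p)=p$ that is a Nash equilibrium. -/

import Mathlib

open Filter Topology

namespace NashGame

/-- A finite strategic game with `n` players and `m` pure strategies for each player:
`u i s` is the payoff of player `i` when every player `l` plays the pure strategy `s l`. -/
abbrev Game (n m : ℕ) : Type := Fin n → (Fin n → Fin m) → ℝ

/-- Vectors with `n × m` real components `p (i, j)`, with the Euclidean distance. -/
abbrev Vec (n m : ℕ) : Type := EuclideanSpace ℝ (Fin n × Fin m)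

/-- The set `P` of profiles of mixed strategies: `p (i, j)` is the probability with which
player `i` chooses the `j`-th pure strategy. -/
def profiles (n m : ℕ) : Set (Vec n m) :=
  {p | ∀ i : Fin n, (fun j : Fin m => p (i, j)) ∈ stdSimplex ℝ (Fin m)}

/-- The expected payoff of player `i` at the profile `p`. -/
def payoff {n m : ℕ} (u : Game n m) (p : Vec n m) (i : Fin n) : ℝ :=
  ∑ s : Fin n → Fin m, (∏ l : Fin n, p (l, s l)) * u i s

/-- The profile in which player `i` plays the mixed strategy `x` and every other player
plays as in `p`. -/
def deviate {n m : ℕ} (p : Vec n m) (i : Fin n) (x : Fin m → ℝ) : Vec n m :=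
  WithLp.toLp 2 (fun lj : Fin n × Fin m => if lj.1 = i then x lj.2 else p lj)

/-- The payoff of player `i` when he chooses his `j`-th pure strategy and the other players
play as in `p`. -/
def purePayoff {n m : ℕ} (u : Game n m) (p : Vec n m) (i : Fin n) (j : Fin m) : ℝ :=
  payoff u (deviate p i (Pi.single j 1)) i

/-- What player `i` gains by switching to his `j`-th pure strategy, or `0` if he loses. -/
noncomputable def gain {n m : ℕ} (u : Game n m) (p : Vec n m) (i : Fin n) (j : Fin m) : ℝ :=
  max (purePayoff u p i j - payoff u p i) 0

/-- The map `ψ` of Nash: `ψ i j = v i j / (v i 1 + ⋯ + v i m)` with `v i j = p i j + gain i j`. -/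
noncomputable def nashMap {n m : ℕ} (u : Game n m) (p : Vec n m) : Vec n m :=
  WithLp.toLp 2 (fun ij : Fin n × Fin m =>
    (p ij + gain u p ij.1 ij.2) / ∑ k : Fin m, (p (ij.1, k) + gain u p ij.1 k))

/-- A Nash equilibrium: a profile of mixed strategies in which the strategy of every player is
a best response, among all his mixed strategies, to the strategies of the others. -/
def IsNashEquilibrium {n m : ℕ} (u : Game n m) (p : Vec n m) : Prop :=
  p ∈ profiles n m ∧
    ∀ (i : Fin n), ∀ x ∈ stdSimplex ℝ (Fin m), payoff u (deviate p i x) i ≤ payoff u p i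

/-- For two sequences in `H` along which all gains tend to `0`, the distance of the two
sequences tends to `0`. -/
def SeqAtMostOneEquilibriumOn {n m : ℕ} (u : Game n m) (H : Set (Vec n m)) : Prop :=
  ∀ p q : ℕ → Vec n m, (∀ t, p t ∈ H) → (∀ t, q t ∈ H) →
    (∀ i j, Tendsto (fun t => gain u (p t) i j) atTop (𝓝 0)) →
    (∀ i j, Tendsto (fun t => gain u (q t) i j) atTop (𝓝 0)) →
    Tendsto (fun t => dist (p t) (q t)) atTop (𝓝 0)

/-- There is a bound `ε₀ > 0` such that for every positive `ε < ε₀` the set `F` is a finite union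
of totally bounded sets of diameter at most `ε` on each of which the preceding condition holds. -/
def HasSeqLocNonconstCovers {n m : ℕ} (u : Game n m) (F : Set (Vec n m)) : Prop :=
  ∃ ε₀ : ℝ, 0 < ε₀ ∧ ∀ ε : ℝ, 0 < ε → ε < ε₀ →
    ∃ (N : ℕ) (H : Fin N → Set (Vec n m)),
      (∀ r, TotallyBounded (H r) ∧ Metric.diam (H r) ≤ ε) ∧
      (⋃ r, H r) = F ∧
      ∀ r, SeqAtMostOneEquilibriumOn u (H r)

/-- The face of `P` in which the players `i ∈ T` play the pure strategies `s i`. -/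
def pureFace {n m : ℕ} (T : Finset (Fin n)) (s : Fin n → Fin m) : Set (Vec n m) :=
  {p | p ∈ profiles n m ∧ ∀ i ∈ T, p (i, s i) = 1}

/-- The coordinates of a simplex `Δ` of dimension `n (m - 1)`. -/
abbrev Simplex (n m : ℕ) : Set (Fin (n * (m - 1) + 1) → ℝ) :=
  stdSimplex ℝ (Fin (n * (m - 1) + 1))

/-- An admissible identification of the simplex `Δ` of dimension `n (m - 1)` with `P`: boundary
points correspond to boundary points, and no vertex of `Δ` corresponds to a vertex of `P`
(a profile in which all players play pure strategies). -/
def IsAdmissible {n m : ℕ} (h : Simplex n m ≃ₜ profiles n m) : Prop :=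
  (∀ x : Simplex n m, (∃ k, x.1 k = 0) ↔ ∃ ij, (h x).1 ij = 0) ∧
  (∀ x : Simplex n m, (∃ k, x.1 = Pi.single k 1) →
    ¬ ∃ s : Fin n → Fin m, ∀ i, (h x).1 (i, s i) = 1)

/-- Sequential local non-constancy of the payoff functions of the game `u`. -/
def SeqLocNonconst {n m : ℕ} (u : Game n m) : Prop :=
  (∃ h : Simplex n m ≃ₜ profiles n m, IsAdmissible h ∧
    ∀ x : Simplex n m, (∃ k, x.1 = Pi.single k 1) →
      ∃ i j, 0 < purePayoff u (h x).1 i j - payoff u (h x).1 i) ∧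
  (∀ (T : Finset (Fin n)) (s : Fin n → Fin m), T.Nonempty →
    HasSeqLocNonconstCovers u (pureFace T s)) ∧
  HasSeqLocNonconstCovers u (profiles n m)

/-! Constructive existence. Real data are presented, as usual in constructive and computable
analysis, by sequences of dyadic rational approximations: a number `r` by integers `z k` with
`|r - z k / 2 ^ k| ≤ 1 / 2 ^ k`. A method acts on such sequences by inspecting finite initial
segments of them. -/

/-- `a` is a name of the game `u`: its `k`-th term is the list of the `n * m ^ n` integers that
approximate all the payoffs with error at most `2 ^ (-k)`. -/
def IsName {n m : ℕ} (u : Game n m) (a : ℕ → List ℤ) : Prop :=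
  ∀ k : ℕ, (a k).length = n * m ^ n ∧ ∀ (i : Fin n) (s : Fin n → Fin m),
    |u i s - ((a k).getD (finProdFinEquiv (i, finFunctionFinEquiv s)).val 0 : ℝ) / 2 ^ k|
      ≤ 1 / 2 ^ k

/-- The list `y` of `n * m` natural numbers approximates all the probabilities `p (i, j)` with
error at most `2 ^ (-k)`. -/
def Approximates {n m : ℕ} (y : List ℕ) (k : ℕ) (p : Vec n m) : Prop :=
  y.length = n * m ∧ ∀ (i : Fin n) (j : Fin m),
    |p (i, j) - (y.getD (finProdFinEquiv (i, j)).val 0 : ℝ) / 2 ^ k| ≤ 1 / 2 ^ k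

/-- A method that is given `n`, `m`, the demanded precision `k` and a finite initial segment of a
name of a game, and either answers with an approximation or asks for more (`none`). -/
abbrev Method : Type := (ℕ × ℕ) × ℕ × List (List ℤ) → Option (List ℕ)

/-- On the name `a` of a game with `n` players and `m` strategies, the method `A` finds `p`:
for every precision `k` it answers on some initial segment of `a`, and each of its answers is
correct to that precision. -/
def Method.Finds (A : Method) {n m : ℕ} (a : ℕ → List ℤ) (p : Vec n m) : Prop :=
  ∀ k : ℕ,
    (∃ N : ℕ, ∃ y, A ((n, m), k, (List.range N).map a) = some y) ∧
    ∀ (N : ℕ) (y : List ℕ), A ((n, m), k, (List.range N).map a) = some y → Approximates y k p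

end NashGame

/-! Equilibria are the zeros, in the orthant, of a continuous vector field `field`, which is Nash's
map with its denominators cleared: with v = x + max (1 - ∑ x, 0) + gain it is v - x ∑ v for each
player, and its zeros are profiles without gains (`mem_profiles_of_field_eq_zero`). Sequential local
non-constancy makes them finite in number: on each set of a finite cover of P, two constant
sequences of equilibria must coincide (`finite_gain_eq_zero`).

Zeros are located by a degree modulo 2. A point of the grid of mesh 2^(-k) is labeled by the last
coordinate in which the field is negative, and by 0 if there is none. A simplex of the Kuhn
triangulation that carries all labels lies where the field is of the order of the mesh. The parity
of the number of such simplices in a box survives every change of labels during which no full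
simplex crosses the boundary (`parity_update`, `parity_eq_of_isolated`). Hence it depends neither on
the approximations of the payoffs nor on the level, if on the boundary the field exceeds a fixed
multiple of the mesh (`parity_fineBox`). For the initial cube it is 1 by Sperner's argument
(`parity_eq_one`).

The algorithm keeps an isolating box of odd parity and at each level searches all boxes for one
inside it that is at most half as large, isolating and odd; these are finite tests in integer
arithmetic, and the whole search is primitive recursive (`computable_boxMethod`). With finitely many
zeros, an odd isolating box contains at every sufficiently fine level a small odd isolating box
around one zero (`exists_small_box`), so the search succeeds again and again and the sizes tend to
0. The tests see approximate payoffs only. With Λ = `fieldLip`, a margin 6Λ for the true game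
implies 5Λ for the approximate one, which is what is tested (`isSuccessor_of`), and this implies 4Λ
for the true game (`IsSuccessor.spec`).

Each box contains a zero and the sets of zeros in the boxes decrease, so by finiteness one zero lies
in all boxes (`exists_mem_boxZeros`). This zero, which may depend on the name, is the profile found.
-/

namespace NashGame

/-! ### Parity of full simplices in the Kuhn triangulation -/

section Sperner

variable {D : ℕ}

/-- The `t`-th vertex of the simplex of the Kuhn triangulation of `ℤ ^ D` with lowest vertex `a`
in which the coordinates are raised in the order given by `τ`. -/
def kuhnVertex (a : Fin D → ℤ) (τ : Equiv.Perm (Fin D)) (t : Fin (D + 1)) : Fin D → ℤ :=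
  fun r => a r + if (τ r).val < t.val then 1 else 0

/-- The simplex carries all the `D + 1` labels. -/
def IsFull (L : (Fin D → ℤ) → Fin (D + 1)) (a : Fin D → ℤ) (τ : Equiv.Perm (Fin D)) : Prop :=
  Function.Injective fun t => L (kuhnVertex a τ t)

open Classical in
/-- The number modulo `2` of full simplices with lowest vertex in `R`. -/
noncomputable def parity (L : (Fin D → ℤ) → Fin (D + 1)) (R : Finset (Fin D → ℤ)) : ZMod 2 :=
  ∑ a ∈ R, ∑ τ : Equiv.Perm (Fin D), if IsFull L a τ then 1 else 0

/-- The row of the determinant that corresponds to a label. -/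
def labelRow (c : Fin (D + 1)) : Fin (D + 1) → ZMod 2 :=
  Fin.cons 1 fun r => if c = r.succ then 1 else 0

/-- The rows of the labels in their natural order form a unitriangular matrix, and signs vanish
modulo 2. Counting full simplices thus becomes a sum of determinants, which are linear in the label
of each single vertex. -/
theorem det_labelRow (l : Fin (D + 1) → Fin (D + 1)) [Decidable (Function.Injective l)] :
    (Matrix.of fun t => labelRow (l t)).det = if Function.Injective l then 1 else 0 := by
  split_ifs with h
  · let σ : Equiv.Perm (Fin (D + 1)) := Equiv.ofBijective l (Finite.injective_iff_bijective.1 h)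
    have h1 : (Matrix.of fun t => labelRow (l t))
        = (Matrix.of fun t : Fin (D + 1) => labelRow t).submatrix σ id := by
      ext t c; rfl
    have h2 : (Matrix.of fun t : Fin (D + 1) => labelRow t).det = 1 := by
      rw [Matrix.det_of_isLowerTriangular]
      · refine Finset.prod_eq_one fun t _ => ?_
        refine Fin.cases ?_ (fun r => ?_) t <;> simp [labelRow]
      · intro i j hij
        simp only [OrderDual.toDual_lt_toDual] at hij
        induction j using Fin.cases with
        | zero => simp at hij
        | succ j => simp [labelRow, hij.ne]
    rw [h1, Matrix.det_permute, h2, mul_one]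
    rcases Int.units_eq_one_or (Equiv.Perm.sign σ) with h | h <;> rw [h] <;> decide
  · simp only [Function.Injective, not_forall] at h
    obtain ⟨s, t, hst, hne⟩ := h
    exact Matrix.det_zero_of_row_eq hne (congrArg labelRow hst)

theorem det_isFull (L : (Fin D → ℤ) → Fin (D + 1)) (a : Fin D → ℤ) (τ : Equiv.Perm (Fin D))
    [inst : Decidable (IsFull L a τ)] :
    (Matrix.of fun t => labelRow (L (kuhnVertex a τ t))).det = if IsFull L a τ then 1 else 0 :=
  @det_labelRow D (fun t => L (kuhnVertex a τ t)) inst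

/-- The vertex `v` occurs in position `t₀` of the simplex with this lowest vertex. -/
def starBase (v : Fin D → ℤ) (τ : Equiv.Perm (Fin D)) (t₀ : Fin (D + 1)) : Fin D → ℤ :=
  fun r => v r - if (τ r).val < t₀.val then 1 else 0

theorem kuhnVertex_starBase (v : Fin D → ℤ) (τ : Equiv.Perm (Fin D)) (t₀ : Fin (D + 1)) :
    kuhnVertex (starBase v τ t₀) τ t₀ = v := by
  ext r; simp [kuhnVertex, starBase]

theorem kuhnVertex_injective (a : Fin D → ℤ) (τ : Equiv.Perm (Fin D)) :
    Function.Injective (kuhnVertex a τ) := by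
  have key : ∀ s t : Fin (D + 1), s < t → kuhnVertex a τ s ≠ kuhnVertex a τ t := by
    intro s t hst h
    have hs : s.val < D := by have := t.2; have : s.val < t.val := hst; omega
    have := congrFun h (τ.symm ⟨s.val, hs⟩)
    have h3 : s.val < t.val := hst
    simp [kuhnVertex, h3] at this
  intro s t h
  rcases lt_trichotomy s t with h' | h' | h'
  · exact absurd h (key _ _ h')
  · exact h'
  · exact absurd h.symm (key _ _ h')

theorem eq_starBase {v a : Fin D → ℤ} {τ : Equiv.Perm (Fin D)} {t : Fin (D + 1)}
    (h : kuhnVertex a τ t = v) : a = starBase v τ t := by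
  ext r; simp [← h, kuhnVertex, starBase]

theorem finRotate_val {d : ℕ} (x : Fin (d + 1)) :
    (finRotate (d + 1) x).val = if x.val = d then 0 else x.val + 1 := by
  split_ifs with h
  · have : x = Fin.last d := Fin.ext h
    subst this; simp
  · exact coe_finRotate_of_ne_last (fun h' => h (by simp [h']))

theorem finRotate_symm_val {d : ℕ} (x : Fin (d + 1)) :
    ((finRotate (d + 1)).symm x).val = if x.val = 0 then d else x.val - 1 := by
  obtain ⟨y, rfl⟩ := (finRotate (d + 1)).surjective x
  rw [Equiv.symm_apply_apply, finRotate_val]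
  have := y.2
  split_ifs <;> simp_all

/-- A triple `(t₀, τ, t)` stands for a simplex with the vertex `v` in position `t₀`, together with
its facet opposite to position `t`. This map goes to the other simplex with the same facet. -/
def starFlip {d : ℕ} (p : Fin (d + 2) × Equiv.Perm (Fin (d + 1)) × Fin (d + 2)) :
    Fin (d + 2) × Equiv.Perm (Fin (d + 1)) × Fin (d + 2) :=
  if h0 : p.2.2.val = 0 then (p.1 - 1, (finRotate (d + 1)).symm * p.2.1, Fin.last (d + 1))
  else if h : p.2.2.val = d + 1 then (p.1 + 1, finRotate (d + 1) * p.2.1, 0)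
  else (p.1, Equiv.swap ⟨p.2.2.val - 1, by have := p.2.2.2; omega⟩
    ⟨p.2.2.val, by have := p.2.2.2; omega⟩ * p.2.1, p.2.2)

theorem starFlip_starFlip {d : ℕ} (p : Fin (d + 2) × Equiv.Perm (Fin (d + 1)) × Fin (d + 2)) :
    starFlip (starFlip p) = p := by
  obtain ⟨t₀, τ, t⟩ := p
  by_cases h0 : t.val = 0
  · have : t = 0 := Fin.ext h0
    subst this
    simp [starFlip, ← mul_assoc, ← Equiv.Perm.inv_def]
  · by_cases h : t.val = d + 1
    · have : t = Fin.last (d + 1) := Fin.ext h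
      subst this
      simp [starFlip, ← mul_assoc, ← Equiv.Perm.inv_def]
    · simp [starFlip, h0, h, ← mul_assoc]

theorem starFlip_ne {d : ℕ} (p : Fin (d + 2) × Equiv.Perm (Fin (d + 1)) × Fin (d + 2)) :
    starFlip p ≠ p := by
  obtain ⟨t₀, τ, t⟩ := p
  intro hp
  by_cases h0 : t.val = 0
  · have h1 : (starFlip (t₀, τ, t)).2.2.val = t.val := by rw [hp]
    simp [starFlip, h0] at h1
  · by_cases h : t.val = d + 1
    · have h1 : (starFlip (t₀, τ, t)).2.2.val = t.val := by rw [hp]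
      simp [starFlip, h] at h1
    · have h1 : (starFlip (t₀, τ, t)).2.1 = τ := by rw [hp]
      simp only [starFlip, h0, h, dite_false] at h1
      rw [mul_eq_right, Equiv.swap_eq_one_iff, Fin.mk.injEq] at h1
      omega

theorem starFlip_fst_eq {d : ℕ} (p : Fin (d + 2) × Equiv.Perm (Fin (d + 1)) × Fin (d + 2)) :
    (starFlip p).1 = (starFlip p).2.2 ↔ p.1 = p.2.2 := by
  obtain ⟨t₀, τ, t⟩ := p
  by_cases h0 : t.val = 0
  · have : t = 0 := Fin.ext h0
    subst this
    simp [starFlip, sub_eq_iff_eq_add]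
  · by_cases h : t.val = d + 1
    · have : t = Fin.last (d + 1) := Fin.ext h
      subst this
      simp [starFlip, add_eq_zero_iff_eq_neg, Fin.ext_iff]
    · simp [starFlip, h0, h]

/-- If the lowest vertex is omitted, the neighbour is shifted up along the coordinate raised first,
which is now raised last, so `v` moves down one position; omitting the highest vertex is the
inverse. If an inner vertex is omitted, the two raises next to it may be interchanged. Since `v`
belongs to the facet, it remains a vertex of the neighbour. -/
theorem starFlip_vertex {d : ℕ} (v : Fin (d + 1) → ℤ)
    (p : Fin (d + 2) × Equiv.Perm (Fin (d + 1)) × Fin (d + 2)) (hp : p.1 ≠ p.2.2)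
    (s : Fin (d + 1)) :
    kuhnVertex (starBase v (starFlip p).2.1 (starFlip p).1) (starFlip p).2.1
        ((starFlip p).2.2.succAbove s)
      = kuhnVertex (starBase v p.2.1 p.1) p.2.1 (p.2.2.succAbove s) := by
  obtain ⟨t₀, τ, t⟩ := p
  simp only at hp
  ext r
  by_cases h0 : t.val = 0
  · have : t = 0 := Fin.ext h0
    subst this
    have h1 : (t₀ - 1).val = t₀.val - 1 := Fin.val_sub_one_of_ne_zero hp
    have h2 : t₀.val ≠ 0 := fun h => hp (Fin.ext h)
    have h3 := s.2
    have h4 := t₀.2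
    have h5 := (τ r).2
    rw [show starFlip (t₀, τ, 0) = (t₀ - 1, (finRotate (d + 1)).symm * τ, Fin.last (d + 1)) by
      simp [starFlip]]
    simp only [kuhnVertex, starBase, Equiv.Perm.mul_apply,
      Fin.succAbove_last, Fin.succAbove_zero, Fin.val_castSucc, Fin.val_succ, h1,
      finRotate_symm_val]
    split_ifs <;> omega
  · by_cases h : t.val = d + 1
    · have : t = Fin.last (d + 1) := Fin.ext h
      subst this
      have h1 : (t₀ + 1).val = t₀.val + 1 :=
        Fin.val_add_one_of_lt (lt_of_le_of_ne (Fin.le_last t₀) hp)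
      have h3 := s.2
      have h4 : t₀.val < d + 1 := Fin.lt_def.1 (lt_of_le_of_ne (Fin.le_last t₀) hp)
      have h5 := (τ r).2
      rw [show starFlip (t₀, τ, Fin.last (d + 1)) = (t₀ + 1, finRotate (d + 1) * τ, 0) by
        simp [starFlip]]
      simp only [kuhnVertex, starBase, Equiv.Perm.mul_apply,
        Fin.succAbove_last, Fin.succAbove_zero, Fin.val_castSucc, Fin.val_succ, h1,
        finRotate_val]
      split_ifs <;> omega
    · have h6 : (t.succAbove s).val ≠ t.val := fun h' => Fin.succAbove_ne t s (Fin.ext h')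
      have h7 : t₀.val ≠ t.val := fun h' => hp (Fin.ext h')
      simp only [starFlip, h0, h, dite_false, kuhnVertex, starBase, Equiv.Perm.mul_apply,
        Equiv.swap_apply_def, Fin.ext_iff]
      split_ifs <;> simp_all <;> omega

/-- Every facet through `v` belongs to exactly two simplices, which `starFlip` exchanges, and equal
terms cancel modulo 2. The facet opposite to `v` is left out. -/
theorem sum_star_facets {d : ℕ} (w : (Fin (d + 1) → ℤ) → Fin (d + 1) → ZMod 2)
    (v : Fin (d + 1) → ℤ) :
    ∑ p : Fin (d + 2) × Equiv.Perm (Fin (d + 1)) × Fin (d + 2),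
      (if p.1 = p.2.2 then 0 else (Matrix.of fun s =>
        w (kuhnVertex (starBase v p.2.1 p.1) p.2.1 (p.2.2.succAbove s))).det) = 0 := by
  refine Finset.sum_ninvolution starFlip (fun p => ?_) (fun p _ => starFlip_ne p)
    (fun _ => Finset.mem_univ _) starFlip_starFlip
  by_cases hp : p.1 = p.2.2
  · rw [if_pos hp, if_pos ((starFlip_fst_eq p).2 hp), add_zero]
  · rw [if_neg hp, if_neg (mt (starFlip_fst_eq p).1 hp)]
    simp only [starFlip_vertex v p hp]
    exact CharTwo.add_self_eq_zero _

/-- The number modulo `2` of full simplices that contain a vertex does not depend on the label of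
this vertex. -/
theorem sum_star_update {d : ℕ} (L L' : (Fin (d + 1) → ℤ) → Fin (d + 2)) (v : Fin (d + 1) → ℤ)
    (hL : ∀ x, x ≠ v → L x = L' x) [∀ L a τ, Decidable (IsFull (D := d + 1) L a τ)] :
    ∑ t₀ : Fin (d + 2), ∑ τ : Equiv.Perm (Fin (d + 1)),
        (if IsFull L (starBase v τ t₀) τ then (1 : ZMod 2) else 0)
      = ∑ t₀ : Fin (d + 2), ∑ τ : Equiv.Perm (Fin (d + 1)),
        (if IsFull L' (starBase v τ t₀) τ then 1 else 0) := by
  rw [← sub_eq_zero, ← Finset.sum_sub_distrib]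
  simp only [← Finset.sum_sub_distrib]
  -- The rows without their first entry, with the difference of the two labels at `v`: the two
  -- determinants of a simplex in the star differ only in the row of `v`.
  let w : (Fin (d + 1) → ℤ) → Fin (d + 1) → ZMod 2 := fun x r =>
    if x = v then labelRow (L v) r.succ - labelRow (L' v) r.succ else labelRow (L x) r.succ
  refine Eq.trans ?_ (sum_star_facets w v)
  rw [Fintype.sum_prod_type]
  refine Finset.sum_congr rfl fun t₀ _ => ?_
  rw [Fintype.sum_prod_type]
  refine Finset.sum_congr rfl fun τ _ => ?_
  set a := starBase v τ t₀ with ha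
  have hv : kuhnVertex a τ t₀ = v := kuhnVertex_starBase v τ t₀
  have hne : ∀ t, t ≠ t₀ → kuhnVertex a τ t ≠ v := fun t ht h =>
    ht (kuhnVertex_injective a τ (h.trans hv.symm))
  let M : Matrix (Fin (d + 2)) (Fin (d + 2)) (ZMod 2) :=
    Matrix.of fun t => labelRow (L (kuhnVertex a τ t))
  have e1 : (if IsFull L a τ then (1 : ZMod 2) else 0) = M.det := (det_isFull L a τ).symm
  have e2 : (if IsFull L' a τ then (1 : ZMod 2) else 0)
      = (M.updateRow t₀ (labelRow (L' v))).det := by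
    rw [← det_isFull]
    congr 1
    ext t c
    by_cases ht : t = t₀
    · subst ht; simp [hv]
    · simp [Matrix.updateRow_ne ht, M, hL _ (hne t ht)]
  have e3 : M = M.updateRow t₀ (labelRow (L v)) := by
    ext t c
    by_cases ht : t = t₀
    · subst ht; simp [hv, M]
    · simp [Matrix.updateRow_ne ht, M]
  rw [@e1, @e2]
  nth_rw 1 [e3]
  have e4 := Matrix.det_updateRow_add M t₀ (labelRow (L v) - labelRow (L' v)) (labelRow (L' v))
  rw [sub_add_cancel] at e4
  -- The difference row begins with 0 and all other rows with 1, so the expansion along the first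
  -- column has one minor for each facet through `v`.
  rw [e4, add_sub_cancel_right, Matrix.det_succ_column_zero]
  refine Finset.sum_congr rfl fun t _ => ?_
  by_cases ht : t = t₀
  · subst ht; simp [labelRow]
  · rw [if_neg (Ne.symm ht), Matrix.updateRow_ne ht]
    have h1 : ((-1 : ZMod 2)) ^ (t : ℕ) = 1 := by
      rw [show (-1 : ZMod 2) = 1 by decide, one_pow]
    have h2 : M t 0 = 1 := by simp [M, labelRow]
    rw [h1, h2, one_mul, one_mul]
    congr 1
    ext s c
    by_cases hs : t.succAbove s = t₀
    · simp [hs, ← ha, hv, w]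
    · simp [Matrix.updateRow_ne hs, w, M, ← ha, hne _ hs]

-- Only simplices in the star of `v` can change. By `iso`, those of them that are full are either
-- all counted in `R` or all not counted, so `sum_star_update` applies to the whole star.
open Classical in
theorem parity_update [NeZero D] (L L' : (Fin D → ℤ) → Fin (D + 1)) (v : Fin D → ℤ)
    (hL : ∀ x, x ≠ v → L x = L' x) (R : Finset (Fin D → ℤ))
    (iso : ∀ a τ t, IsFull L a τ ∨ IsFull L' a τ → kuhnVertex a τ t = v → (a ∈ R ↔ v ∈ R)) :
    parity L R = parity L' R := by
  obtain ⟨d, rfl⟩ := Nat.exists_eq_succ_of_ne_zero (NeZero.ne D)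
  let star : Finset ((Fin (d + 1) → ℤ) × Equiv.Perm (Fin (d + 1))) :=
    (Finset.univ : Finset (Fin (d + 2) × Equiv.Perm (Fin (d + 1)))).image
      fun p => (starBase v p.2 p.1, p.2)
  have hstar : ∀ G : (Fin (d + 1) → ℤ) × Equiv.Perm (Fin (d + 1)) → ZMod 2,
      ∑ p ∈ star, G p = ∑ t₀, ∑ τ, G (starBase v τ t₀, τ) := by
    intro G
    rw [Finset.sum_image, Fintype.sum_prod_type]
    rintro ⟨t, τ⟩ - ⟨t', τ'⟩ - h
    simp only [Prod.mk.injEq] at h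
    obtain ⟨h, rfl⟩ := h
    have h1 : kuhnVertex (starBase v τ t') τ t = kuhnVertex (starBase v τ t') τ t' := by
      rw [kuhnVertex_starBase v τ t', ← h, kuhnVertex_starBase v τ t]
    rw [kuhnVertex_injective _ _ h1]
  have mem_star : ∀ p, p ∈ star ↔ ∃ t, kuhnVertex p.1 p.2 t = v := by
    rintro ⟨a, τ⟩
    simp only [star, Finset.mem_image, Finset.mem_univ, true_and, Prod.mk.injEq, Prod.exists]
    constructor
    · rintro ⟨t, _, h, rfl⟩
      exact ⟨t, h ▸ kuhnVertex_starBase v _ t⟩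
    · rintro ⟨t, h⟩
      exact ⟨t, τ, (eq_starBase h).symm, rfl⟩
  have split : ∀ L'' : (Fin (d + 1) → ℤ) → Fin (d + 2), (L'' = L ∨ L'' = L') →
      parity L'' R = ∑ p ∈ (R ×ˢ Finset.univ) \ star, (if IsFull L'' p.1 p.2 then 1 else 0)
        + if v ∈ R then ∑ p ∈ star, (if IsFull L'' p.1 p.2 then 1 else 0) else 0 := by
    intro L'' hL''
    rw [parity, ← Finset.sum_product' R Finset.univ
      fun a τ => if IsFull L'' a τ then (1 : ZMod 2) else 0, ← Finset.sum_inter_add_sum_sdiff _ star, add_comm]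
    congr 1
    rw [Finset.inter_comm, ← Finset.filter_mem_eq_inter, Finset.sum_filter]
    split_ifs with hv
    · refine Finset.sum_congr rfl fun p hp => ?_
      obtain ⟨t, ht⟩ := (mem_star p).1 hp
      by_cases hf : IsFull L'' p.1 p.2
      · have := iso p.1 p.2 t (by rcases hL'' with rfl | rfl <;> simp [hf]) ht
        simp [this.2 hv]
      · simp [hf]
    · refine Finset.sum_eq_zero fun p hp => ?_
      obtain ⟨t, ht⟩ := (mem_star p).1 hp
      by_cases hf : IsFull L'' p.1 p.2
      · have := iso p.1 p.2 t (by rcases hL'' with rfl | rfl <;> simp [hf]) ht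
        simp [this, hv]
      · simp [hf]
  rw [split L (Or.inl rfl), split L' (Or.inr rfl), hstar, hstar, sum_star_update L L' v hL]
  congr 1
  refine Finset.sum_congr rfl fun p hp => ?_
  have hp' : ∀ t, kuhnVertex p.1 p.2 t ≠ v := fun t ht =>
    (Finset.mem_sdiff.1 hp).2 ((mem_star p).2 ⟨t, ht⟩)
  have : IsFull L p.1 p.2 ↔ IsFull L' p.1 p.2 := by
    simp only [IsFull, hL _ (hp' _)]
  simp only [this]

/-- The parity in a region that no full simplex leaves is the same for two labelings, if this holds
for all labelings that arise by mixing the two. -/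
theorem parity_eq_of_isolated [NeZero D] (L L' : (Fin D → ℤ) → Fin (D + 1))
    (R : Finset (Fin D → ℤ))
    (iso : ∀ L'' : (Fin D → ℤ) → Fin (D + 1), (∀ x, L'' x = L x ∨ L'' x = L' x) →
      ∀ a τ t, IsFull L'' a τ → (kuhnVertex a τ t ∈ R ↔ a ∈ R)) :
    parity L R = parity L' R := by
  classical
  have key : ∀ S : Finset (Fin D → ℤ),
      parity L R = parity (fun x => if x ∈ S then L' x else L x) R := by
    intro S
    induction S using Finset.induction_on with
    | empty => simp
    | insert v S hv ih =>
      rw [ih]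
      refine parity_update _ _ v (fun x hx => by simp [hx]) R fun a τ t hf ht => ?_
      subst ht
      rcases hf with hf | hf
      · exact (iso _ (fun x => by split_ifs <;> simp) a τ t hf).symm
      · exact (iso _ (fun x => by split_ifs <;> simp) a τ t hf).symm
  -- It is enough to change the labels at the finitely many vertices of simplices based in `R`.
  rw [key (R.biUnion fun a => Finset.univ.biUnion fun τ => Finset.univ.image (kuhnVertex a τ))]
  unfold parity
  refine Finset.sum_congr rfl fun a ha => Finset.sum_congr rfl fun τ _ => ?_
  congr 1
  unfold IsFull
  have : ∀ t, kuhnVertex a τ t ∈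
      R.biUnion fun a => Finset.univ.biUnion fun τ => Finset.univ.image (kuhnVertex a τ) := by
    intro t
    simp only [Finset.mem_biUnion, Finset.mem_univ, Finset.mem_image, true_and]
    exact ⟨a, ha, τ, t, rfl⟩
  simp only [this, if_true]

/-- Passing to a grid that is finer by the factor `q`. -/
theorem parity_refine (L : (Fin D → ℤ) → Fin (D + 1)) (q : ℕ) (hq : 0 < q)
    (R R' : Finset (Fin D → ℤ)) (hR : ∀ v, v ∈ R' ↔ (fun r => v r / (q : ℤ)) ∈ R) :
    parity (fun v => L fun r => v r / (q : ℤ)) R' = parity L R := by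
  classical
  have hq' : (0 : ℤ) < q := by exact_mod_cast hq
  unfold parity
  -- From the base point q a + (q - 1), raising any coordinate crosses a multiple of q, so the
  -- rounded vertices run through the coarse simplex based at `a`.
  let f : (Fin D → ℤ) → (Fin D → ℤ) := fun a r => q * a r + (q - 1)
  have hf : Function.Injective f := by
    intro a b h
    ext r
    have := congrFun h r
    simp only [f] at this
    have h2 : (q : ℤ) * a r = q * b r := by linarith
    exact mul_left_cancel₀ hq'.ne' h2
  have hfv : ∀ a τ t, (fun r => kuhnVertex (f a) τ t r / (q : ℤ)) = kuhnVertex a τ t := by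
    intro a τ t
    ext r
    simp only [kuhnVertex, f]
    split_ifs
    · rw [show (q : ℤ) * a r + (q - 1) + 1 = q * (a r + 1) by ring,
        Int.mul_ediv_cancel_left _ hq'.ne']
    · rw [add_zero, add_comm, Int.add_mul_ediv_left _ _ hq'.ne',
        Int.ediv_eq_zero_of_lt (by omega) (by omega), zero_add, add_zero]
  have hfm : ∀ a ∈ R, f a ∈ R' := by
    intro a ha
    rw [hR]
    have : (fun r => f a r / (q : ℤ)) = a := by
      ext r
      simp only [f]
      rw [add_comm, Int.add_mul_ediv_left _ _ hq'.ne',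
        Int.ediv_eq_zero_of_lt (by omega) (by omega), zero_add]
    rwa [this]
  symm
  trans ∑ a ∈ R.image f, ∑ τ : Equiv.Perm (Fin D), if IsFull
    (fun v => L fun r => v r / (q : ℤ)) a τ then (1 : ZMod 2) else 0
  · rw [Finset.sum_image hf.injOn]
    refine Finset.sum_congr rfl fun a _ => Finset.sum_congr rfl fun τ _ => ?_
    have : IsFull (fun v => L fun r => v r / (q : ℤ)) (f a) τ ↔ IsFull L a τ := by
      simp only [IsFull, hfv]
    simp only [this]
  · refine Finset.sum_subset (fun v hv => ?_) fun a ha hna => ?_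
    · obtain ⟨a, ha, rfl⟩ := Finset.mem_image.1 hv
      exact hfm a ha
    · refine Finset.sum_eq_zero fun τ _ => if_neg fun hfull => hna ?_
      -- Otherwise raising the coordinate `r` does not change the rounded point, and two consecutive
      -- vertices have the same label.
      have h1 : ∀ r, (a r + 1) % (q : ℤ) = 0 := by
        intro r
        by_contra hr
        have h2 : (a r + 1) / (q : ℤ) = a r / q := by
          have e := Int.emod_add_mul_ediv (a r) q
          have e0 := Int.emod_nonneg (a r) hq'.ne'
          have e1 := Int.emod_lt_of_pos (a r) hq'
          have e2 : a r % q ≠ q - 1 := by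
            intro h
            apply hr
            rw [show a r + 1 = q * (a r / q + 1) by rw [mul_add]; omega]
            exact Int.mul_emod_right _ _
          rw [show a r + 1 = (a r % q + 1) + q * (a r / q) by omega,
            Int.add_mul_ediv_left _ _ hq'.ne', Int.ediv_eq_zero_of_lt (by omega) (by omega),
            zero_add]
        have h3 : (τ r).castSucc = (τ r).succ := by
          apply hfull
          simp only
          congr 1
          ext r'
          by_cases hr' : r' = r
          · subst hr'
            simp [kuhnVertex, h2]
          · have : (τ r').val ≠ (τ r).val := fun h => hr' (τ.injective (Fin.ext h))
            simp only [kuhnVertex, Fin.val_castSucc, Fin.val_succ]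
            congr 2
            split_ifs <;> omega
        simp [Fin.ext_iff] at h3
      refine Finset.mem_image.2 ⟨fun r => a r / q, (hR a).1 ha, ?_⟩
      ext r
      simp only [f]
      obtain ⟨k, hk⟩ := Int.dvd_of_emod_eq_zero (h1 r)
      have : a r = (q - 1) + q * (k - 1) := by rw [mul_sub]; omega
      rw [this, Int.add_mul_ediv_left _ _ hq'.ne', Int.ediv_eq_zero_of_lt (by omega) (by omega)]
      ring

theorem IsFull.exists_label {L : (Fin D → ℤ) → Fin (D + 1)} {a : Fin D → ℤ}
    {τ : Equiv.Perm (Fin D)} (h : IsFull L a τ) (c : Fin (D + 1)) :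
    ∃ t, L (kuhnVertex a τ t) = c :=
  Finite.surjective_of_injective h c

theorem le_kuhnVertex (a : Fin D → ℤ) (τ : Equiv.Perm (Fin D)) (t : Fin (D + 1)) (r : Fin D) :
    a r ≤ kuhnVertex a τ t r ∧ kuhnVertex a τ t r ≤ a r + 1 := by
  unfold kuhnVertex; split_ifs <;> omega

/-- The vertex labeled 0 bounds every coordinate from above, the vertex labeled `r.succ` bounds the
coordinate `r` from below, and the vertices of a simplex differ by at most 1. -/
theorem IsFull.bounds {L : (Fin D → ℤ) → Fin (D + 1)} {b : ℤ}
    (hpos : ∀ v r, L v = r.succ → 0 < v r) (h0 : ∀ v, L v = 0 → ∀ r, v r ≤ b)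
    {a : Fin D → ℤ} {τ : Equiv.Perm (Fin D)} (h : IsFull L a τ) (t : Fin (D + 1)) (r : Fin D) :
    0 ≤ kuhnVertex a τ t r ∧ kuhnVertex a τ t r ≤ b + 1 := by
  obtain ⟨s, hs⟩ := h.exists_label 0
  obtain ⟨s', hs'⟩ := h.exists_label r.succ
  have h1 := h0 _ hs r
  have h2 := hpos _ _ hs'
  have h3 := le_kuhnVertex a τ s r
  have h4 := le_kuhnVertex a τ s' r
  have h5 := le_kuhnVertex a τ t r
  omega

open Classical in
/-- The label of the last coordinate with the property `P`, and `0` if there is none. -/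
noncomputable def lastLabel (P : Fin D → Prop) : Fin (D + 1) :=
  ⟨Nat.findGreatest (fun k => ∃ r : Fin D, r.val + 1 = k ∧ P r) D,
    Nat.lt_succ_of_le (Nat.findGreatest_le _)⟩

theorem lastLabel_eq_zero {P : Fin D → Prop} : lastLabel P = 0 ↔ ∀ r, ¬ P r := by
  simp only [lastLabel, Fin.ext_iff, Fin.val_zero, Nat.findGreatest_eq_zero_iff]
  constructor
  · intro h r hr
    exact h (Nat.succ_pos r.val) (by have := r.2; omega) ⟨r, rfl, hr⟩
  · rintro h k - - ⟨r, -, hr⟩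
    exact h r hr

theorem lastLabel_eq_succ {P : Fin D → Prop} {r : Fin D} :
    lastLabel P = r.succ ↔ P r ∧ ∀ s, r < s → ¬ P s := by
  simp only [lastLabel, Fin.ext_iff, Fin.val_succ, Nat.findGreatest_eq_iff]
  constructor
  · rintro ⟨-, h1, h2⟩
    obtain ⟨s, hs, hP⟩ := h1 (Nat.succ_ne_zero _)
    obtain rfl : s = r := Fin.ext (by omega)
    refine ⟨hP, fun s' hs' hP' => ?_⟩
    have : s.val < s'.val := hs'
    exact h2 (n := s'.val + 1) (by omega) (by have := s'.2; omega) ⟨s', rfl, hP'⟩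
  · rintro ⟨h1, h2⟩
    refine ⟨by have := r.2; omega, fun _ => ⟨r, rfl, h1⟩, ?_⟩
    rintro n hn - ⟨s, hs, hP⟩
    exact h2 s (Fin.lt_def.2 (by omega)) hP

/-- A labeling that behaves at the boundary of a cube as in Sperner's lemma has an odd number of
full simplices. -/
theorem parity_eq_one [NeZero D] (L : (Fin D → ℤ) → Fin (D + 1)) (b : ℤ) (hb : 0 ≤ b)
    (hpos : ∀ v r, L v = r.succ → 0 < v r) (h0 : ∀ v, L v = 0 → ∀ r, v r ≤ b)
    (R : Finset (Fin D → ℤ)) (hR : ∀ v, (∀ r, 0 ≤ v r ∧ v r ≤ b + 1) → v ∈ R) :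
    parity L R = 1 := by
  classical
  -- The reference labeling, by the last positive coordinate: its only full simplex is based at 0
  -- and raises the coordinates in their natural order.
  let L₀ : (Fin D → ℤ) → Fin (D + 1) := fun v => lastLabel fun r => 0 < v r
  have hpos0 : ∀ v r, L₀ v = r.succ → 0 < v r := fun v r h => (lastLabel_eq_succ.1 h).1
  have h00 : ∀ v, L₀ v = 0 → ∀ r, v r ≤ 0 := fun v h r => not_lt.1 (lastLabel_eq_zero.1 h r)
  rw [parity_eq_of_isolated L L₀ R]
  · have hfull : ∀ a τ, IsFull L₀ a τ ↔ a = 0 ∧ τ = 1 := by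
      intro a τ
      constructor
      · intro h
        have ha : a = 0 := by
          ext r
          obtain ⟨s, hs⟩ := h.exists_label 0
          obtain ⟨s', hs'⟩ := h.exists_label r.succ
          have h1 := h00 _ hs r
          have h2 := hpos0 _ _ hs'
          have h3 := le_kuhnVertex a τ s r
          have h4 := le_kuhnVertex a τ s' r
          simp only [Pi.zero_apply]
          omega
        refine ⟨ha, ?_⟩
        subst ha
        -- At the vertex labeled `r.succ` the coordinate `r` is already raised and no later
        -- coordinate is.
        have hm : StrictMono τ := by
          intro r s hrs
          obtain ⟨t, ht⟩ := h.exists_label r.succ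
          obtain ⟨h1, h2⟩ := lastLabel_eq_succ.1 ht
          have h3 := h2 s hrs
          simp only [kuhnVertex, Pi.zero_apply, zero_add] at h1 h3
          rw [Fin.lt_def]
          by_contra h4
          split_ifs at h1 h3 <;> omega
        have := (hm.range_inj strictMono_id).1 (by simp [τ.surjective.range_eq])
        ext r
        simp [this]
      · rintro ⟨rfl, rfl⟩
        have : ∀ t, L₀ (kuhnVertex 0 1 t) = t := by
          intro t
          induction t using Fin.cases with
          | zero =>
            refine lastLabel_eq_zero.2 fun r => ?_
            simp [kuhnVertex]
          | succ t =>
            refine lastLabel_eq_succ.2 ⟨by simp [kuhnVertex], fun s hs => ?_⟩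
            have : t.val < s.val := hs
            have h2 : ¬ s.val < t.val + 1 := by omega
            simp [kuhnVertex, h2]
        intro s t hst
        simpa only [this] using hst
    unfold parity
    rw [Finset.sum_eq_single 0, Finset.sum_eq_single 1]
    · simp [hfull]
    · intro τ _ hτ
      simp [hfull, hτ]
    · simp
    · intro a _ ha
      simp [hfull, ha]
    · intro h
      exact absurd (hR 0 fun r => by simp; omega) h
  -- Mixed labelings inherit the boundary conditions, so all their full simplices lie inside `R`.
  · intro L'' hL'' a τ t hf
    have hp : ∀ v r, L'' v = r.succ → 0 < v r := by
      intro v r hv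
      rcases hL'' v with h | h
      · exact hpos v r (h ▸ hv)
      · exact hpos0 v r (h ▸ hv)
    have hz : ∀ v, L'' v = 0 → ∀ r, v r ≤ b := by
      intro v hv r
      rcases hL'' v with h | h
      · exact h0 v (h ▸ hv) r
      · exact (h00 v (h ▸ hv) r).trans hb
    have h1 := hR _ (hf.bounds hp hz t)
    have h2 := hR _ (hf.bounds hp hz 0)
    have h3 : kuhnVertex a τ 0 = a := by ext r; simp [kuhnVertex]
    rw [h3] at h2
    exact iff_of_true h1 h2

end Sperner
end NashGame


namespace NashGame

/-! ### Multilinearity of payoffs; finiteness of the set of equilibria -/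

section Payoffs

variable {n m : ℕ}

/-- Each product of probabilities contains exactly one factor of player `i`, so his payoff is linear
in his own strategy. -/
theorem payoff_deviate (u : Game n m) (p : Vec n m) (i : Fin n) (x : Fin m → ℝ) :
    payoff u (deviate p i x) i = ∑ j, x j * purePayoff u p i j := by
  have key : ∀ (y : Fin m → ℝ) (s : Fin n → Fin m), ∏ l, (deviate p i y) (l, s l)
      = y (s i) * ∏ l ∈ Finset.univ.erase i, p (l, s l) := by
    intro y s
    rw [← Finset.mul_prod_erase _ _ (Finset.mem_univ i)]
    congr 1
    · simp [deviate]
    · refine Finset.prod_congr rfl fun l hl => ?_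
      simp [deviate, Finset.ne_of_mem_erase hl]
  simp only [purePayoff, payoff, key, Finset.mul_sum]
  rw [Finset.sum_comm]
  refine Finset.sum_congr rfl fun s _ => ?_
  rw [Finset.sum_eq_single (s i)]
  · simp [mul_assoc]
  · intro j _ hj
    simp [hj.symm]
  · simp

theorem deviate_self (p : Vec n m) (i : Fin n) : deviate p i (fun j => p (i, j)) = p := by
  ext ⟨l, j⟩
  by_cases h : l = i
  · subst h; simp [deviate]
  · simp [deviate, h]

theorem payoff_eq_sum_purePayoff (u : Game n m) (p : Vec n m) (i : Fin n) :
    payoff u p i = ∑ j, p (i, j) * purePayoff u p i j := by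
  rw [← payoff_deviate, deviate_self]

theorem gain_nonneg (u : Game n m) (p : Vec n m) (i : Fin n) (j : Fin m) : 0 ≤ gain u p i j :=
  le_max_right _ _

theorem isNashEquilibrium_of_gain_eq_zero {u : Game n m} {p : Vec n m} (hp : p ∈ profiles n m)
    (h : ∀ i j, gain u p i j = 0) : IsNashEquilibrium u p := by
  refine ⟨hp, fun i x hx => ?_⟩
  rw [payoff_deviate]
  calc ∑ j, x j * purePayoff u p i j ≤ ∑ j, x j * payoff u p i := by
        refine Finset.sum_le_sum fun j _ => mul_le_mul_of_nonneg_left ?_ (hx.1 j)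
        have := le_max_left (purePayoff u p i j - payoff u p i) 0
        rw [show max (purePayoff u p i j - payoff u p i) 0 = 0 from h i j] at this
        linarith
    _ = payoff u p i := by rw [← Finset.sum_mul, hx.2, one_mul]

theorem nashMap_eq_of_gain_eq_zero {u : Game n m} {p : Vec n m} (hp : p ∈ profiles n m)
    (h : ∀ i j, gain u p i j = 0) : nashMap u p = p := by
  ext ⟨i, j⟩
  have := (hp i).2
  simp [nashMap, h, this]

/-- Two equilibria in one set of the cover, taken as constant sequences, have a constant distance
that tends to 0. Hence each of the finitely many sets contains at most one. -/
theorem finite_gain_eq_zero {u : Game n m} (hu : SeqLocNonconst u) :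
    {p : Vec n m | p ∈ profiles n m ∧ ∀ i j, gain u p i j = 0}.Finite := by
  obtain ⟨ε₀, hε₀, h⟩ := hu.2.2
  obtain ⟨N, H, -, hH, hs⟩ := h (ε₀ / 2) (by linarith) (by linarith)
  have : {p : Vec n m | p ∈ profiles n m ∧ ∀ i j, gain u p i j = 0}
      ⊆ ⋃ r, {p | p ∈ H r ∧ ∀ i j, gain u p i j = 0} := by
    rintro p ⟨hp, hg⟩
    rw [← hH] at hp
    obtain ⟨r, hr⟩ := Set.mem_iUnion.1 hp
    exact Set.mem_iUnion.2 ⟨r, hr, hg⟩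
  refine (Set.finite_iUnion fun r => Set.Subsingleton.finite ?_).subset this
  rintro p ⟨hp, hpg⟩ q ⟨hq, hqg⟩
  have := hs r (fun _ => p) (fun _ => q) (fun _ => hp) (fun _ => hq)
    (fun i j => by simp [hpg]) (fun i j => by simp [hqg])
  exact dist_eq_zero.1 (tendsto_const_nhds_iff.1 this)

end Payoffs

/-! ### The vector field: zeros, compactness, Lipschitz constants -/

section Field

variable {n m : ℕ}

/-- A continuous vector field on the orthant of `ℝ ^ (n * m)`. Its zeros are the equilibria. -/
noncomputable def field (u : Game n m) (x : Fin n × Fin m → ℝ) (ij : Fin n × Fin m) : ℝ :=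
  (x ij + max (1 - ∑ k, x (ij.1, k)) 0 + gain u (WithLp.toLp 2 x) ij.1 ij.2)
    - x ij * (∑ k, x (ij.1, k) + m * max (1 - ∑ k, x (ij.1, k)) 0
      + ∑ k, gain u (WithLp.toLp 2 x) ij.1 k)

/-- A zero satisfies x ∑ v = v for each player. The term max (1 - ∑ x, 0) excludes the origin and
forces the total mass 1; after that, Nash's argument applies. -/
theorem mem_profiles_of_field_eq_zero (hm : 0 < m) {u : Game n m} {x : Fin n × Fin m → ℝ}
    (hx : ∀ ij, 0 ≤ x ij) (h : ∀ ij, field u x ij = 0) :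
    WithLp.toLp 2 x ∈ profiles n m ∧ ∀ i j, gain u (WithLp.toLp 2 x) i j = 0 := by
  have hsum : ∀ i, ∑ k, x (i, k) = 1 := by
    intro i
    set S := ∑ k, x (i, k) with hS
    set G := ∑ k, gain u (WithLp.toLp 2 x) i k with hG
    have hS0 : 0 ≤ S := Finset.sum_nonneg fun k _ => hx _
    have hG0 : 0 ≤ G := Finset.sum_nonneg fun k _ => gain_nonneg _ _ _ _
    have h1 : ∑ j, field u x (i, j) = 0 := Finset.sum_eq_zero fun j _ => h _
    simp only [field, Finset.sum_sub_distrib, Finset.sum_add_distrib, ← Finset.sum_mul] at h1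
    simp only [← hS, ← hG, Finset.sum_const, Finset.card_univ, Fintype.card_fin,
      nsmul_eq_mul] at h1
    have hm' : (1 : ℝ) ≤ m := by exact_mod_cast hm
    -- The first factor is ∑ v. It cannot vanish, since S = 0 would make the maximum at least 1.
    have h2 : (S + m * max (1 - S) 0 + G) * (1 - S) = 0 := by linarith
    rcases mul_eq_zero.1 h2 with h3 | h3
    · have h4 : 0 ≤ max (1 - S) 0 := le_max_right _ _
      have h5 : 1 - S ≤ max (1 - S) 0 := le_max_left _ _
      nlinarith
    · linarith
  have hp : WithLp.toLp 2 x ∈ profiles n m := fun i => ⟨fun j => hx _, hsum i⟩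
  refine ⟨hp, ?_⟩
  intro i
  set p : Vec n m := WithLp.toLp 2 x with hpdef
  have hg : ∀ j, gain u p i j = x (i, j) * ∑ k, gain u p i k := by
    intro j
    have := h (i, j)
    simp only [field, hsum, sub_self, max_self, add_zero, mul_zero, ← hpdef] at this
    linarith
  set G := ∑ k, gain u p i k with hG
  have hG0 : 0 ≤ G := Finset.sum_nonneg fun k _ => gain_nonneg _ _ _ _
  rcases hG0.eq_or_lt with hG1 | hG1
  · intro j; rw [hg j, ← hG1, mul_zero]
  · exfalso
    -- Here each gain is x (i, j) G with G > 0, so every strategy in use does strictly better than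
    -- the average of the strategies in use, which is absurd.
    have hle : ∀ j, x (i, j) * payoff u p i ≤ x (i, j) * purePayoff u p i j := by
      intro j
      rcases (hx (i, j)).eq_or_lt with h0 | h0
      · rw [← h0]; simp
      · have h1 : 0 < gain u p i j := by rw [hg j]; positivity
        have h2 : payoff u p i ≤ purePayoff u p i j := by
          by_contra h3
          rw [gain, max_eq_right (by linarith)] at h1
          exact lt_irrefl _ h1
        exact mul_le_mul_of_nonneg_left h2 h0.le
    have hex : ∃ j, 0 < x (i, j) := by
      by_contra! hn
      have : ∑ k, x (i, k) ≤ 0 := Finset.sum_nonpos fun k _ => hn k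
      rw [hsum] at this; linarith
    obtain ⟨j, hj⟩ := hex
    have hlt : x (i, j) * payoff u p i < x (i, j) * purePayoff u p i j := by
      have h1 : 0 < gain u p i j := by rw [hg j]; positivity
      refine mul_lt_mul_of_pos_left ?_ hj
      by_contra h3
      rw [gain, max_eq_right (by linarith)] at h1
      exact lt_irrefl _ h1
    have h2 := Finset.sum_lt_sum (fun j (_ : j ∈ Finset.univ) => hle j) ⟨j, Finset.mem_univ _, hlt⟩
    rw [← Finset.sum_mul, hsum, one_mul] at h2
    have h3 := payoff_eq_sum_purePayoff u p i
    simp only [hpdef] at h2 h3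
    exact h2.ne h3

theorem continuous_field (u : Game n m) : Continuous (field u) := by
  unfold field gain purePayoff payoff deviate
  refine continuous_pi fun ij => ?_
  have h : ∀ (i l : Fin n) (a b : Fin m), Continuous fun x : Fin n × Fin m → ℝ =>
      (if l = i then (Pi.single a 1 : Fin m → ℝ) b else x (l, b)) := by
    intro i l a b
    split_ifs <;> fun_prop
  dsimp only
  fun_prop

/-- Compactness: on the part of the cube at distance at least `s` from all zeros the norm of the
field attains a positive minimum, unless this part is empty. No procedure for `δ` is given; it
serves to show that the search succeeds and is not used by the search itself. -/
theorem exists_near_zero_of_field_small (u : Game n m) {s : ℝ} (hs : 0 < s) :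
    ∃ δ > 0, ∀ x : Fin n × Fin m → ℝ, (∀ ij, 0 ≤ x ij ∧ x ij ≤ 2) → (∀ ij, |field u x ij| ≤ δ) →
      ∃ e : Fin n × Fin m → ℝ, (∀ ij, 0 ≤ e ij) ∧ (∀ ij, field u e ij = 0) ∧
        ∀ ij, |x ij - e ij| < s := by
  let E : Set (Fin n × Fin m → ℝ) := {e | (∀ ij, 0 ≤ e ij) ∧ ∀ ij, field u e ij = 0}
  let C : Set (Fin n × Fin m → ℝ) := Set.Icc 0 (fun _ => 2) ∩ ⋂ e ∈ E, {x | s ≤ dist x e}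
  have hC : IsCompact C := isCompact_Icc.inter_right (isClosed_biInter fun e _ =>
    isClosed_le continuous_const (continuous_id.dist continuous_const))
  have hnear : ∀ x : Fin n × Fin m → ℝ, (∀ ij, 0 ≤ x ij ∧ x ij ≤ 2) → x ∉ C →
      ∃ e : Fin n × Fin m → ℝ, (∀ ij, 0 ≤ e ij) ∧ (∀ ij, field u e ij = 0) ∧
        ∀ ij, |x ij - e ij| < s := by
    intro x hx hxC
    have h1 : ¬ ∀ e ∈ E, s ≤ dist x e := fun h => hxC
      ⟨⟨fun ij => (hx ij).1, fun ij => (hx ij).2⟩, Set.mem_iInter₂.2 h⟩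
    push Not at h1
    obtain ⟨e, he, hd⟩ := h1
    exact ⟨e, he.1, he.2, fun ij => by
      have := (dist_pi_lt_iff hs).1 hd ij
      rwa [Real.dist_eq] at this⟩
  rcases C.eq_empty_or_nonempty with hE | hne
  · exact ⟨1, one_pos, fun x hx _ => hnear x hx (by simp [hE])⟩
  · obtain ⟨y, hy, hmin⟩ := hC.exists_isMinOn hne (continuous_field u).norm.continuousOn
    have hpos : 0 < ‖field u y‖ := by
      rw [norm_pos_iff]
      intro h0
      have hyE : y ∈ E := ⟨fun ij => hy.1.1 ij, fun ij => by rw [h0]; rfl⟩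
      have : s ≤ dist y y := Set.mem_iInter₂.1 hy.2 y hyE
      rw [dist_self] at this
      linarith
    refine ⟨‖field u y‖ / 2, by linarith, fun x hx hf => hnear x hx fun hxC => ?_⟩
    have h1 : ‖field u y‖ ≤ ‖field u x‖ := hmin hxC
    have h2 : ‖field u x‖ ≤ ‖field u y‖ / 2 :=
      (pi_norm_le_iff_of_nonneg (by linarith)).2 fun ij => by
        rw [Real.norm_eq_abs]; exact hf ij
    linarith

theorem prod_le_two_pow {ι : Type*} (S : Finset ι) (f : ι → ℝ) (hf : ∀ l, 0 ≤ f l ∧ f l ≤ 2) :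
    ∏ l ∈ S, f l ≤ 2 ^ S.card :=
  (Finset.prod_le_prod (fun l _ => (hf l).1) fun l _ => (hf l).2).trans_eq (Finset.prod_const 2)

theorem abs_prod_sub_prod_le {ι : Type*} (S : Finset ι) (f g : ι → ℝ) {ε : ℝ} (hε : 0 ≤ ε)
    (hf : ∀ l, 0 ≤ f l ∧ f l ≤ 2) (hg : ∀ l, 0 ≤ g l ∧ g l ≤ 2) (h : ∀ l, |f l - g l| ≤ ε) :
    |∏ l ∈ S, f l - ∏ l ∈ S, g l| ≤ S.card * 2 ^ S.card * ε := by
  classical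
  induction S using Finset.induction_on with
  | empty => simp
  | insert a S ha ih =>
    rw [Finset.prod_insert ha, Finset.prod_insert ha, Finset.card_insert_of_notMem ha]
    have h1 : 0 ≤ ∏ l ∈ S, f l := Finset.prod_nonneg fun l _ => (hf l).1
    have h2 : ∏ l ∈ S, f l ≤ 2 ^ S.card := prod_le_two_pow S f hf
    calc |f a * ∏ l ∈ S, f l - g a * ∏ l ∈ S, g l|
        = |(f a - g a) * ∏ l ∈ S, f l + g a * (∏ l ∈ S, f l - ∏ l ∈ S, g l)| := by ring_nf
      _ ≤ |f a - g a| * ∏ l ∈ S, f l + g a * |∏ l ∈ S, f l - ∏ l ∈ S, g l| := by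
        refine (abs_add_le _ _).trans ?_
        rw [abs_mul, abs_mul, abs_of_nonneg h1, abs_of_nonneg (hg a).1]
      _ ≤ ε * 2 ^ S.card + 2 * (S.card * 2 ^ S.card * ε) := by
        gcongr
        · exact h a
        · exact (hg a).2
      _ ≤ ((S.card + 1 : ℕ) : ℝ) * 2 ^ (S.card + 1) * ε := by
        have : (0 : ℝ) ≤ 2 ^ S.card * ε := by positivity
        push_cast
        rw [pow_succ]
        nlinarith

/-- A Lipschitz constant of the payoffs on the cube `[0, 2] ^ (n * m)`, if these are bounded by `B`
at the profiles of pure strategies. -/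
def payoffLip (n m B : ℕ) : ℕ := m ^ n * (2 ^ n * (n * B + 1))

/-- The game and the point vary together, so that one estimate covers both the approximation of the
payoffs and the passage between neighbouring grid points. -/
theorem abs_payoff_sub_payoff_le {u u' : Game n m} {B : ℕ} {ε : ℝ} (hε : 0 ≤ ε)
    (hu : ∀ i s, |u i s| ≤ B) (huu : ∀ i s, |u i s - u' i s| ≤ ε) {x y : Vec n m}
    (hx : ∀ ij, 0 ≤ x ij ∧ x ij ≤ 2) (hy : ∀ ij, 0 ≤ y ij ∧ y ij ≤ 2)
    (hxy : ∀ ij, |x ij - y ij| ≤ ε) (i : Fin n) :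
    |payoff u x i - payoff u' y i| ≤ payoffLip n m B * ε := by
  unfold payoff
  rw [← Finset.sum_sub_distrib]
  have hterm : ∀ s : Fin n → Fin m, |(∏ l, x (l, s l)) * u i s - (∏ l, y (l, s l)) * u' i s|
      ≤ 2 ^ n * (n * B + 1) * ε := by
    intro s
    have h1 := abs_prod_sub_prod_le Finset.univ (fun l => x (l, s l)) (fun l => y (l, s l)) hε
      (fun l => hx _) (fun l => hy _) (fun l => hxy _)
    have h2 : 0 ≤ ∏ l, y (l, s l) := Finset.prod_nonneg fun l _ => (hy _).1
    have h3 : ∏ l, y (l, s l) ≤ 2 ^ (Finset.univ : Finset (Fin n)).card :=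
      prod_le_two_pow _ _ fun l => hy _
    simp only [Finset.card_univ, Fintype.card_fin] at h1 h3
    calc |(∏ l, x (l, s l)) * u i s - (∏ l, y (l, s l)) * u' i s|
        = |(∏ l, x (l, s l) - ∏ l, y (l, s l)) * u i s
            + (∏ l, y (l, s l)) * (u i s - u' i s)| := by ring_nf
      _ ≤ |∏ l, x (l, s l) - ∏ l, y (l, s l)| * |u i s|
            + (∏ l, y (l, s l)) * |u i s - u' i s| := by
        refine (abs_add_le _ _).trans ?_
        rw [abs_mul, abs_mul, abs_of_nonneg h2]
      _ ≤ (n * 2 ^ n * ε) * B + 2 ^ n * ε := by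
        gcongr
        · exact hu i s
        · exact huu i s
      _ = 2 ^ n * (n * B + 1) * ε := by ring
  refine (Finset.abs_sum_le_sum_abs _ _).trans ((Finset.sum_le_sum fun s _ => hterm s).trans ?_)
  simp [payoffLip, mul_assoc]

theorem abs_payoff_le (hn : 0 < n) {u : Game n m} {B : ℕ}
    (hu : ∀ i s, |u i s| ≤ B) {x : Vec n m}
    (hx : ∀ ij, 0 ≤ x ij ∧ x ij ≤ 2) (i : Fin n) :
    |payoff u x i| ≤ payoffLip n m B := by
  unfold payoff
  have hterm : ∀ s : Fin n → Fin m, |(∏ l, x (l, s l)) * u i s| ≤ 2 ^ n * (n * B + 1) := by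
    intro s
    have h2 : 0 ≤ ∏ l, x (l, s l) := Finset.prod_nonneg fun l _ => (hx _).1
    have h3 : ∏ l, x (l, s l) ≤ 2 ^ (Finset.univ : Finset (Fin n)).card :=
      prod_le_two_pow _ _ fun l => hx _
    simp only [Finset.card_univ, Fintype.card_fin] at h3
    have hn' : (1 : ℝ) ≤ n := by exact_mod_cast hn
    have hB : (0 : ℝ) ≤ B := by positivity
    rw [abs_mul, abs_of_nonneg h2]
    refine mul_le_mul h3 ((hu i s).trans ?_) (abs_nonneg _) (by positivity)
    nlinarith
  refine (Finset.abs_sum_le_sum_abs _ _).trans ((Finset.sum_le_sum fun s _ => hterm s).trans ?_)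
  simp [payoffLip]

theorem deviate_single_mem {x : Vec n m} (hx : ∀ ij, 0 ≤ x ij ∧ x ij ≤ 2) (i : Fin n) (j : Fin m)
    (ij : Fin n × Fin m) :
    0 ≤ deviate x i (Pi.single j 1) ij ∧ deviate x i (Pi.single j 1) ij ≤ 2 := by
  by_cases h : ij.1 = i
  · by_cases h' : ij.2 = j <;> simp [deviate, h, h', Pi.single_apply]
  · simpa [deviate, h] using hx ij

theorem abs_gain_sub_gain_le {u u' : Game n m} {B : ℕ} {ε : ℝ} (hε : 0 ≤ ε)
    (hu : ∀ i s, |u i s| ≤ B) (huu : ∀ i s, |u i s - u' i s| ≤ ε) {x y : Vec n m}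
    (hx : ∀ ij, 0 ≤ x ij ∧ x ij ≤ 2) (hy : ∀ ij, 0 ≤ y ij ∧ y ij ≤ 2)
    (hxy : ∀ ij, |x ij - y ij| ≤ ε) (i : Fin n) (j : Fin m) :
    |gain u x i j - gain u' y i j| ≤ 2 * payoffLip n m B * ε := by
  have h1 := abs_payoff_sub_payoff_le hε hu huu hx hy hxy i
  have h2 := abs_payoff_sub_payoff_le hε hu huu (deviate_single_mem hx i j)
    (deviate_single_mem hy i j) (fun ij => by
      by_cases h : ij.1 = i
      · simpa [deviate, h] using hε
      · simpa [deviate, h] using hxy ij) i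
  refine (abs_max_sub_max_le_abs _ _ _).trans ?_
  unfold purePayoff
  rw [abs_le] at *
  constructor <;> linarith [h1.1, h1.2, h2.1, h2.2]

theorem gain_le (hn : 0 < n) {u : Game n m} {B : ℕ} (hu : ∀ i s, |u i s| ≤ B) {x : Vec n m}
    (hx : ∀ ij, 0 ≤ x ij ∧ x ij ≤ 2) (i : Fin n) (j : Fin m) :
    gain u x i j ≤ 2 * payoffLip n m B := by
  have h1 := abs_le.1 (abs_payoff_le hn hu hx i)
  have h2 := abs_le.1 (abs_payoff_le hn hu (deviate_single_mem hx i j) i)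
  unfold gain purePayoff
  refine max_le (by linarith [h1.1, h1.2, h2.1, h2.2]) (by positivity)

/-- A Lipschitz constant of `field` on the cube `[0, 2] ^ (n * m)`. -/
def fieldLip (n m B : ℕ) : ℕ := 9 * (m * m * (1 + payoffLip n m B))

theorem abs_field_sub_field_le (hn : 0 < n) (hm : 0 < m) {u u' : Game n m} {B : ℕ} {ε : ℝ}
    (hε : 0 ≤ ε) (hu : ∀ i s, |u i s| ≤ B) (huu : ∀ i s, |u i s - u' i s| ≤ ε)
    {x y : Fin n × Fin m → ℝ} (hx : ∀ ij, 0 ≤ x ij ∧ x ij ≤ 2)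
    (hy : ∀ ij, 0 ≤ y ij ∧ y ij ≤ 2) (hxy : ∀ ij, |x ij - y ij| ≤ ε) (ij : Fin n × Fin m) :
    |field u x ij - field u' y ij| ≤ fieldLip n m B * ε := by
  obtain ⟨i, j⟩ := ij
  set l : ℝ := (payoffLip n m B : ℝ) with hl
  have hl0 : 0 ≤ l := by positivity
  have hm' : (1 : ℝ) ≤ m := by exact_mod_cast hm
  have hg := abs_gain_sub_gain_le hε hu huu (x := WithLp.toLp 2 x) (y := WithLp.toLp 2 y)
    hx hy hxy i
  have hgx := gain_le hn hu (x := WithLp.toLp 2 x) hx i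
  have hsum : ∀ (f g : Fin m → ℝ) (c : ℝ), (∀ k, |f k - g k| ≤ c) →
      |∑ k, f k - ∑ k, g k| ≤ m * c := by
    intro f g c h
    rw [← Finset.sum_sub_distrib]
    refine (Finset.abs_sum_le_sum_abs _ _).trans ((Finset.sum_le_sum fun k _ => h k).trans ?_)
    simp
  have hsumle : ∀ (f : Fin m → ℝ) (c : ℝ), (∀ k, f k ≤ c) → ∑ k, f k ≤ m * c := by
    intro f c h
    refine (Finset.sum_le_sum fun k _ => h k).trans ?_
    simp
  simp only [field]
  have hS := hsum (fun k => x (i, k)) (fun k => y (i, k)) ε fun k => hxy _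
  have hG := hsum (fun k => gain u (WithLp.toLp 2 x) i k) (fun k => gain u' (WithLp.toLp 2 y) i k)
    _ hg
  have hSx := hsumle (fun k => x (i, k)) 2 fun k => (hx _).2
  have hGx := hsumle (fun k => gain u (WithLp.toLp 2 x) i k) _ hgx
  have hSx0 : 0 ≤ ∑ k, x (i, k) := Finset.sum_nonneg fun k _ => (hx _).1
  have hGx0 : 0 ≤ ∑ k, gain u (WithLp.toLp 2 x) i k :=
    Finset.sum_nonneg fun k _ => gain_nonneg _ _ _ _
  have hgj := hg j
  have hxj := hxy (i, j)
  have hyj := hy (i, j)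
  have hM : |max (1 - ∑ k, x (i, k)) 0 - max (1 - ∑ k, y (i, k)) 0| ≤ m * ε := by
    refine (abs_max_sub_max_le_abs _ _ _).trans ?_
    rw [show 1 - ∑ k, x (i, k) - (1 - ∑ k, y (i, k)) = -(∑ k, x (i, k) - ∑ k, y (i, k)) by ring,
      abs_neg]
    exact hS
  have hMx : max (1 - ∑ k, x (i, k)) 0 ≤ 1 := max_le (by linarith) zero_le_one
  have hMx0 : 0 ≤ max (1 - ∑ k, x (i, k)) 0 := le_max_right _ _
  generalize (∑ k, x (i, k)) = S at *
  generalize (∑ k, y (i, k)) = S' at *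
  generalize (∑ k, gain u (WithLp.toLp 2 x) i k) = G at *
  generalize (∑ k, gain u' (WithLp.toLp 2 y) i k) = G' at *
  generalize max (1 - S) 0 = T at *
  generalize max (1 - S') 0 = T' at *
  generalize gain u (WithLp.toLp 2 x) i j = g at *
  generalize gain u' (WithLp.toLp 2 y) i j = g' at *
  generalize x (i, j) = a at *
  generalize y (i, j) = b at *
  have hden : |(S + m * T + G) - (S' + m * T' + G')| ≤ (m + m * m + m * (2 * l)) * ε := by
    have h1 : |m * (T - T')| ≤ m * (m * ε) := by
      rw [abs_mul, abs_of_nonneg (by linarith : (0 : ℝ) ≤ m)]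
      gcongr
    calc _ = |(S - S') + m * (T - T') + (G - G')| := by ring_nf
      _ ≤ |S - S'| + |m * (T - T')| + |G - G'| := abs_add_three _ _ _
      _ ≤ m * ε + m * (m * ε) + m * (2 * l * ε) := by gcongr
      _ = _ := by ring
  have hden0 : 0 ≤ S + m * T + G := by positivity
  have hdenx : S + m * T + G ≤ 3 * m + 2 * (m * l) := by nlinarith
  have hprod : |a * (S + m * T + G) - b * (S' + m * T' + G')|
      ≤ ε * (3 * m + 2 * (m * l)) + 2 * ((m + m * m + m * (2 * l)) * ε) := by
    calc _ = |(a - b) * (S + m * T + G) + b * ((S + m * T + G) - (S' + m * T' + G'))| := by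
          ring_nf
      _ ≤ |a - b| * (S + m * T + G) + b * |(S + m * T + G) - (S' + m * T' + G')| := by
        refine (abs_add_le _ _).trans ?_
        rw [abs_mul, abs_mul, abs_of_nonneg hden0, abs_of_nonneg hyj.1]
      _ ≤ _ := by gcongr; exact hyj.2
  have hnum : |(a + T + g) - (b + T' + g')| ≤ ε + m * ε + 2 * l * ε := by
    calc _ = |(a - b) + (T - T') + (g - g')| := by ring_nf
      _ ≤ |a - b| + |T - T'| + |g - g'| := abs_add_three _ _ _
      _ ≤ _ := by gcongr
  calc |(a + T + g - a * (S + m * T + G)) - (b + T' + g' - b * (S' + m * T' + G'))|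
      = |((a + T + g) - (b + T' + g')) - (a * (S + m * T + G) - b * (S' + m * T' + G'))| := by
        ring_nf
    _ ≤ |(a + T + g) - (b + T' + g')| + |a * (S + m * T + G) - b * (S' + m * T' + G')| :=
        abs_sub _ _
    _ ≤ (1 + 6 * m + 2 * (m * m) + 2 * l + 6 * (m * l)) * ε := by linarith
    -- As m ≥ 1, all terms are bounded by multiples of m² and m² l, with the coefficients 1 + 6 + 2
    -- = 9 and 2 + 6 = 8.
    _ ≤ (9 * (m * m * (1 + l))) * ε := by
        refine mul_le_mul_of_nonneg_right ?_ hε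
        have h1 : (m : ℝ) ≤ m * m := by nlinarith
        have h2 : (m : ℝ) * l ≤ m * m * l := by gcongr
        have h3 : l ≤ m * l := by nlinarith
        nlinarith
    _ = _ := by simp [fieldLip, hl]

end Field
end NashGame


namespace NashGame

/-! ### Boxes in the grid and their refinements -/

section Boxes

variable {D : ℕ}

/-- The grid points of the orthant in the cube with the centre `c` and the edge `2 w`. -/
noncomputable def box (c : Fin D → ℤ) (w : ℕ) : Finset (Fin D → ℤ) :=
  Finset.Icc (fun r => max 0 (c r - w)) fun r => c r + w

theorem mem_box {c : Fin D → ℤ} {w : ℕ} {v : Fin D → ℤ} :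
    v ∈ box c w ↔ ∀ r, 0 ≤ v r ∧ c r - w ≤ v r ∧ v r ≤ c r + w := by
  simp only [box, Finset.mem_Icc, Pi.le_def, max_le_iff, ← forall_and, and_assoc]

/-- The points of the grid that is finer by the factor `q` that are rounded down into `box c w`. -/
noncomputable def fineBox (q : ℕ) (c : Fin D → ℤ) (w : ℕ) : Finset (Fin D → ℤ) :=
  Finset.Icc (fun r => max 0 (c r - w) * q) fun r => (c r + w + 1) * q - 1

theorem mem_fineBox {q : ℕ} (hq : 0 < q) {c : Fin D → ℤ} {w : ℕ} {v : Fin D → ℤ} :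
    v ∈ fineBox q c w ↔ (fun r => v r / (q : ℤ)) ∈ box c w := by
  have hq' : (0 : ℤ) < q := by exact_mod_cast hq
  simp only [box, fineBox, Finset.mem_Icc, Pi.le_def, Int.le_ediv_iff_mul_le hq']
  refine and_congr_right fun _ => forall_congr' fun r => ?_
  rw [← Int.lt_add_one_iff (a := v r / q), Int.ediv_lt_iff_lt_mul hq']
  omega

/-- A move of at most one unit in each coordinate can leave the box only from one of the faces c r ±
w. Where the box is cut off by the orthant it is not left, since `y` stays in the orthant; isolation
is therefore demanded on the faces c r ± w only. -/
theorem exists_eq_of_not_mem_box {c : Fin D → ℤ} {w : ℕ} {x y : Fin D → ℤ} (hx : x ∈ box c w)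
    (hy : y ∉ box c w) (hy0 : ∀ r, 0 ≤ y r) (hxy : ∀ r, |x r - y r| ≤ 1) :
    ∃ r, x r = c r - w ∨ x r = c r + w := by
  rw [mem_box] at hx hy
  push Not at hy
  obtain ⟨r, hr⟩ := hy
  have h1 := hr (hy0 r)
  have h2 := hx r
  have h3 := abs_le.1 (hxy r)
  refine ⟨r, ?_⟩
  by_cases h4 : c r - w ≤ y r
  · have := h1 h4
    omega
  · omega

theorem abs_ediv_sub_ediv_le {q x y : ℤ} (hq : 0 < q) (h : |x - y| ≤ q) :
    |x / q - y / q| ≤ 1 := by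
  rw [abs_le] at h ⊢
  have h1 : x / q ≤ (y + q) / q := Int.ediv_le_ediv hq (by omega)
  have h2 : y / q ≤ (x + q) / q := Int.ediv_le_ediv hq (by omega)
  rw [Int.add_ediv_of_dvd_right dvd_rfl, Int.ediv_self hq.ne'] at h1 h2
  omega

end Boxes

/-! ### Labelings adapted to the field; the parity of an isolating box -/

section Labelings

variable {n m : ℕ}

/-- The point with the coordinates `v / 2 ^ k`. -/
noncomputable def gridPoint (k : ℕ) (v : Fin (n * m) → ℤ) (ij : Fin n × Fin m) : ℝ :=
  (v (finProdFinEquiv ij) : ℝ) / 2 ^ k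

/-- The labels are, up to the error `ε`, coordinates in which the vector field is negative. -/
structure IsLabeling (u : Game n m) (ε : ℝ) (k : ℕ) (b : ℤ)
    (L : (Fin (n * m) → ℤ) → Fin (n * m + 1)) : Prop where
  pos : ∀ v r, L v = r.succ → 0 < v r
  le : ∀ v, L v = 0 → ∀ r, v r ≤ b
  field_le : ∀ v, (∀ r, 0 ≤ v r ∧ v r ≤ 2 * 2 ^ k) → ∀ ij, L v = (finProdFinEquiv ij).succ →
    field u (gridPoint k v) ij ≤ ε
  le_field : ∀ v, (∀ r, 0 ≤ v r ∧ v r ≤ 2 * 2 ^ k) → L v = 0 → ∀ ij,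
    -ε ≤ field u (gridPoint k v) ij

theorem IsLabeling.mono {u : Game n m} {ε ε' : ℝ} {k : ℕ} {b b' : ℤ}
    {L : (Fin (n * m) → ℤ) → Fin (n * m + 1)} (h : IsLabeling u ε k b L) (hε : ε ≤ ε')
    (hb : b ≤ b') : IsLabeling u ε' k b' L where
  pos := h.pos
  le v hv r := (h.le v hv r).trans hb
  field_le v hv ij hij := (h.field_le v hv ij hij).trans hε
  le_field v hv h0 ij := (neg_le_neg hε).trans (h.le_field v hv h0 ij)

theorem IsLabeling.mix {u : Game n m} {ε : ℝ} {k : ℕ} {b : ℤ}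
    {L L' L'' : (Fin (n * m) → ℤ) → Fin (n * m + 1)} (h : IsLabeling u ε k b L)
    (h' : IsLabeling u ε k b L') (h'' : ∀ v, L'' v = L v ∨ L'' v = L' v) :
    IsLabeling u ε k b L'' where
  pos v r hv := (h'' v).elim (fun e => h.pos v r (e ▸ hv)) fun e => h'.pos v r (e ▸ hv)
  le v hv := (h'' v).elim (fun e => h.le v (e ▸ hv)) fun e => h'.le v (e ▸ hv)
  field_le v hv ij hij := (h'' v).elim (fun e => h.field_le v hv ij (e ▸ hij))
    fun e => h'.field_le v hv ij (e ▸ hij)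
  le_field v hv h0 := (h'' v).elim (fun e => h.le_field v hv (e ▸ h0))
    fun e => h'.le_field v hv (e ▸ h0)

theorem gridPoint_mem {k : ℕ} {v : Fin (n * m) → ℤ} (hv : ∀ r, 0 ≤ v r ∧ v r ≤ 2 * 2 ^ k)
    (ij : Fin n × Fin m) : 0 ≤ gridPoint k v ij ∧ gridPoint k v ij ≤ 2 := by
  have h1 : (0 : ℝ) ≤ v (finProdFinEquiv ij) := by exact_mod_cast (hv _).1
  have h2 : (v (finProdFinEquiv ij) : ℝ) ≤ 2 * 2 ^ k := by exact_mod_cast (hv _).2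
  unfold gridPoint
  exact ⟨by positivity, by rw [div_le_iff₀ (by positivity)]; exact h2⟩

theorem abs_gridPoint_sub_le {k : ℕ} {v w : Fin (n * m) → ℤ} {c : ℤ} (h : ∀ r, |v r - w r| ≤ c)
    (ij : Fin n × Fin m) : |gridPoint k v ij - gridPoint k w ij| ≤ c / 2 ^ k := by
  unfold gridPoint
  rw [← sub_div, abs_div, abs_of_pos (by positivity : (0 : ℝ) < 2 ^ k)]
  gcongr
  exact_mod_cast h _

theorem abs_kuhnVertex_sub_le {D : ℕ} (a : Fin D → ℤ) (τ : Equiv.Perm (Fin D))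
    (s t : Fin (D + 1)) (r : Fin D) : |kuhnVertex a τ s r - kuhnVertex a τ t r| ≤ 1 := by
  have h1 := le_kuhnVertex a τ s r
  have h2 := le_kuhnVertex a τ t r
  rw [abs_le]; omega

/-- The vertex labeled 0 bounds every component of the field from below, the vertex with the label
of `ij` bounds this component from above, and the Lipschitz bound carries both to any other vertex.
-/
theorem abs_field_le_of_isFull (hn : 0 < n) (hm : 0 < m) {u : Game n m} {B : ℕ}
    (hu : ∀ i s, |u i s| ≤ B) {ε : ℝ} {k : ℕ} {b : ℤ} (hb : b + 1 ≤ 2 * 2 ^ k)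
    {L : (Fin (n * m) → ℤ) → Fin (n * m + 1)} (hL : IsLabeling u ε k b L)
    {a : Fin (n * m) → ℤ} {τ : Equiv.Perm (Fin (n * m))} (h : IsFull L a τ) (t : Fin (n * m + 1))
    (ij : Fin n × Fin m) :
    |field u (gridPoint k (kuhnVertex a τ t)) ij| ≤ ε + fieldLip n m B / 2 ^ k := by
  have hbd : ∀ t r, 0 ≤ kuhnVertex a τ t r ∧ kuhnVertex a τ t r ≤ 2 * 2 ^ k := fun t r =>
    ⟨(h.bounds hL.pos hL.le t r).1, (h.bounds hL.pos hL.le t r).2.trans hb⟩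
  have hlip : ∀ s t, |field u (gridPoint k (kuhnVertex a τ s)) ij
      - field u (gridPoint k (kuhnVertex a τ t)) ij| ≤ fieldLip n m B / 2 ^ k := by
    intro s t
    have := abs_field_sub_field_le hn hm (ε := 1 / 2 ^ k) (u := u) (u' := u) (by positivity) hu
      (fun i s => by rw [sub_self, abs_zero]; positivity) (gridPoint_mem (hbd s))
      (gridPoint_mem (hbd t)) (fun ij => by
        have := abs_gridPoint_sub_le (k := k) (c := 1) (abs_kuhnVertex_sub_le a τ s t) ij
        rwa [Int.cast_one] at this) ij
    rwa [mul_one_div] at this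
  obtain ⟨s, hs⟩ := h.exists_label 0
  obtain ⟨s', hs'⟩ := h.exists_label (finProdFinEquiv ij).succ
  have h1 := hL.le_field _ (hbd s) hs ij
  have h2 := hL.field_le _ (hbd s') ij hs'
  have h3 := abs_le.1 (hlip t s)
  have h4 := abs_le.1 (hlip t s')
  rw [abs_le]
  constructor <;> linarith [h3.1, h4.2]

theorem abs_gridPoint_floor_sub_le {k k' : ℕ} (hk : k ≤ k') (v : Fin (n * m) → ℤ)
    (ij : Fin n × Fin m) :
    |gridPoint k (fun r => v r / ((2 ^ (k' - k) : ℕ) : ℤ)) ij - gridPoint k' v ij| ≤ 1 / 2 ^ k := by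
  unfold gridPoint
  set q : ℤ := ((2 ^ (k' - k) : ℕ) : ℤ) with hq
  have hq0 : 0 < q := by positivity
  have hqr : (q : ℝ) * 2 ^ k = 2 ^ k' := by
    rw [hq]; push_cast; rw [← pow_add, Nat.sub_add_cancel hk]
  set x := v (finProdFinEquiv ij)
  have h1 : ((x / q : ℤ) : ℝ) * q ≤ x := by exact_mod_cast Int.ediv_mul_le x hq0.ne'
  have h2 : (x : ℝ) ≤ ((x / q : ℤ) : ℝ) * q + q := by
    have := Int.lt_ediv_add_one_mul_self x hq0
    have h3 : x ≤ x / q * q + q := by linarith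
    exact_mod_cast h3
  have hq0' : (0 : ℝ) < q := by exact_mod_cast hq0
  have hk0 : (0 : ℝ) < 2 ^ k := by positivity
  rw [← hqr]
  have h4 : ((x / q : ℤ) : ℝ) / 2 ^ k - x / (q * 2 ^ k) = (((x / q : ℤ) : ℝ) * q - x) / (q * 2 ^ k) := by
    field_simp
  rw [h4, abs_div, abs_of_pos (by positivity : (0 : ℝ) < q * 2 ^ k), div_le_div_iff₀ (by positivity) hk0,
    one_mul]
  refine mul_le_mul_of_nonneg_right ?_ hk0.le
  rw [abs_le]
  constructor <;> linarith

theorem floor_mem {k k' : ℕ} (hk : k ≤ k') {x : ℤ} (hx : 0 ≤ x ∧ x ≤ 2 * 2 ^ k') :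
    0 ≤ x / ((2 ^ (k' - k) : ℕ) : ℤ) ∧ x / ((2 ^ (k' - k) : ℕ) : ℤ) ≤ 2 * 2 ^ k := by
  have hq0 : (0 : ℤ) < ((2 ^ (k' - k) : ℕ) : ℤ) := by positivity
  refine ⟨Int.ediv_nonneg hx.1 hq0.le, ?_⟩
  have h1 : (2 : ℤ) * 2 ^ k' = 2 * 2 ^ k * ((2 ^ (k' - k) : ℕ) : ℤ) := by
    push_cast; rw [mul_assoc, ← pow_add, Nat.add_sub_cancel' hk]
  have h2 := Int.ediv_le_ediv hq0 hx.2
  rwa [h1, Int.mul_ediv_cancel _ hq0.ne'] at h2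

/-- Rounding down to the coarse grid moves a point by at most 1 / 2^k, which costs Λ / 2^k. A
rounded coordinate at most 2^k means a coordinate below 2^k' + 2^(k' - k), hence the new bound. -/
theorem IsLabeling.refine (hn : 0 < n) (hm : 0 < m) {u : Game n m} {B : ℕ}
    (hu : ∀ i s, |u i s| ≤ B) {ε : ℝ} {k k' : ℕ} (hk : k ≤ k')
    {L : (Fin (n * m) → ℤ) → Fin (n * m + 1)} (hL : IsLabeling u ε k (2 ^ k) L) :
    IsLabeling u (ε + fieldLip n m B / 2 ^ k) k' (2 * 2 ^ k' - 1)
      (fun v => L fun r => v r / ((2 ^ (k' - k) : ℕ) : ℤ)) := by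
  have hq0 : (0 : ℤ) < ((2 ^ (k' - k) : ℕ) : ℤ) := by positivity
  have hlip : ∀ v : Fin (n * m) → ℤ, (∀ r, 0 ≤ v r ∧ v r ≤ 2 * 2 ^ k') → ∀ ij,
      |field u (gridPoint k (fun r => v r / ((2 ^ (k' - k) : ℕ) : ℤ))) ij
        - field u (gridPoint k' v) ij| ≤ fieldLip n m B / 2 ^ k := by
    intro v hv ij
    have := abs_field_sub_field_le hn hm (ε := 1 / 2 ^ k) (u := u) (u' := u) (by positivity) hu
      (fun i s => by rw [sub_self, abs_zero]; positivity)
      (gridPoint_mem fun r => floor_mem hk (hv r))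
      (gridPoint_mem hv) (abs_gridPoint_floor_sub_le hk v) ij
    rwa [mul_one_div] at this
  constructor
  · intro v r hv
    have := hL.pos _ _ hv
    by_contra h
    have h1 : v r / ((2 ^ (k' - k) : ℕ) : ℤ) ≤ 0 / ((2 ^ (k' - k) : ℕ) : ℤ) :=
      Int.ediv_le_ediv hq0 (by omega)
    rw [Int.zero_ediv] at h1
    omega
  · intro v hv r
    have h1 := hL.le _ hv r
    have h2 : v r < (2 ^ k + 1) * ((2 ^ (k' - k) : ℕ) : ℤ) :=
      (Int.ediv_lt_iff_lt_mul hq0).1 (by omega)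
    have h3 : (2 ^ k : ℤ) * ((2 ^ (k' - k) : ℕ) : ℤ) = 2 ^ k' := by
      push_cast; rw [← pow_add, Nat.add_sub_cancel' hk]
    have h4 : ((2 ^ (k' - k) : ℕ) : ℤ) ≤ 2 ^ k' := by
      push_cast; exact pow_le_pow_right₀ (by norm_num) (Nat.sub_le _ _)
    rw [add_mul, h3] at h2
    omega
  · intro v hv ij hij
    have h1 := hL.field_le _ (fun r => floor_mem hk (hv r)) ij hij
    have h2 := abs_le.1 (hlip v hv ij)
    linarith [h2.1]
  · intro v hv h0 ij
    have h1 := hL.le_field _ (fun r => floor_mem hk (hv r)) h0 ij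
    have h2 := abs_le.1 (hlip v hv ij)
    linarith [h2.2]

/-- At the boundary of the box the vector field is larger than `θ / 2 ^ k`. -/
def IsIsolating (u : Game n m) (θ : ℝ) (k : ℕ) (c : Fin (n * m) → ℤ) (w : ℕ) : Prop :=
  ∀ v ∈ box c w, (∀ r, 0 ≤ v r ∧ v r ≤ 2 * 2 ^ k) → (∃ r, v r = c r - w ∨ v r = c r + w) →
    ∃ ij, θ / 2 ^ k < |field u (gridPoint k v) ij|

/-- The labeling of the fine level and the coarse one pulled back are compared through mixtures, of
error at most 2Λ / 2^k. A full simplex adds Λ / 2^k' and rounding its vertex adds Λ / 2^k, together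
at most 4Λ / 2^k. So no full simplex of a mixture crosses a face of the isolating box. -/
theorem parity_fineBox (hn : 0 < n) (hm : 0 < m) {u : Game n m} {B : ℕ}
    (hu : ∀ i s, |u i s| ≤ B) {L : ℕ → (Fin (n * m) → ℤ) → Fin (n * m + 1)}
    (hL : ∀ k, IsLabeling u (fieldLip n m B / 2 ^ k) k (2 ^ k) (L k)) {k k' : ℕ} (hk : k ≤ k')
    {c : Fin (n * m) → ℤ} {w : ℕ} (hiso : IsIsolating u (4 * fieldLip n m B) k c w) :
    parity (L k') (fineBox (2 ^ (k' - k)) c w) = parity (L k) (box c w) := by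
  have : NeZero (n * m) := ⟨(Nat.mul_pos hn hm).ne'⟩
  have hq : 0 < 2 ^ (k' - k) := by positivity
  have hq0 : (0 : ℤ) < ((2 ^ (k' - k) : ℕ) : ℤ) := by positivity
  rw [← parity_refine (L k) (2 ^ (k' - k)) hq (box c w) (fineBox (2 ^ (k' - k)) c w)
    fun v => mem_fineBox hq]
  set Λ : ℝ := (fieldLip n m B : ℝ) with hΛ
  have hΛ0 : 0 ≤ Λ := by positivity
  have hkk : Λ / 2 ^ k' ≤ Λ / 2 ^ k :=
    div_le_div_of_nonneg_left hΛ0 (by positivity) (pow_le_pow_right₀ (by norm_num) hk)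
  have hk0 : 0 ≤ Λ / 2 ^ k := by positivity
  have h1k : (1 : ℤ) ≤ 2 ^ k' := one_le_pow₀ (by norm_num)
  refine parity_eq_of_isolated _ _ _ fun L'' hL'' a τ t hf => ?_
  have hlab : IsLabeling u (Λ / 2 ^ k + Λ / 2 ^ k) k' (2 * 2 ^ k' - 1) L'' :=
    IsLabeling.mix ((hL k').mono (by linarith) (by linarith))
      ((hL k).refine hn hm hu hk) hL''
  have hbd : ∀ t r, 0 ≤ kuhnVertex a τ t r ∧ kuhnVertex a τ t r ≤ 2 * 2 ^ k' := fun t r => by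
    have := hf.bounds hlab.pos hlab.le t r
    omega
  have key : ∀ s t, kuhnVertex a τ s ∈ fineBox (2 ^ (k' - k)) c w →
      kuhnVertex a τ t ∈ fineBox (2 ^ (k' - k)) c w := by
    intro s t hs
    by_contra ht
    rw [mem_fineBox hq] at hs ht
    obtain hr := exists_eq_of_not_mem_box hs ht (fun r => (floor_mem hk (hbd t r)).1) fun r =>
      abs_ediv_sub_ediv_le hq0 ((abs_kuhnVertex_sub_le a τ s t r).trans (by omega))
    obtain ⟨ij, hij⟩ := hiso _ hs (fun r => floor_mem hk (hbd s r)) hr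
    have h1 := abs_field_le_of_isFull hn hm hu (by omega) hlab hf s ij
    have h2 := abs_field_sub_field_le hn hm (ε := 1 / 2 ^ k) (u := u) (u' := u) (by positivity) hu
      (fun i s => by rw [sub_self, abs_zero]; positivity)
      (gridPoint_mem fun r => floor_mem hk (hbd s r))
      (gridPoint_mem (hbd s)) (abs_gridPoint_floor_sub_le hk (kuhnVertex a τ s)) ij
    rw [mul_one_div] at h2
    have h3 := abs_sub_abs_le_abs_sub
      (field u (gridPoint k (fun r => kuhnVertex a τ s r / ((2 ^ (k' - k) : ℕ) : ℤ))) ij)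
      (field u (gridPoint k' (kuhnVertex a τ s)) ij)
    rw [mul_div_assoc] at hij
    linarith
  have h0 : kuhnVertex a τ 0 = a := by ext r; simp [kuhnVertex]
  constructor
  · intro h
    have := key t 0 h
    rwa [h0] at this
  · intro h
    rw [← h0] at h
    exact key 0 t h

end Labelings
end NashGame


/-! ### Small odd boxes around single zeros -/

namespace NashGame

theorem exists_separation {ι : Type*} [Fintype ι] {E : Set (ι → ℝ)} (hE : E.Finite) :
    ∃ s > 0, ∀ x ∈ E, ∀ y ∈ E, (∀ i, |x i - y i| < s) → x = y := by
  obtain ⟨C, hC, h⟩ := hE.relatively_discrete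
  obtain ⟨s, hs0, hs⟩ : ∃ s : ℝ, 0 < s ∧ ENNReal.ofReal s ≤ C := by
    by_cases hCt : C = ⊤
    · exact ⟨1, one_pos, by simp [hCt]⟩
    · exact ⟨C.toReal, ENNReal.toReal_pos hC.ne' hCt, by rw [ENNReal.ofReal_toReal hCt]⟩
  refine ⟨s, hs0, fun x hx y hy hxy => ?_⟩
  by_contra hne
  have h1 := hs.trans (h x hx y hy hne)
  rw [edist_dist, ENNReal.ofReal_le_ofReal_iff dist_nonneg] at h1
  exact absurd ((dist_pi_lt_iff hs0).2 fun i => by rw [Real.dist_eq]; exact hxy i) (not_lt.2 h1)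

section Subdivision

variable {n m : ℕ}

/-- The zeros of the vector field in the orthant. -/
def zeros (u : Game n m) : Set (Fin n × Fin m → ℝ) :=
  {e | (∀ ij, 0 ≤ e ij) ∧ ∀ ij, field u e ij = 0}

theorem zeros_le_one (hm : 0 < m) {u : Game n m} {e : Fin n × Fin m → ℝ} (he : e ∈ zeros u)
    (ij : Fin n × Fin m) : e ij ≤ 1 := by
  have h := ((mem_profiles_of_field_eq_zero hm he.1 he.2).1 ij.1)
  calc e ij ≤ ∑ j, e (ij.1, j) :=
        Finset.single_le_sum (f := fun j => e (ij.1, j)) (fun j _ => he.1 _) (Finset.mem_univ ij.2)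
    _ = 1 := h.2

theorem finite_zeros (hm : 0 < m) {u : Game n m} (hu : SeqLocNonconst u) : (zeros u).Finite := by
  refine Set.Finite.of_finite_image (f := WithLp.toLp 2)
    ((finite_gain_eq_zero hu).subset ?_) (WithLp.toLp_injective 2).injOn
  rintro _ ⟨e, he, rfl⟩
  exact mem_profiles_of_field_eq_zero hm he.1 he.2

/-- The grid point below `x`. -/
noncomputable def gridFloor (k : ℕ) (x : Fin n × Fin m → ℝ) (r : Fin (n * m)) : ℤ :=
  ⌊x (finProdFinEquiv.symm r) * 2 ^ k⌋

theorem gridFloor_le (k : ℕ) (x : Fin n × Fin m → ℝ) (ij : Fin n × Fin m) :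
    (gridFloor k x (finProdFinEquiv ij) : ℝ) ≤ x ij * 2 ^ k := by
  simpa [gridFloor] using Int.floor_le (x ij * 2 ^ k)

theorem lt_gridFloor (k : ℕ) (x : Fin n × Fin m → ℝ) (ij : Fin n × Fin m) :
    x ij * 2 ^ k < gridFloor k x (finProdFinEquiv ij) + 1 := by
  simp [gridFloor]

theorem gridPoint_mul (k : ℕ) (v : Fin (n * m) → ℤ) (ij : Fin n × Fin m) :
    (v (finProdFinEquiv ij) : ℝ) = gridPoint k v ij * 2 ^ k := by
  simp [gridPoint]

/-- The additional 1 accounts for rounding `e` down to the centre of the box. -/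
theorem abs_gridPoint_sub_lt_of_mem_box {k w : ℕ} {e : Fin n × Fin m → ℝ} {v : Fin (n * m) → ℤ}
    (hv : v ∈ box (gridFloor k e) w) (ij : Fin n × Fin m) :
    |gridPoint k v ij - e ij| ≤ (w + 1) / 2 ^ k := by
  have hk : (0 : ℝ) < 2 ^ k := by positivity
  obtain ⟨-, h1, h2⟩ := mem_box.1 hv (finProdFinEquiv ij)
  have h1' : (gridFloor k e (finProdFinEquiv ij) : ℝ) - w ≤ v (finProdFinEquiv ij) := by
    exact_mod_cast h1
  have h2' : (v (finProdFinEquiv ij) : ℝ) ≤ gridFloor k e (finProdFinEquiv ij) + w := by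
    exact_mod_cast h2
  have h3 := gridFloor_le k e ij
  have h4 := lt_gridFloor k e ij
  rw [gridPoint_mul k v] at h1' h2'
  rw [le_div_iff₀ hk, ← abs_of_pos hk, ← abs_mul, abs_le, sub_mul]
  constructor <;> linarith

theorem mem_box_gridFloor {k w : ℕ} {e : Fin n × Fin m → ℝ} {v : Fin (n * m) → ℤ}
    (hv0 : ∀ r, 0 ≤ v r) (hv : ∀ ij, |gridPoint k v ij - e ij| * 2 ^ k ≤ w - 1) :
    v ∈ box (gridFloor k e) w := by
  rw [mem_box]
  intro r
  obtain ⟨ij, rfl⟩ := finProdFinEquiv.surjective r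
  have hk : (0 : ℝ) < 2 ^ k := by positivity
  have h := hv ij
  rw [← abs_of_pos hk, ← abs_mul, abs_le, sub_mul, ← gridPoint_mul] at h
  have h3 := gridFloor_le k e ij
  have h4 := lt_gridFloor k e ij
  refine ⟨hv0 _, ?_, ?_⟩
  · have : (gridFloor k e (finProdFinEquiv ij) : ℝ) - w ≤ v (finProdFinEquiv ij) := by linarith [h.1]
    exact_mod_cast this
  · have : (v (finProdFinEquiv ij) : ℝ) ≤ gridFloor k e (finProdFinEquiv ij) + w := by linarith [h.2]
    exact_mod_cast this

theorem gridFloor_nonneg {k : ℕ} {e : Fin n × Fin m → ℝ} (he : ∀ ij, 0 ≤ e ij) (r : Fin (n * m)) :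
    0 ≤ gridFloor k e r :=
  Int.floor_nonneg.2 (mul_nonneg (he _) (by positivity))

theorem gridFloor_mem_box {k w : ℕ} {e : Fin n × Fin m → ℝ} (he : ∀ ij, 0 ≤ e ij) :
    gridFloor k e ∈ box (gridFloor k e) w :=
  mem_box.2 fun r => ⟨gridFloor_nonneg he r, by omega, by omega⟩

theorem le_two_of_mem_box {k w : ℕ} {e : Fin n × Fin m → ℝ} (he : ∀ ij, e ij ≤ 1) (hw : w ≤ 2 ^ k)
    {v : Fin (n * m) → ℤ} (hv : v ∈ box (gridFloor k e) w) (r : Fin (n * m)) :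
    0 ≤ v r ∧ v r ≤ 2 * 2 ^ k := by
  obtain ⟨h0, h1, h2⟩ := mem_box.1 hv r
  refine ⟨h0, ?_⟩
  have h3 : gridFloor k e r ≤ 2 ^ k := by
    rw [gridFloor, Int.floor_le_iff]
    push_cast
    have := mul_le_mul_of_nonneg_right (he (finProdFinEquiv.symm r))
      (by positivity : (0 : ℝ) ≤ 2 ^ k)
    linarith
  have hw' : (w : ℤ) ≤ 2 ^ k := by exact_mod_cast hw
  omega

/-- A box of a coarse grid that isolates some zeros contains each of the small boxes around zeros
that it meets. -/
theorem box_subset_fineBox (hn : 0 < n) (hm : 0 < m) {u : Game n m} {B : ℕ}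
    (hu : ∀ i s, |u i s| ≤ B) {k k' : ℕ} (hk : k ≤ k')
    {c : Fin (n * m) → ℤ} {w : ℕ} (hiso : IsIsolating u (4 * fieldLip n m B) k c w)
    {e : Fin n × Fin m → ℝ} (he : e ∈ zeros u) {w' : ℕ}
    (hw' : 2 * (w' + 1) ≤ 2 ^ (k' - k)) {x : Fin (n * m) → ℤ}
    (hx : x ∈ box (gridFloor k' e) w') (hxR : x ∈ fineBox (2 ^ (k' - k)) c w) :
    box (gridFloor k' e) w' ⊆ fineBox (2 ^ (k' - k)) c w := by
  intro y hy
  by_contra hyR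
  have hq : 0 < 2 ^ (k' - k) := by positivity
  have hq0 : (0 : ℤ) < ((2 ^ (k' - k) : ℕ) : ℤ) := by positivity
  have hle : w' ≤ 2 ^ k' := by
    have : 2 ^ (k' - k) ≤ 2 ^ k' := Nat.pow_le_pow_right (by norm_num) (Nat.sub_le _ _)
    omega
  rw [mem_fineBox hq] at hxR hyR
  have hx2 := le_two_of_mem_box (zeros_le_one hm he) hle hx
  have hy2 := le_two_of_mem_box (zeros_le_one hm he) hle hy
  have hxy : ∀ r, |x r - y r| ≤ ((2 ^ (k' - k) : ℕ) : ℤ) := by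
    intro r
    have h1 := mem_box.1 hx r
    have h2 := mem_box.1 hy r
    have h3 : (2 : ℤ) * (w' + 1) ≤ ((2 ^ (k' - k) : ℕ) : ℤ) := by exact_mod_cast hw'
    rw [abs_le]
    omega
  have hr := exists_eq_of_not_mem_box hxR hyR (fun r => (floor_mem hk (hy2 r)).1)
    fun r => abs_ediv_sub_ediv_le hq0 (hxy r)
  obtain ⟨ij, hij⟩ := hiso _ hxR (fun r => floor_mem hk (hx2 r)) hr
  -- The face point is `x` rounded down, and `x` is within 1 / 2^k of `e`. So the field there is at
  -- most 2Λ / 2^k, against more than 4Λ / 2^k by isolation.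
  have hw2 : ((w' : ℝ) + 1) / 2 ^ k' ≤ 1 / 2 ^ k := by
    rw [div_le_div_iff₀ (by positivity) (by positivity), one_mul]
    have h1 : w' + 1 ≤ 2 ^ (k' - k) := by omega
    have h2 : (w' + 1) * 2 ^ k ≤ 2 ^ k' := by
      calc _ ≤ 2 ^ (k' - k) * 2 ^ k := Nat.mul_le_mul_right _ h1
        _ = 2 ^ k' := by rw [← pow_add, Nat.sub_add_cancel hk]
    exact_mod_cast h2
  have h2 := abs_field_sub_field_le hn hm (ε := 2 * (1 / 2 ^ k)) (u := u) (u' := u)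
    (by positivity) hu (fun i s => by rw [sub_self, abs_zero]; positivity)
    (gridPoint_mem fun r => floor_mem hk (hx2 r))
    (y := e) (fun ij => ⟨he.1 ij, (zeros_le_one hm he ij).trans (by norm_num)⟩)
    (fun ij => by
      have h3 := abs_gridPoint_floor_sub_le hk x ij
      have h4 := abs_gridPoint_sub_lt_of_mem_box hx ij
      have h5 := abs_sub_le (gridPoint k (fun r => x r / ((2 ^ (k' - k) : ℕ) : ℤ)) ij)
        (gridPoint k' x ij) (e ij)
      linarith) ij
  rw [he.2, sub_zero] at h2
  have h6 : (0 : ℝ) ≤ fieldLip n m B / 2 ^ k := by positivity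
  rw [mul_div_assoc] at hij
  have h7 : (fieldLip n m B : ℝ) * (2 * (1 / 2 ^ k)) = 2 * (fieldLip n m B / 2 ^ k) := by ring
  linarith

/-- An isolating box of odd parity contains, at all sufficiently fine levels, a small isolating box
of odd parity around one of finitely many zeros. -/
theorem exists_small_box (hn : 0 < n) (hm : 0 < m) {u : Game n m} (hfin : (zeros u).Finite)
    {B : ℕ} (hu : ∀ i s, |u i s| ≤ B) {L : ℕ → (Fin (n * m) → ℤ) → Fin (n * m + 1)}
    (hL : ∀ k, IsLabeling u (fieldLip n m B / 2 ^ k) k (2 ^ k) (L k)) {k : ℕ}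
    {c : Fin (n * m) → ℤ} {w : ℕ} (hiso : IsIsolating u (4 * fieldLip n m B) k c w)
    (hodd : parity (L k) (box c w) = 1) {η : ℝ} (hη : 0 < η) :
    ∃ k₁ ≥ k, ∀ k' ≥ k₁, ∃ e ∈ zeros u, ∃ w' ≤ 2 ^ k',
      IsIsolating u (6 * fieldLip n m B) k' (gridFloor k' e) w' ∧
      parity (L k') (box (gridFloor k' e) w') = 1 ∧
      box (gridFloor k' e) w' ⊆ fineBox (2 ^ (k' - k)) c w ∧ ((w' : ℝ) + 1) / 2 ^ k' ≤ η := by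
  classical
  set Λ : ℝ := (fieldLip n m B : ℝ) with hΛ
  have hΛ0 : 0 ≤ Λ := by positivity
  obtain ⟨s₀, hs₀, hsep⟩ := exists_separation hfin
  have hk0 : (0 : ℝ) < 1 / 2 ^ k := by positivity
  -- `s` is the approximate half-edge of the new boxes: s₀ / 3 keeps boxes of different zeros
  -- disjoint, a quarter of the coarse mesh is what `box_subset_fineBox` needs, η / 2 ensures the
  -- final size, and 1 ensures w' ≤ 2^k'.
  obtain ⟨s, hs, hs1, hs2, hs3, hs4⟩ : ∃ s : ℝ, 0 < s ∧ s ≤ s₀ / 3 ∧ s ≤ 1 / 2 ^ k / 4 ∧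
      s ≤ η / 2 ∧ s ≤ 1 := by
    refine ⟨min (min (s₀ / 3) (1 / 2 ^ k / 4)) (min (η / 2) 1), ?_, ?_, ?_, ?_, ?_⟩
    · refine lt_min (lt_min ?_ ?_) (lt_min ?_ one_pos) <;> linarith
    · exact (min_le_left _ _).trans (min_le_left _ _)
    · exact (min_le_left _ _).trans (min_le_right _ _)
    · exact (min_le_right _ _).trans (min_le_left _ _)
    · exact (min_le_right _ _).trans (min_le_right _ _)
  -- A small field forces a zero within s / 4, well inside a box of half-edge about s.
  obtain ⟨δ, hδ, hnear⟩ := exists_near_zero_of_field_small u (s := s / 4) (by linarith)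
  -- 8 / s makes the rounding of the half-edge harmless. 6Λ / δ brings the isolation threshold, and
  -- with it the field at full simplices, below δ.
  obtain ⟨k₀, hk₀⟩ : ∃ k₀ : ℕ, max (8 / s) (6 * Λ / δ) < 2 ^ k₀ :=
    pow_unbounded_of_one_lt _ (by norm_num)
  refine ⟨max k k₀, le_max_left _ _, fun k' hk' => ?_⟩
  have hkk : k ≤ k' := (le_max_left _ _).trans hk'
  have hK : max (8 / s) (6 * Λ / δ) < 2 ^ k' :=
    hk₀.trans_le (pow_le_pow_right₀ (by norm_num) ((le_max_right _ _).trans hk'))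
  set K : ℝ := 2 ^ k' with hKdef
  have hK0 : 0 < K := by positivity
  have hsK : 8 < s * K := by
    have := (le_max_left _ _).trans_lt hK
    rwa [div_lt_iff₀ hs, mul_comm] at this
  have hδK : 6 * Λ / K ≤ δ := by
    have := (le_max_right _ _).trans_lt hK
    rw [div_lt_iff₀ hδ] at this
    rw [div_le_iff₀ hK0]
    linarith
  have hΛK : 0 ≤ Λ / K := by positivity
  set w' : ℕ := ⌊s * K⌋₊ with hw'
  have hw1 : (w' : ℝ) ≤ s * K := Nat.floor_le (by linarith)
  have hw2 : s * K < w' + 1 := Nat.lt_floor_add_one _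
  have hwK : ((w' : ℝ) + 1) / K ≤ s + s / 8 := by
    rw [div_le_iff₀ hK0]; linarith
  have hwle : w' ≤ 2 ^ k' := by
    have : (w' : ℝ) ≤ (2 ^ k' : ℕ) := by
      push_cast
      rw [← hKdef]
      nlinarith
    exact_mod_cast this
  have hwq : 2 * (w' + 1) ≤ 2 ^ (k' - k) := by
    have h1 : (2 ^ (k' - k) : ℝ) * 2 ^ k = K := by
      rw [hKdef, ← pow_add, Nat.sub_add_cancel hkk]
    have h2 : s * K ≤ 2 ^ (k' - k) / 4 := by
      rw [← h1]
      have h3 : s * 2 ^ k ≤ 1 / 4 := by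
        have h4 : s * 2 ^ k ≤ 1 / 2 ^ k / 4 * 2 ^ k := by gcongr
        refine h4.trans_eq ?_
        field_simp
      calc s * (2 ^ (k' - k) * 2 ^ k) = 2 ^ (k' - k) * (s * 2 ^ k) := by ring
        _ ≤ 2 ^ (k' - k) * (1 / 4) := by gcongr
        _ = _ := by ring
    have : ((2 * (w' + 1) : ℕ) : ℝ) ≤ (2 ^ (k' - k) : ℕ) := by
      push_cast
      linarith
    exact_mod_cast this
  have hboxdist : ∀ e : Fin n × Fin m → ℝ, ∀ v ∈ box (gridFloor k' e) w', ∀ ij,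
      |gridPoint k' v ij - e ij| ≤ s + s / 8 := fun e v hv ij =>
    (abs_gridPoint_sub_lt_of_mem_box hv ij).trans hwK
  have hclose : ∀ e ∈ zeros u, ∀ e' ∈ zeros u, ∀ x : Fin n × Fin m → ℝ,
      (∀ ij, |x ij - e ij| ≤ s + s / 8) → (∀ ij, |x ij - e' ij| ≤ s + s / 8) → e = e' := by
    intro e he e' he' x h1 h2
    refine hsep e he e' he' fun ij => ?_
    have h3 := abs_sub_le (e ij) (x ij) (e' ij)
    rw [abs_sub_comm (e ij) (x ij)] at h3
    have := h1 ij
    have := h2 ij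
    linarith
  -- Where the field is below the threshold there is a zero within s / 4. By separation it is `e`
  -- itself, but points of the faces are at distance about s from `e`.
  have hsmall : ∀ e ∈ zeros u, IsIsolating u (6 * Λ) k' (gridFloor k' e) w' := by
    rintro e he v hv hv2 ⟨r, hr⟩
    by_contra! hno
    obtain ⟨e', he'0, he'1, hee⟩ := hnear _ (gridPoint_mem hv2) fun ij => (hno ij).trans hδK
    have heq := hclose e he e' ⟨he'0, he'1⟩ _ (hboxdist e v hv) fun ij => by
      have := hee ij
      linarith
    subst heq
    obtain ⟨ij, rfl⟩ := finProdFinEquiv.surjective r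
    have h1 := abs_lt.1 (hee ij)
    have h2 := gridFloor_le k' e ij
    have h3 := lt_gridFloor k' e ij
    have h4 : gridPoint k' v ij * K - e ij * K < s / 4 * K := by
      rw [← sub_mul]; exact mul_lt_mul_of_pos_right h1.2 hK0
    have h5 : -(s / 4) * K < gridPoint k' v ij * K - e ij * K := by
      rw [← sub_mul]; exact mul_lt_mul_of_pos_right h1.1 hK0
    rw [hKdef, ← gridPoint_mul, ← hKdef] at h4 h5
    rcases hr with hr | hr
    · have : (v (finProdFinEquiv ij) : ℝ) = gridFloor k' e (finProdFinEquiv ij) - w' := by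
        rw [hr]; push_cast; ring
      linarith
    · have : (v (finProdFinEquiv ij) : ℝ) = gridFloor k' e (finProdFinEquiv ij) + w' := by
        rw [hr]; push_cast; ring
      linarith
  set R := fineBox (2 ^ (k' - k)) c w with hR
  have hpar : parity (L k') R = 1 := (parity_fineBox hn hm hu hL hkk hiso).trans hodd
  let f : (Fin (n * m) → ℤ) → ZMod 2 := fun a =>
    ∑ τ : Equiv.Perm (Fin (n * m)), if IsFull (L k') a τ then 1 else 0
  -- Full simplices have a field of at most 2Λ / K, so their lowest vertices lie in the boxes around
  -- zeros.
  have hf : ∀ a, f a ≠ 0 → ∃ e ∈ zeros u, a ∈ box (gridFloor k' e) w' := by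
    intro a ha
    obtain ⟨τ, -, hτ⟩ := Finset.exists_ne_zero_of_sum_ne_zero ha
    have hfull : IsFull (L k') a τ := by by_contra h; simp [h] at hτ
    have h0 : kuhnVertex a τ 0 = a := by ext r; simp [kuhnVertex]
    have h1K : (1 : ℤ) ≤ 2 ^ k' := one_le_pow₀ (by norm_num)
    have hbd := hfull.bounds (hL k').pos (hL k').le 0
    have hfl := abs_field_le_of_isFull hn hm hu (by omega) (hL k') hfull 0
    rw [h0] at hbd hfl
    obtain ⟨e, he0, he1, hee⟩ := hnear (gridPoint k' a)
      (gridPoint_mem fun r => ⟨(hbd r).1, by have := (hbd r).2; omega⟩) fun ij => by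
        have h1 := hfl ij
        have h2 : 6 * Λ / K = 6 * (Λ / K) := by ring
        linarith
    refine ⟨e, ⟨he0, he1⟩, mem_box_gridFloor (fun r => (hbd r).1) fun ij => ?_⟩
    have : |gridPoint k' a ij - e ij| * K ≤ s / 4 * K :=
      mul_le_mul_of_nonneg_right (hee ij).le hK0.le
    linarith
  -- The disjoint boxes around the zeros carry the whole odd parity, so one of them carries an odd
  -- part.
  have hsum : parity (L k') R = ∑ e ∈ hfin.toFinset, ∑ a ∈ R ∩ box (gridFloor k' e) w', f a := by
    rw [← Finset.sum_biUnion]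
    · symm
      refine Finset.sum_subset (fun a ha => ?_) fun a ha hna => ?_
      · obtain ⟨e, -, he⟩ := Finset.mem_biUnion.1 ha
        exact (Finset.mem_inter.1 he).1
      · by_contra h
        obtain ⟨e, he, hae⟩ := hf a h
        exact hna (Finset.mem_biUnion.2
          ⟨e, hfin.mem_toFinset.2 he, Finset.mem_inter.2 ⟨ha, hae⟩⟩)
    · intro e he e' he' hne
      rw [Function.onFun, Finset.disjoint_left]
      intro a ha ha'
      exact hne (hclose e (hfin.mem_toFinset.1 he) e' (hfin.mem_toFinset.1 he') _
        (hboxdist e a (Finset.mem_inter.1 ha).2) (hboxdist e' a (Finset.mem_inter.1 ha').2))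
  obtain ⟨e, heE, hne⟩ : ∃ e ∈ hfin.toFinset, ∑ a ∈ R ∩ box (gridFloor k' e) w', f a ≠ 0 := by
    apply Finset.exists_ne_zero_of_sum_ne_zero
    rw [← hsum, hpar]
    exact one_ne_zero
  have he := hfin.mem_toFinset.1 heE
  obtain ⟨x, hx, -⟩ := Finset.exists_ne_zero_of_sum_ne_zero hne
  have hsub : box (gridFloor k' e) w' ⊆ R :=
    box_subset_fineBox hn hm hu hkk hiso he hwq (Finset.mem_inter.1 hx).2 (Finset.mem_inter.1 hx).1
  refine ⟨e, he, w', hwle, hsmall e he, ?_, hsub, by linarith⟩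
  rw [Finset.inter_eq_right.2 hsub] at hne
  change parity (L k') (box (gridFloor k' e) w') ≠ 0 at hne
  generalize parity (L k') (box (gridFloor k' e) w') = z at hne ⊢
  revert z
  decide

end Subdivision
end NashGame


namespace NashGame

/-! ### The field in natural number arithmetic -/

section Arithmetic

/-- The digit with the index `r` of `x` in base `b`. -/
def digit (b x r : ℕ) : ℕ := x / b ^ r % b

/-- The expected payoff of player `i`, for a table `t` of payoffs in which the profiles of pure
strategies are given by their numbers. -/
def natPayoff (n m : ℕ) (t x : ℕ → ℕ → ℕ) (i : ℕ) : ℕ :=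
  ∑ s ∈ Finset.range (m ^ n), (∏ l ∈ Finset.range n, x l (digit m s l)) * t i s

/-- Player `i` plays the pure strategy `j`; probabilities are multiples of `1 / K`. -/
def natDeviate (K : ℕ) (x : ℕ → ℕ → ℕ) (i j l b : ℕ) : ℕ :=
  if l = i then if b = j then K else 0 else x l b

/-- The function `gain` on a grid, for payoffs that are given as differences. -/
def natGain (n m K : ℕ) (t t' x : ℕ → ℕ → ℕ) (i j : ℕ) : ℕ :=
  (natPayoff n m t (natDeviate K x i j) i + natPayoff n m t' x i)
    - (natPayoff n m t x i + natPayoff n m t' (natDeviate K x i j) i)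

/-- The positive part of the vector field `field` on a grid. -/
def fieldPos (n m K : ℕ) (t t' x : ℕ → ℕ → ℕ) (i j : ℕ) : ℕ :=
  ((x i j + (K - ∑ k ∈ Finset.range m, x i k)) * K ^ n + natGain n m K t t' x i j) * K

/-- The negative part of the vector field `field` on a grid. -/
def fieldNeg (n m K : ℕ) (t t' x : ℕ → ℕ → ℕ) (i j : ℕ) : ℕ :=
  x i j * ((∑ k ∈ Finset.range m, x i k + m * (K - ∑ k ∈ Finset.range m, x i k)) * K ^ n
    + ∑ k ∈ Finset.range m, natGain n m K t t' x i k)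

theorem digit_finFunctionFinEquiv {D b : ℕ} (f : Fin D → Fin b) (r : Fin D) :
    digit b (finFunctionFinEquiv f) r = f r := by
  conv_rhs => rw [← finFunctionFinEquiv.symm_apply_apply f]
  rfl

theorem sum_range_pow {M : Type*} [AddCommMonoid M] (b D : ℕ) (F : ℕ → M) :
    ∑ z ∈ Finset.range (b ^ D), F z = ∑ f : Fin D → Fin b, F (finFunctionFinEquiv f) := by
  rw [Finset.sum_range]
  exact (Equiv.sum_comp finFunctionFinEquiv fun z : Fin (b ^ D) => F z).symm

variable {n m : ℕ}

/-- Every monomial has n probabilities and one payoff, each scaled by K. -/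
theorem natPayoff_cast {K : ℝ} {x : ℕ → ℕ → ℕ} {y : Vec n m}
    (hxy : ∀ i j, (x (i : Fin n) (j : Fin m) : ℝ) = y (i, j) * K) {t : ℕ → ℕ → ℕ} {u : Game n m}
    (ht : ∀ i s, (t (i : Fin n) (finFunctionFinEquiv s).val : ℝ) = u i s * K) (i : Fin n) :
    (natPayoff n m t x i : ℝ) = payoff u y i * K ^ (n + 1) := by
  rw [natPayoff, sum_range_pow, Nat.cast_sum, payoff, Finset.sum_mul]
  refine Finset.sum_congr rfl fun s _ => ?_
  rw [Nat.cast_mul, ht, Finset.prod_range, Nat.cast_prod]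
  simp only [digit_finFunctionFinEquiv, hxy, Finset.prod_mul_distrib, Finset.prod_const,
    Finset.card_univ, Fintype.card_fin]
  ring

theorem payoff_sub (u v : Game n m) (p : Vec n m) (i : Fin n) :
    payoff (u - v) p i = payoff u p i - payoff v p i := by
  simp only [payoff, ← Finset.sum_sub_distrib, Pi.sub_apply, mul_sub]

theorem cast_tsub (a b : ℕ) : ((a - b : ℕ) : ℝ) = max ((a : ℝ) - b) 0 := by
  rcases le_total b a with h | h
  · rw [Nat.cast_sub h, max_eq_left]
    have : (b : ℝ) ≤ a := by exact_mod_cast h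
    linarith
  · rw [Nat.sub_eq_zero_of_le h, max_eq_right, Nat.cast_zero]
    have : (a : ℝ) ≤ b := by exact_mod_cast h
    linarith

theorem natDeviate_cast {K : ℕ} {x : ℕ → ℕ → ℕ} {y : Vec n m}
    (hxy : ∀ i j, (x (i : Fin n) (j : Fin m) : ℝ) = y (i, j) * K) (i : Fin n) (j : Fin m)
    (l : Fin n) (b : Fin m) :
    (natDeviate K x i j l b : ℝ) = deviate y i (Pi.single j 1) (l, b) * K := by
  unfold natDeviate deviate
  by_cases hl : l = i
  · by_cases hb : b = j
    · simp [hl, hb]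
    · simp [hl, hb, Fin.val_inj]
  · simp [hl, Fin.val_inj, hxy]

/-- Truncated subtraction is exactly the positive part in the definition of `gain`. To stay in the
natural numbers, payoffs are differences of two tables and negative terms change sides. -/
theorem natGain_cast {K : ℕ} {x : ℕ → ℕ → ℕ} {y : Vec n m}
    (hxy : ∀ i j, (x (i : Fin n) (j : Fin m) : ℝ) = y (i, j) * K) {t t' : ℕ → ℕ → ℕ}
    {u u' : Game n m} (ht : ∀ i s, (t (i : Fin n) (finFunctionFinEquiv s).val : ℝ) = u i s * K)
    (ht' : ∀ i s, (t' (i : Fin n) (finFunctionFinEquiv s).val : ℝ) = u' i s * K) (i : Fin n)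
    (j : Fin m) :
    (natGain n m K t t' x i j : ℝ) = gain (u - u') y i j * K ^ (n + 1) := by
  have hd := natDeviate_cast hxy i j
  rw [natGain, cast_tsub, Nat.cast_add, Nat.cast_add, natPayoff_cast hd ht, natPayoff_cast hd ht',
    natPayoff_cast hxy ht, natPayoff_cast hxy ht', gain, purePayoff, payoff_sub, payoff_sub,
    max_mul_of_nonneg _ _ (by positivity : (0 : ℝ) ≤ (K : ℝ) ^ (n + 1)), zero_mul]
  congr 1
  ring

theorem field_cast {K : ℕ} {x : ℕ → ℕ → ℕ} {y : Fin n × Fin m → ℝ}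
    (hxy : ∀ i j, (x (i : Fin n) (j : Fin m) : ℝ) = y (i, j) * K) {t t' : ℕ → ℕ → ℕ}
    {u u' : Game n m} (ht : ∀ i s, (t (i : Fin n) (finFunctionFinEquiv s).val : ℝ) = u i s * K)
    (ht' : ∀ i s, (t' (i : Fin n) (finFunctionFinEquiv s).val : ℝ) = u' i s * K) (i : Fin n)
    (j : Fin m) :
    (fieldPos n m K t t' x i j : ℝ) - fieldNeg n m K t t' x i j
      = field (u - u') y (i, j) * K ^ (n + 2) := by
  have hg := natGain_cast (y := WithLp.toLp 2 y) hxy ht ht' i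
  have hS : ((∑ k ∈ Finset.range m, x i k : ℕ) : ℝ) = (∑ k, y (i, k)) * K := by
    rw [Finset.sum_range, Nat.cast_sum, Finset.sum_mul]
    exact Finset.sum_congr rfl fun k _ => hxy i k
  have hG : ((∑ k ∈ Finset.range m, natGain n m K t t' x i k : ℕ) : ℝ)
      = (∑ k, gain (u - u') (WithLp.toLp 2 y) i k) * K ^ (n + 1) := by
    rw [Finset.sum_range, Nat.cast_sum, Finset.sum_mul]
    exact Finset.sum_congr rfl fun k _ => hg k
  have hM : ((K - ∑ k ∈ Finset.range m, x i k : ℕ) : ℝ) = max (1 - ∑ k, y (i, k)) 0 * K := by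
    rw [cast_tsub, hS, max_mul_of_nonneg _ _ (Nat.cast_nonneg K), zero_mul, sub_mul, one_mul]
  unfold fieldPos fieldNeg field
  simp only [Nat.cast_mul, Nat.cast_add, Nat.cast_pow, hS, hM, hG, hg, hxy]
  ring

/-- This sign on the faces of the orthant, with the next one beyond the unit cube, is the boundary
condition of Sperner's argument. -/
theorem field_nonneg_of_eq_zero (u : Game n m) {x : Fin n × Fin m → ℝ} {ij : Fin n × Fin m}
    (h : x ij = 0) : 0 ≤ field u x ij := by
  unfold field
  rw [h, zero_mul, sub_zero, zero_add]
  exact add_nonneg (le_max_right _ _) (gain_nonneg _ _ _ _)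

theorem field_neg_of_one_lt (u : Game n m) {x : Fin n × Fin m → ℝ} (hx : ∀ ij, 0 ≤ x ij)
    {ij : Fin n × Fin m} (h : 1 < x ij) : field u x ij < 0 := by
  obtain ⟨i, j⟩ := ij
  have h1 : x (i, j) ≤ ∑ k, x (i, k) :=
    Finset.single_le_sum (f := fun k => x (i, k)) (fun k _ => hx _) (Finset.mem_univ j)
  have h2 : gain u (WithLp.toLp 2 x) i j ≤ ∑ k, gain u (WithLp.toLp 2 x) i k :=
    Finset.single_le_sum (f := fun k => gain u (WithLp.toLp 2 x) i k)
      (fun k _ => gain_nonneg _ _ _ _) (Finset.mem_univ j)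
  have h3 := gain_nonneg u (WithLp.toLp 2 x) i j
  simp only [field]
  rw [max_eq_right (by linarith)]
  nlinarith

end Arithmetic

/-! ### The labeling by signs of the field -/

section Label

variable {n m : ℕ}

/-- The labeling of the grid of level `k` that is given by the signs of the vector field. -/
noncomputable def signLabel (u : Game n m) (k : ℕ) (v : Fin (n * m) → ℤ) : Fin (n * m + 1) :=
  -- Negative coordinates are replaced by 0, so that the boundary condition also holds outside the
  -- orthant.
  lastLabel fun r => field u (gridPoint k fun r => max (v r) 0) (finProdFinEquiv.symm r) < 0

theorem gridPoint_max_nonneg (k : ℕ) (v : Fin (n * m) → ℤ) (ij : Fin n × Fin m) :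
    0 ≤ gridPoint k (fun r => max (v r) 0) ij := by
  unfold gridPoint
  have : (0 : ℝ) ≤ ((max (v (finProdFinEquiv ij)) 0 : ℤ) : ℝ) := by
    exact_mod_cast le_max_right _ _
  positivity

/-- The boundary conditions hold exactly for the approximate game `u'`; the error Λ / 2^k only
accounts for replacing `u'` by `u`. -/
theorem isLabeling_signLabel (hn : 0 < n) (hm : 0 < m) {u u' : Game n m} {B : ℕ}
    (hu : ∀ i s, |u i s| ≤ B) {k : ℕ} (huu : ∀ i s, |u i s - u' i s| ≤ 1 / 2 ^ k) :
    IsLabeling u (fieldLip n m B / 2 ^ k) k (2 ^ k) (signLabel u' k) := by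
  have hclose : ∀ v : Fin (n * m) → ℤ, (∀ r, 0 ≤ v r ∧ v r ≤ 2 * 2 ^ k) → ∀ ij,
      |field u (gridPoint k v) ij - field u' (gridPoint k v) ij| ≤ fieldLip n m B / 2 ^ k := by
    intro v hv ij
    have := abs_field_sub_field_le hn hm (ε := 1 / 2 ^ k) (by positivity) hu huu
      (gridPoint_mem hv) (gridPoint_mem hv) (fun ij => by rw [sub_self, abs_zero]; positivity) ij
    rwa [mul_one_div] at this
  have hmax : ∀ v : Fin (n * m) → ℤ, (∀ r, 0 ≤ v r ∧ v r ≤ 2 * 2 ^ k) →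
      (fun r => max (v r) 0) = v := fun v hv => funext fun r => max_eq_left (hv r).1
  constructor
  · intro v r hv
    by_contra h
    refine not_lt.2 (field_nonneg_of_eq_zero u' ?_) (lastLabel_eq_succ.1 hv).1
    simp only [gridPoint, Equiv.apply_symm_apply, max_eq_right (not_lt.1 h), Int.cast_zero,
      zero_div]
  · intro v hv r
    by_contra h
    refine lastLabel_eq_zero.1 hv r (field_neg_of_one_lt u' (gridPoint_max_nonneg k v) ?_)
    simp only [gridPoint, Equiv.apply_symm_apply]
    rw [lt_div_iff₀ (by positivity), one_mul]
    have : (2 : ℤ) ^ k < max (v r) 0 := (not_le.1 h).trans_le (le_max_left _ _)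
    exact_mod_cast this
  · intro v hv ij hij
    have h1 := (lastLabel_eq_succ.1 hij).1
    simp only [hmax v hv, Equiv.symm_apply_apply] at h1
    have h2 := abs_le.1 (hclose v hv ij)
    linarith [h2.2]
  · intro v hv h0 ij
    have h1 := lastLabel_eq_zero.1 h0 (finProdFinEquiv ij)
    simp only [hmax v hv, Equiv.symm_apply_apply] at h1
    have h2 := abs_le.1 (hclose v hv ij)
    linarith [h2.1]

end Label

end NashGame


namespace NashGame

/-! ### The search for nested boxes, in terms of numerical codes -/

section Search

/-- The vector field is negative at the grid point `a` in the coordinate with the number `r`. -/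
def IsNeg (n m K : ℕ) (t t' : ℕ → ℕ → ℕ) (a : ℕ → ℕ) (r : ℕ) : Prop :=
  fieldPos n m K t t' (fun i j => a (j + m * i)) (r / m) (r % m)
    < fieldNeg n m K t t' (fun i j => a (j + m * i)) (r / m) (r % m)

/-- The vector field has at the grid point `a` in the coordinate with the number `r` an absolute
value larger than `T / K`. -/
def IsLarge (n m K T : ℕ) (t t' : ℕ → ℕ → ℕ) (a : ℕ → ℕ) (r : ℕ) : Prop :=
  fieldNeg n m K t t' (fun i j => a (j + m * i)) (r / m) (r % m) + T * K ^ (n + 1)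
      < fieldPos n m K t t' (fun i j => a (j + m * i)) (r / m) (r % m) ∨
    fieldPos n m K t t' (fun i j => a (j + m * i)) (r / m) (r % m) + T * K ^ (n + 1)
      < fieldNeg n m K t t' (fun i j => a (j + m * i)) (r / m) (r % m)

open Classical in
/-- The function `signLabel` on grid points with natural coordinates. -/
noncomputable def natLabel (n m K : ℕ) (t t' : ℕ → ℕ → ℕ) (a : ℕ → ℕ) : ℕ :=
  Nat.findGreatest (fun c => 0 < c ∧ IsNeg n m K t t' a (c - 1)) (n * m)

/-- The function `kuhnVertex` for natural coordinates. -/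
def natVertex (a τ : ℕ → ℕ) (s r : ℕ) : ℕ := a r + if τ r < s then 1 else 0

/-- The simplex with lowest vertex `a` and order `τ` is full. -/
def NatFull (n m K : ℕ) (t t' : ℕ → ℕ → ℕ) (a τ : ℕ → ℕ) : Prop :=
  ∀ s < n * m + 1, ∀ s' < n * m + 1,
    natLabel n m K t t' (natVertex a τ s) = natLabel n m K t t' (natVertex a τ s') → s = s'

/-- The numbers `τ r` with `r < D` are distinct. -/
def IsOrder (D : ℕ) (τ : ℕ → ℕ) : Prop := ∀ r < D, ∀ r' < D, τ r = τ r' → r = r'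

/-- The grid point `a` is in the box with centre `c` and edge `2 w`. -/
def InBox (D : ℕ) (a c : ℕ → ℕ) (w : ℕ) : Prop := ∀ r < D, c r ≤ a r + w ∧ a r ≤ c r + w

open Classical in
/-- The number of full simplices with lowest vertex in the box. -/
noncomputable def natParity (n m K : ℕ) (t t' : ℕ → ℕ → ℕ) (b : ℕ) (c : ℕ → ℕ) (w : ℕ) : ℕ :=
  ∑ z ∈ Finset.range (b ^ (n * m)), if InBox (n * m) (digit b z) c w then
    ∑ y ∈ Finset.range ((n * m) ^ (n * m)),
      if IsOrder (n * m) (digit (n * m) y) ∧ NatFull n m K t t' (digit b z) (digit (n * m) y)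
      then 1 else 0 else 0

/-- The base of the positional system in which grid points of level `k` are coded. -/
def gridBase (k : ℕ) : ℕ := 2 * 2 ^ k + 1

/-- The box of level `k` with the centre `c` and the edge `2 w` is an admissible successor of the
box `(k₀, c₀, w₀)`. -/
def IsSuccessor (n m T : ℕ) (t t' : ℕ → ℕ → ℕ) (k₀ : ℕ) (c₀ : ℕ → ℕ) (w₀ k : ℕ) (c : ℕ → ℕ)
    (w : ℕ) : Prop :=
  (∀ r < n * m, c r + w < gridBase k) ∧
  (∀ z < gridBase k ^ (n * m), InBox (n * m) (digit (gridBase k) z) c w →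
    InBox (n * m) (fun r => digit (gridBase k) z r / 2 ^ (k - k₀)) c₀ w₀ ∧
    ((∃ r < n * m, digit (gridBase k) z r + w = c r ∨ digit (gridBase k) z r = c r + w) →
      ∃ r < n * m, IsLarge n m (2 ^ k) T t t' (digit (gridBase k) z) r)) ∧
  natParity n m (2 ^ k) t t' (gridBase k) c w % 2 = 1 ∧
  (w + 1) * 2 ^ k₀ * 2 ≤ (w₀ + 1) * 2 ^ k

/-- A bound for the payoffs, computed from the tables of level `0`. -/
def payoffBound (n m : ℕ) (t t' : ℕ → ℕ → ℕ) : ℕ :=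
  -- Approximations of level 0 have error at most 1, which the final summand covers.
  ∑ i ∈ Finset.range n, ∑ s ∈ Finset.range (m ^ n), (t i s + t' i s) + 2

/-- The successor property, for a box that is coded by a number. -/
def IsSuccessorCode (n m T : ℕ) (t t' : ℕ → ℕ → ℕ) (S : ℕ × ℕ × ℕ) (k y : ℕ) : Prop :=
  IsSuccessor n m T t t' S.1 (digit (gridBase S.1) S.2.1) S.2.2 k
    (digit (gridBase k) (y / gridBase k)) (y % gridBase k)

open Classical in
/-- The code of a successor at level `k` of the box `S`, if there is one. -/
noncomputable def successorCode (n m T : ℕ) (t t' : ℕ → ℕ → ℕ) (S : ℕ × ℕ × ℕ) (k : ℕ) : ℕ :=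
  Nat.findGreatest (fun y => IsSuccessorCode n m T t t' S k y) (gridBase k ^ (n * m + 1))

open Classical in
/-- Pass to a successor at level `k`, if there is one. -/
noncomputable def boxStep (n m T : ℕ) (t t' : ℕ → ℕ → ℕ) (S : ℕ × ℕ × ℕ) (k : ℕ) : ℕ × ℕ × ℕ :=
  if IsSuccessorCode n m T t t' S k (successorCode n m T t t' S k) then
    (k, successorCode n m T t t' S k / gridBase k, successorCode n m T t t' S k % gridBase k)
  else S

/-- The box (level, code of the centre, half of the edge) that is reached after `N` levels. -/
noncomputable def boxSeq (n m : ℕ) (t t' : ℕ → ℕ → ℕ → ℕ) (N : ℕ) : ℕ × ℕ × ℕ :=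
  -- At level 0 the full simplices have coordinates between 0 and 2, so the half-edge 3 contains
  -- them all; the faces lie outside the cube [0, 2], where isolation demands nothing. The factor 5
  -- below lies between the margin 4 that is needed and the margin 6 that small boxes offer.
  Nat.rec (0, 0, 3) (fun k S =>
    boxStep n m (5 * fieldLip n m (payoffBound n m (t 0) (t' 0))) (t k) (t' k) S k) N

end Search

/-! ### Agreement of the numerical search with the geometry -/

section Correctness

variable {n m : ℕ}

/-- The numbers `a r` with `r < D` are the coordinates of `v`. -/
def Represents {D : ℕ} (a : ℕ → ℕ) (v : Fin D → ℤ) : Prop := ∀ r : Fin D, (a r : ℤ) = v r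

/-- The tables `t` and `t'` describe the game `u`, with payoffs in units `1 / 2 ^ k`. -/
def IsTable (t t' : ℕ → ℕ → ℕ) (k : ℕ) (u : Game n m) : Prop :=
  ∀ i s, (t (i : Fin n) (finFunctionFinEquiv s).val : ℝ)
    - t' (i : Fin n) (finFunctionFinEquiv s).val = u i s * 2 ^ k

theorem IsTable.field_cast {t t' : ℕ → ℕ → ℕ} {k : ℕ} {u : Game n m} (h : IsTable t t' k u)
    {a : ℕ → ℕ} {v : Fin (n * m) → ℤ} (hv : Represents a v) (ij : Fin n × Fin m) :
    (fieldPos n m (2 ^ k) t t' (fun i j => a (j + m * i)) ij.1 ij.2 : ℝ)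
      - fieldNeg n m (2 ^ k) t t' (fun i j => a (j + m * i)) ij.1 ij.2
      = field u (gridPoint k v) ij * (2 ^ k) ^ (n + 2) := by
  have hk : (0 : ℝ) < 2 ^ k := by positivity
  have := NashGame.field_cast (K := 2 ^ k) (x := fun i j => a (j + m * i)) (y := gridPoint k v)
    (t := t) (t' := t')
    (u := fun i s => (t i (finFunctionFinEquiv s).val : ℝ) / 2 ^ k)
    (u' := fun i s => (t' i (finFunctionFinEquiv s).val : ℝ) / 2 ^ k)
    (fun i j => by
      push_cast
      rw [← gridPoint_mul, ← hv]
      rfl)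
    (fun i s => by push_cast; field_simp) (fun i s => by push_cast; field_simp) ij.1 ij.2
  rw [this]
  push_cast
  congr 2
  ext i s
  have h1 := h i s
  simp only [Pi.sub_apply]
  rw [← sub_div, h1]
  field_simp

theorem val_div_mod (ij : Fin n × Fin m) :
    (finProdFinEquiv ij).val / m = ij.1 ∧ (finProdFinEquiv ij).val % m = ij.2 := by
  have h := finProdFinEquiv.symm_apply_apply ij
  exact ⟨congrArg (fun p : Fin n × Fin m => p.1.val) h,
    congrArg (fun p : Fin n × Fin m => p.2.val) h⟩

theorem isNeg_iff {t t' : ℕ → ℕ → ℕ} {k : ℕ} {u : Game n m} (h : IsTable t t' k u)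
    {a : ℕ → ℕ} {v : Fin (n * m) → ℤ} (hv : Represents a v) (ij : Fin n × Fin m) :
    IsNeg n m (2 ^ k) t t' a (finProdFinEquiv ij).val ↔ field u (gridPoint k v) ij < 0 := by
  have h1 := h.field_cast hv ij
  rw [IsNeg, (val_div_mod ij).1, (val_div_mod ij).2, ← Nat.cast_lt (α := ℝ), ← sub_neg, h1]
  have hk : (0 : ℝ) < (2 ^ k) ^ (n + 2) := by positivity
  exact ⟨fun h' => by_contra fun h2 => not_lt.2 (mul_nonneg (not_lt.1 h2) hk.le) h',
    fun h' => mul_neg_of_neg_of_pos h' hk⟩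

theorem isLarge_iff {t t' : ℕ → ℕ → ℕ} {k T : ℕ} {u : Game n m} (h : IsTable t t' k u)
    {a : ℕ → ℕ} {v : Fin (n * m) → ℤ} (hv : Represents a v) (ij : Fin n × Fin m) :
    IsLarge n m (2 ^ k) T t t' a (finProdFinEquiv ij).val
      ↔ (T : ℝ) / 2 ^ k < |field u (gridPoint k v) ij| := by
  have h1 := h.field_cast hv ij
  have hk : (0 : ℝ) < (2 ^ k) ^ (n + 2) := by positivity
  have h2 : (T : ℝ) / 2 ^ k * (2 ^ k) ^ (n + 2) = T * (2 ^ k) ^ (n + 1) := by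
    field_simp; ring
  rw [IsLarge, (val_div_mod ij).1, (val_div_mod ij).2, ← Nat.cast_lt (α := ℝ),
    ← Nat.cast_lt (α := ℝ), ← mul_lt_mul_iff_left₀ (b := (T : ℝ) / 2 ^ k) hk, h2]
  have h3 : |field u (gridPoint k v) ij| * (2 ^ k) ^ (n + 2)
      = |field u (gridPoint k v) ij * (2 ^ k) ^ (n + 2)| := by rw [abs_mul, abs_of_pos hk]
  rw [h3, ← h1, lt_abs]
  push_cast
  constructor
  · rintro (h | h)
    · left; linarith
    · right; linarith
  · rintro (h | h)
    · left; linarith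
    · right; linarith

theorem natLabel_eq {t t' : ℕ → ℕ → ℕ} {k : ℕ} {u : Game n m} (h : IsTable t t' k u)
    {a : ℕ → ℕ} {v : Fin (n * m) → ℤ} (hv : Represents a v) :
    natLabel n m (2 ^ k) t t' a = (signLabel u k v).val := by
  classical
  have hmax : (fun r => max (v r) 0) = v := funext fun r => max_eq_left (by rw [← hv]; positivity)
  have key : ∀ c ≤ n * m, (0 < c ∧ IsNeg n m (2 ^ k) t t' a (c - 1)) ↔
      ∃ r : Fin (n * m), r.val + 1 = c ∧ field u (gridPoint k fun r => max (v r) 0)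
        (finProdFinEquiv.symm r) < 0 := by
    intro c hc
    rw [hmax]
    constructor
    · rintro ⟨h0, h1⟩
      refine ⟨⟨c - 1, by omega⟩, by simp only; omega, ?_⟩
      rw [← isNeg_iff h hv, Equiv.apply_symm_apply]
      exact h1
    · rintro ⟨r, rfl, hr⟩
      rw [← isNeg_iff h hv, Equiv.apply_symm_apply] at hr
      exact ⟨Nat.succ_pos _, hr⟩
  rw [natLabel, signLabel, lastLabel]
  simp only
  rw [Nat.findGreatest_eq_iff]
  refine ⟨Nat.findGreatest_le _, fun hne => ?_, fun {c} hc hcD hP => ?_⟩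
  · rw [key _ (Nat.findGreatest_le _)]
    exact Nat.findGreatest_of_ne_zero rfl hne
  · exact Nat.findGreatest_is_greatest hc hcD ((key c hcD).1 hP)

theorem natFull_iff {t t' : ℕ → ℕ → ℕ} {k : ℕ} {u : Game n m} (h : IsTable t t' k u)
    {a : ℕ → ℕ} {v : Fin (n * m) → ℤ} (hv : Represents a v) {τ : ℕ → ℕ}
    {σ : Equiv.Perm (Fin (n * m))} (hσ : ∀ r : Fin (n * m), τ r = σ r) :
    NatFull n m (2 ^ k) t t' a τ ↔ IsFull (signLabel u k) v σ := by
  have hvert : ∀ s : Fin (n * m + 1), Represents (natVertex a τ s) (kuhnVertex v σ s) := by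
    intro s r
    simp only [natVertex, kuhnVertex, hσ, ← hv r]
    push_cast
    rfl
  constructor
  · intro hf s s' hs
    refine Fin.ext (hf s s.2 s' s'.2 ?_)
    rw [natLabel_eq h (hvert s), natLabel_eq h (hvert s')]
    exact congrArg Fin.val hs
  · intro hf s hs s' hs' heq
    have := @hf ⟨s, hs⟩ ⟨s', hs'⟩ (Fin.ext (by
      rw [← natLabel_eq h (hvert ⟨s, hs⟩), ← natLabel_eq h (hvert ⟨s', hs'⟩)]
      exact heq))
    exact congrArg Fin.val this

theorem inBox_iff {D : ℕ} {a c : ℕ → ℕ} {w : ℕ} {v e : Fin D → ℤ} (hv : Represents a v)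
    (he : Represents c e) : InBox D a c w ↔ v ∈ box e w := by
  rw [mem_box]
  constructor
  · intro h r
    have := h r r.2
    have := hv r
    have := he r
    omega
  · intro h r hr
    have := h ⟨r, hr⟩
    have h1 := hv ⟨r, hr⟩
    have h2 := he ⟨r, hr⟩
    simp only at h1 h2
    omega

theorem exists_code {D b : ℕ} {v : Fin D → ℤ} (h : ∀ r, 0 ≤ v r ∧ v r < b) :
    ∃ z < b ^ D, Represents (digit b z) v := by
  let f : Fin D → Fin b := fun r => ⟨(v r).toNat, by have := h r; omega⟩
  refine ⟨finFunctionFinEquiv f, (finFunctionFinEquiv f).2, fun r => ?_⟩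
  rw [digit_finFunctionFinEquiv]
  have := h r
  simp only [f]
  omega

/-- The grid point with this code. -/
def decodePoint (D b z : ℕ) (r : Fin D) : ℤ := digit b z r

theorem represents_decodePoint (D b z : ℕ) : Represents (digit b z) (decodePoint D b z) :=
  fun _ => rfl

theorem isOrder_iff {D : ℕ} (g : Fin D → Fin D) :
    IsOrder D (digit D (finFunctionFinEquiv g)) ↔ Function.Injective g := by
  constructor
  · intro h r r' hr
    refine Fin.ext (h r r.2 r' r'.2 ?_)
    rw [digit_finFunctionFinEquiv, digit_finFunctionFinEquiv, hr]
  · intro h r hr r' hr' heq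
    have h1 := digit_finFunctionFinEquiv g ⟨r, hr⟩
    have h2 := digit_finFunctionFinEquiv g ⟨r', hr'⟩
    simp only at h1 h2
    rw [h1, h2] at heq
    exact congrArg Fin.val (h (Fin.ext heq))

/-- The codes `y` run through all maps of the coordinates into themselves, of which `IsOrder`
selects the permutations. By `hb` every point of the box has a code in base `b`. -/
theorem natParity_cast {t t' : ℕ → ℕ → ℕ} {k : ℕ} {u : Game n m} (h : IsTable t t' k u)
    {b : ℕ} {c : ℕ → ℕ} {e : Fin (n * m) → ℤ} (he : Represents c e) {w : ℕ}
    (hb : ∀ r, e r + w < b) :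
    (natParity n m (2 ^ k) t t' b c w : ZMod 2) = parity (signLabel u k) (box e w) := by
  classical
  have hinner : ∀ (a : ℕ → ℕ) (v : Fin (n * m) → ℤ), Represents a v →
      ((∑ y ∈ Finset.range ((n * m) ^ (n * m)),
        if IsOrder (n * m) (digit (n * m) y) ∧ NatFull n m (2 ^ k) t t' a (digit (n * m) y)
        then 1 else 0 : ℕ) : ZMod 2)
      = ∑ τ : Equiv.Perm (Fin (n * m)), if IsFull (signLabel u k) v τ then 1 else 0 := by
    intro a v hv
    rw [sum_range_pow, Nat.cast_sum]
    symm
    refine Finset.sum_of_injOn (fun τ : Equiv.Perm (Fin (n * m)) => (τ : Fin (n * m) → Fin (n * m)))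
      (fun _ _ _ _ h => DFunLike.coe_injective h) (fun _ _ => Finset.mem_univ _) ?_ ?_
    · intro g _ hg
      rw [if_neg, Nat.cast_zero]
      rintro ⟨h1, -⟩
      rw [isOrder_iff] at h1
      exact hg ⟨Equiv.ofBijective g (Finite.injective_iff_bijective.1 h1),
        by simp, rfl⟩
    · intro τ _
      have h1 := natFull_iff h hv (σ := τ) (fun r => digit_finFunctionFinEquiv (⇑τ) r)
      have h2 := (isOrder_iff (⇑τ)).2 τ.injective
      by_cases hf : IsFull (signLabel u k) v τ
      · rw [if_pos hf, if_pos ⟨h2, h1.2 hf⟩, Nat.cast_one]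
      · rw [if_neg hf, if_neg (fun h' => hf (h1.1 h'.2)), Nat.cast_zero]
  rw [natParity, sum_range_pow, Nat.cast_sum, parity]
  have hrep : ∀ f : Fin (n * m) → Fin b,
      Represents (digit b (finFunctionFinEquiv f)) fun r => ((f r).val : ℤ) := fun f r => by
    rw [digit_finFunctionFinEquiv]
  have hterm : ∀ f : Fin (n * m) → Fin b,
      ((if InBox (n * m) (digit b (finFunctionFinEquiv f)) c w then
        ∑ y ∈ Finset.range ((n * m) ^ (n * m)),
        if IsOrder (n * m) (digit (n * m) y) ∧
          NatFull n m (2 ^ k) t t' (digit b (finFunctionFinEquiv f)) (digit (n * m) y)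
        then 1 else 0 else 0 : ℕ) : ZMod 2)
      = if (fun r => ((f r).val : ℤ)) ∈ box e w then
        ∑ τ : Equiv.Perm (Fin (n * m)),
          if IsFull (signLabel u k) (fun r => ((f r).val : ℤ)) τ then 1 else 0 else 0 := by
    intro f
    by_cases hf : (fun r => ((f r).val : ℤ)) ∈ box e w
    · rw [if_pos hf, if_pos ((inBox_iff (hrep f) he).2 hf), hinner _ _ (hrep f)]
    · rw [if_neg hf, if_neg (mt (inBox_iff (hrep f) he).1 hf), Nat.cast_zero]
  simp only [hterm]
  rw [← Finset.sum_filter]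
  refine Finset.sum_bij (fun f _ => fun r => ((f r).val : ℤ)) (fun f hf => (Finset.mem_filter.1 hf).2)
    (fun f _ g _ hfg => ?_) (fun v hv => ?_) fun f _ => rfl
  · ext r
    have := congrFun hfg r
    exact_mod_cast this
  · have hv' := mem_box.1 hv
    have hfv : ∀ r, (v r).toNat < b := fun r => by
      have := hv' r
      have := hb r
      omega
    have heq : (fun r => (((⟨(v r).toNat, hfv r⟩ : Fin b).val : ℕ) : ℤ)) = v := by
      ext r
      have := hv' r
      simp only
      omega
    exact ⟨fun r => ⟨(v r).toNat, hfv r⟩,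
      Finset.mem_filter.2 ⟨Finset.mem_univ _, by rw [heq]; exact hv⟩, heq⟩

end Correctness
end NashGame


namespace NashGame

/-! ### Soundness and completeness of the successor test -/

section Successor

variable {n m : ℕ}

theorem abs_field_sub_field_gridPoint_le (hn : 0 < n) (hm : 0 < m) {u u' : Game n m} {B : ℕ}
    (hu : ∀ i s, |u i s| ≤ B) {k : ℕ} (huu : ∀ i s, |u i s - u' i s| ≤ 1 / 2 ^ k)
    {v : Fin (n * m) → ℤ} (hv : ∀ r, 0 ≤ v r ∧ v r ≤ 2 * 2 ^ k) (ij : Fin n × Fin m) :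
    |field u (gridPoint k v) ij - field u' (gridPoint k v) ij| ≤ fieldLip n m B / 2 ^ k := by
  have := abs_field_sub_field_le hn hm (ε := 1 / 2 ^ k) (by positivity) hu huu
    (gridPoint_mem hv) (gridPoint_mem hv) (fun ij => by rw [sub_self, abs_zero]; positivity) ij
  rwa [mul_one_div] at this

theorem represents_div {D : ℕ} {a : ℕ → ℕ} {v : Fin D → ℤ} (h : Represents a v) (q : ℕ) :
    Represents (fun r => a r / q) fun r => v r / (q : ℤ) := fun r => by
  change ((a r / q : ℕ) : ℤ) = v r / (q : ℤ)
  rw [← h r, Int.natCast_div]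

/-- Soundness: the fields of `u` and `u'` differ by at most Λ / 2^k at grid points, so the tested
margin 5Λ leaves 4Λ for the true game. -/
theorem IsSuccessor.spec (hn : 0 < n) (hm : 0 < m) {u u' : Game n m} {B : ℕ}
    (hu : ∀ i s, |u i s| ≤ B) {k : ℕ} (huu : ∀ i s, |u i s - u' i s| ≤ 1 / 2 ^ k)
    {t t' : ℕ → ℕ → ℕ} (ht : IsTable t t' k u') {k₀ w₀ w : ℕ} {c₀ c : ℕ → ℕ}
    {e₀ e : Fin (n * m) → ℤ} (he₀ : Represents c₀ e₀) (he : Represents c e)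
    (h : IsSuccessor n m (5 * fieldLip n m B) t t' k₀ c₀ w₀ k c w) :
    IsIsolating u (4 * fieldLip n m B) k e w ∧ parity (signLabel u' k) (box e w) = 1 ∧
      box e w ⊆ fineBox (2 ^ (k - k₀)) e₀ w₀ ∧
      ((w : ℝ) + 1) / 2 ^ k ≤ ((w₀ : ℝ) + 1) / 2 ^ k₀ / 2 := by
  obtain ⟨hb, hz, hp, hs⟩ := h
  have hb' : ∀ r, e r + w < gridBase k := fun r => by
    have := hb r r.2
    have := he r
    omega
  have hcode : ∀ v ∈ box e w, ∃ z < gridBase k ^ (n * m),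
      Represents (digit (gridBase k) z) v := fun v hv => exists_code fun r => by
    have := mem_box.1 hv r
    have := hb' r
    omega
  refine ⟨fun v hv hv2 hr => ?_, ?_, fun v hv => ?_, ?_⟩
  · obtain ⟨z, hz0, hzv⟩ := hcode v hv
    obtain ⟨r, hr⟩ := hr
    obtain ⟨r', hr', hlarge⟩ := (hz z hz0 ((inBox_iff hzv he).2 hv)).2 ⟨r, r.2, by
      have := hzv r
      have := he r
      omega⟩
    obtain ⟨ij, hij⟩ := finProdFinEquiv.surjective ⟨r', hr'⟩
    have hval : r' = (finProdFinEquiv ij).val := by rw [hij]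
    rw [hval, isLarge_iff ht hzv] at hlarge
    refine ⟨ij, ?_⟩
    have h1 := abs_field_sub_field_gridPoint_le hn hm hu huu hv2 ij
    have h2 := abs_sub_abs_le_abs_sub (field u' (gridPoint k v) ij) (field u (gridPoint k v) ij)
    rw [abs_sub_comm] at h2
    push_cast at hlarge
    rw [mul_div_assoc] at hlarge ⊢
    linarith
  · rw [← natParity_cast ht he hb', ZMod.natCast_eq_one_iff_odd, Nat.odd_iff]
    exact hp
  · obtain ⟨z, hz0, hzv⟩ := hcode v hv
    rw [mem_fineBox (by positivity)]
    exact (inBox_iff (represents_div hzv _) he₀).1 (hz z hz0 ((inBox_iff hzv he).2 hv)).1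
  · rw [div_div, div_le_div_iff₀ (by positivity) (by positivity)]
    have : (((w + 1) * 2 ^ k₀ * 2 : ℕ) : ℝ) ≤ ((w₀ + 1) * 2 ^ k : ℕ) := by exact_mod_cast hs
    push_cast at this
    linarith

/-- Completeness: by the same comparison, a true margin 6Λ passes the test with 5Λ. -/
theorem isSuccessor_of (hn : 0 < n) (hm : 0 < m) {u u' : Game n m} {B : ℕ}
    (hu : ∀ i s, |u i s| ≤ B) {k : ℕ} (huu : ∀ i s, |u i s - u' i s| ≤ 1 / 2 ^ k)
    {t t' : ℕ → ℕ → ℕ} (ht : IsTable t t' k u') {k₀ w₀ w : ℕ} {c₀ c : ℕ → ℕ}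
    {e₀ e : Fin (n * m) → ℤ} (he₀ : Represents c₀ e₀) (he : Represents c e)
    (hb : ∀ r, e r + w < gridBase k)
    (hiso : IsIsolating u (6 * fieldLip n m B) k e w)
    (hp : parity (signLabel u' k) (box e w) = 1)
    (hsub : box e w ⊆ fineBox (2 ^ (k - k₀)) e₀ w₀)
    (hs : ((w : ℝ) + 1) / 2 ^ k ≤ ((w₀ : ℝ) + 1) / 2 ^ k₀ / 2) :
    IsSuccessor n m (5 * fieldLip n m B) t t' k₀ c₀ w₀ k c w := by
  refine ⟨fun r hr => ?_, fun z _ hz => ⟨?_, ?_⟩, ?_, ?_⟩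
  · have := hb ⟨r, hr⟩
    have h1 := he ⟨r, hr⟩
    simp only at h1
    omega
  · rw [inBox_iff (represents_decodePoint _ _ z) he] at hz
    rw [inBox_iff (represents_div (represents_decodePoint _ _ z) _) he₀]
    exact (mem_fineBox (by positivity)).1 (hsub hz)
  · rintro ⟨r, hr, hr2⟩
    have hzv := represents_decodePoint (n * m) (gridBase k) z
    rw [inBox_iff hzv he] at hz
    have hv2 : ∀ r, 0 ≤ decodePoint (n * m) (gridBase k) z r ∧
        decodePoint (n * m) (gridBase k) z r ≤ 2 * 2 ^ k := by
      intro r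
      have h1 : digit (gridBase k) z r < gridBase k := Nat.mod_lt _ (Nat.succ_pos _)
      have h2 : (digit (gridBase k) z r : ℤ) < 2 * 2 ^ k + 1 := by
        unfold gridBase at h1 ⊢
        exact_mod_cast h1
      unfold decodePoint
      omega
    obtain ⟨ij, hij⟩ := hiso _ hz hv2 ⟨⟨r, hr⟩, by
      have h1 := he ⟨r, hr⟩
      have h2 := hzv ⟨r, hr⟩
      simp only at h1 h2
      omega⟩
    refine ⟨finProdFinEquiv ij, (finProdFinEquiv ij).2, ?_⟩
    rw [isLarge_iff ht hzv]
    have h1 := abs_field_sub_field_gridPoint_le hn hm hu huu hv2 ij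
    have h2 := abs_sub_abs_le_abs_sub
      (field u (gridPoint k (decodePoint (n * m) (gridBase k) z)) ij)
      (field u' (gridPoint k (decodePoint (n * m) (gridBase k) z)) ij)
    push_cast
    rw [mul_div_assoc] at hij ⊢
    linarith
  · rw [← Nat.odd_iff, ← ZMod.natCast_eq_one_iff_odd, natParity_cast ht he hb, hp]
  · rw [div_div, div_le_div_iff₀ (by positivity) (by positivity)] at hs
    have : (((w + 1) * 2 ^ k₀ * 2 : ℕ) : ℝ) ≤ ((w₀ + 1) * 2 ^ k : ℕ) := by
      push_cast
      linarith
    exact_mod_cast this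

end Successor

/-! ### Convergence of the boxes to one zero -/

section Limit

variable {n m : ℕ}

/-- The centre of a coded box. -/
def boxCentre (n m : ℕ) (S : ℕ × ℕ × ℕ) : Fin (n * m) → ℤ :=
  decodePoint (n * m) (gridBase S.1) S.2.1

/-- The edge of a coded box, up to rounding. -/
noncomputable def boxSize (S : ℕ × ℕ × ℕ) : ℝ := ((S.2.2 : ℝ) + 1) / 2 ^ S.1

/-- The zeros of the vector field in a coded box. -/
def boxZeros (u : Game n m) (S : ℕ × ℕ × ℕ) : Set (Fin n × Fin m → ℝ) :=
  {e | e ∈ zeros u ∧ gridFloor S.1 e ∈ box (boxCentre n m S) S.2.2}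

/-- Rounding in two stages agrees with rounding at once. This is how membership of a zero passes
from a finer box to the coarser one around it. -/
theorem gridFloor_div {k k' : ℕ} (hk : k ≤ k') (e : Fin n × Fin m → ℝ) (r : Fin (n * m)) :
    gridFloor k' e r / ((2 ^ (k' - k) : ℕ) : ℤ) = gridFloor k e r := by
  unfold gridFloor
  rw [← Int.floor_div_natCast]
  congr 1
  push_cast
  rw [div_eq_iff (by positivity), mul_assoc, ← pow_add, Nat.add_sub_cancel' hk]

theorem abs_sub_le_boxSize {u : Game n m} {S : ℕ × ℕ × ℕ} {e : Fin n × Fin m → ℝ}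
    (he : e ∈ boxZeros u S) (ij : Fin n × Fin m) :
    |e ij - digit (gridBase S.1) S.2.1 (finProdFinEquiv ij) / 2 ^ S.1| ≤ boxSize S := by
  have hk : (0 : ℝ) < 2 ^ S.1 := by positivity
  obtain ⟨-, h1, h2⟩ := mem_box.1 he.2 (finProdFinEquiv ij)
  have h3 := gridFloor_le S.1 e ij
  have h4 := lt_gridFloor S.1 e ij
  have h5 : boxCentre n m S (finProdFinEquiv ij)
    = (digit (gridBase S.1) S.2.1 (finProdFinEquiv ij) : ℤ) := rfl
  rw [h5] at h1 h2
  generalize digit (gridBase S.1) S.2.1 (finProdFinEquiv ij) = d at *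
  have h1' : (d : ℝ) - S.2.2 ≤ gridFloor S.1 e (finProdFinEquiv ij) := by exact_mod_cast h1
  have h2' : (gridFloor S.1 e (finProdFinEquiv ij) : ℝ) ≤ d + S.2.2 := by exact_mod_cast h2
  rw [boxSize, abs_le, neg_le, neg_sub, sub_le_iff_le_add, sub_le_iff_le_add, ← add_div,
    div_le_iff₀ hk]
  constructor
  · rw [add_mul, div_mul_cancel₀ _ hk.ne']
    linarith
  · rw [le_div_iff₀ hk]
    linarith

variable {u : Game n m} {t t' : ℕ → ℕ → ℕ → ℕ} {uk : ℕ → Game n m}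

theorem boxStep_eq_or (hn : 0 < n) (hm : 0 < m) {B : ℕ} (hu : ∀ i s, |u i s| ≤ B)
    {t t' : ℕ → ℕ → ℕ} {u' : Game n m} {k : ℕ} (ht : IsTable t t' k u')
    (huu : ∀ i s, |u i s - u' i s| ≤ 1 / 2 ^ k) (S : ℕ × ℕ × ℕ) :
    boxStep n m (5 * fieldLip n m B) t t' S k = S ∨
    ∃ S', boxStep n m (5 * fieldLip n m B) t t' S k = S' ∧ S'.1 = k ∧
      IsIsolating u (4 * fieldLip n m B) k (boxCentre n m S') S'.2.2 ∧
      parity (signLabel u' k) (box (boxCentre n m S') S'.2.2) = 1 ∧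
      box (boxCentre n m S') S'.2.2 ⊆ fineBox (2 ^ (k - S.1)) (boxCentre n m S) S.2.2 ∧
      boxSize S' ≤ boxSize S / 2 := by
  unfold boxStep
  split_ifs with h
  · exact Or.inr ⟨_, rfl, rfl, IsSuccessor.spec hn hm hu huu ht (represents_decodePoint _ _ _)
      (represents_decodePoint _ _ _) h⟩
  · exact Or.inl rfl

/-- The given box need not be the one chosen. Its existence makes the bounded search succeed, and
whatever successor is chosen has at most half the size. -/
theorem boxStep_size_le (hn : 0 < n) (hm : 0 < m) {B : ℕ} (hu : ∀ i s, |u i s| ≤ B)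
    {t t' : ℕ → ℕ → ℕ} {u' : Game n m} {k : ℕ} (ht : IsTable t t' k u')
    (huu : ∀ i s, |u i s - u' i s| ≤ 1 / 2 ^ k) (S : ℕ × ℕ × ℕ) {e : Fin (n * m) → ℤ} {w : ℕ}
    (he : ∀ r, 0 ≤ e r ∧ e r ≤ 2 ^ k) (hw : w ≤ 2 ^ k)
    (hiso : IsIsolating u (6 * fieldLip n m B) k e w)
    (hp : parity (signLabel u' k) (box e w) = 1)
    (hsub : box e w ⊆ fineBox (2 ^ (k - S.1)) (boxCentre n m S) S.2.2)
    (hs : ((w : ℝ) + 1) / 2 ^ k ≤ boxSize S / 2) :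
    boxSize (boxStep n m (5 * fieldLip n m B) t t' S k) ≤ boxSize S / 2 := by
  classical
  have hb : ∀ r, e r + w < gridBase k := fun r => by
    have h1 := he r
    have h2 : (w : ℤ) ≤ 2 ^ k := by exact_mod_cast hw
    unfold gridBase
    push_cast
    omega
  have hwb : w < gridBase k := by unfold gridBase; omega
  obtain ⟨z, hz, hze⟩ := exists_code (D := n * m) (b := gridBase k) (v := e) fun r => by
    have := he r
    have := hb r
    omega
  have hsucc : IsSuccessorCode n m (5 * fieldLip n m B) t t' S k (z * gridBase k + w) := by
    unfold IsSuccessorCode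
    have h1 : (z * gridBase k + w) / gridBase k = z := by
      rw [mul_comm, Nat.mul_add_div (by omega), Nat.div_eq_of_lt hwb, add_zero]
    have h2 : (z * gridBase k + w) % gridBase k = w := by
      rw [mul_comm, Nat.mul_add_mod, Nat.mod_eq_of_lt hwb]
    rw [h1, h2]
    exact isSuccessor_of hn hm hu huu ht (represents_decodePoint _ _ _) hze hb hiso hp hsub hs
  have hle : z * gridBase k + w ≤ gridBase k ^ (n * m + 1) := by
    rw [pow_succ]
    have : (z + 1) * gridBase k ≤ gridBase k ^ (n * m) * gridBase k := Nat.mul_le_mul_right _ hz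
    rw [add_mul] at this
    omega
  have h : IsSuccessorCode n m (5 * fieldLip n m B) t t' S k
      (successorCode n m (5 * fieldLip n m B) t t' S k) :=
    Nat.findGreatest_spec (P := fun y => IsSuccessorCode n m (5 * fieldLip n m B) t t' S k y)
      hle hsucc
  unfold boxStep
  rw [if_pos h]
  exact (IsSuccessor.spec hn hm hu huu ht (represents_decodePoint _ _ _)
    (represents_decodePoint _ _ _) h).2.2.2

/-- For the initial box the parity is Sperner's; afterwards each accepted box has been tested, and a
rejected step changes nothing. -/
theorem boxSeq_invariant (hn : 0 < n) (hm : 0 < m) (ht : ∀ k, IsTable (t k) (t' k) k (uk k))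
    (huu : ∀ k i s, |u i s - uk k i s| ≤ 1 / 2 ^ k)
    (hu : ∀ i s, |u i s| ≤ payoffBound n m (t 0) (t' 0)) (N : ℕ) :
    (boxSeq n m t t' N).1 ≤ N ∧
    IsIsolating u (4 * fieldLip n m (payoffBound n m (t 0) (t' 0))) (boxSeq n m t t' N).1
      (boxCentre n m (boxSeq n m t t' N)) (boxSeq n m t t' N).2.2 ∧
    parity (signLabel (uk (boxSeq n m t t' N).1) (boxSeq n m t t' N).1)
      (box (boxCentre n m (boxSeq n m t t' N)) (boxSeq n m t t' N).2.2) = 1 := by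
  induction N with
  | zero =>
    have hc : boxCentre n m (boxSeq n m t t' 0) = 0 := by
      ext r
      simp [boxCentre, decodePoint, boxSeq, digit]
    have h0 : boxSeq n m t t' 0 = (0, 0, 3) := rfl
    rw [hc, h0]
    refine ⟨le_rfl, ?_, ?_⟩
    · rintro v - hv2 ⟨r, hr⟩
      have := hv2 r
      simp only [pow_zero, Pi.zero_apply] at this hr
      push_cast at hr
      omega
    · have : NeZero (n * m) := ⟨(Nat.mul_pos hn hm).ne'⟩
      have hlab := isLabeling_signLabel hn hm hu (huu 0)
      refine parity_eq_one _ (2 ^ 0) (by norm_num) hlab.pos hlab.le _ fun v hv => ?_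
      rw [mem_box]
      intro r
      have := hv r
      simp only [Pi.zero_apply]
      norm_num at this ⊢
      omega
  | succ N ih =>
    rcases boxStep_eq_or hn hm hu (ht N) (huu N) (boxSeq n m t t' N) with h | ⟨S', h, h1, h2, h3, -⟩
    · change boxSeq n m t t' (N + 1) = _ at h
      rw [h]
      exact ⟨ih.1.trans (Nat.le_succ N), ih.2⟩
    · change boxSeq n m t t' (N + 1) = _ at h
      rw [h, h1]
      exact ⟨Nat.le_succ N, h2, h3⟩

theorem boxZeros_antitone (hn : 0 < n) (hm : 0 < m) (ht : ∀ k, IsTable (t k) (t' k) k (uk k))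
    (huu : ∀ k i s, |u i s - uk k i s| ≤ 1 / 2 ^ k)
    (hu : ∀ i s, |u i s| ≤ payoffBound n m (t 0) (t' 0)) :
    Antitone fun N => boxZeros u (boxSeq n m t t' N) := by
  refine antitone_nat_of_succ_le fun N => ?_
  rcases boxStep_eq_or hn hm hu (ht N) (huu N) (boxSeq n m t t' N) with h | ⟨S', h, h1, -, -, h4, -⟩
  · change boxSeq n m t t' (N + 1) = _ at h
    rw [h]
  · change boxSeq n m t t' (N + 1) = _ at h
    rw [h]
    rintro e ⟨he, heb⟩
    refine ⟨he, ?_⟩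
    rw [h1] at heb
    have hle := (boxSeq_invariant hn hm ht huu hu N).1
    have := (mem_fineBox (by positivity)).1 (h4 heb)
    simpa only [gridFloor_div hle] using this

theorem boxSize_antitone (hn : 0 < n) (hm : 0 < m) (ht : ∀ k, IsTable (t k) (t' k) k (uk k))
    (huu : ∀ k i s, |u i s - uk k i s| ≤ 1 / 2 ^ k)
    (hu : ∀ i s, |u i s| ≤ payoffBound n m (t 0) (t' 0)) {N M : ℕ} (hNM : N ≤ M) :
    boxSeq n m t t' M = boxSeq n m t t' N ∨
      boxSize (boxSeq n m t t' M) ≤ boxSize (boxSeq n m t t' N) / 2 := by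
  induction M, hNM using Nat.le_induction with
  | base => exact Or.inl rfl
  | succ M _ ih =>
    rcases boxStep_eq_or hn hm hu (ht M) (huu M) (boxSeq n m t t' M) with
      h | ⟨S', h, -, -, -, -, h5⟩
    · change boxSeq n m t t' (M + 1) = _ at h
      rwa [h]
    · change boxSeq n m t t' (M + 1) = _ at h
      rw [← h] at h5
      right
      rcases ih with ih | ih
      · rwa [ih] at h5
      · have : 0 ≤ boxSize (boxSeq n m t t' M) := by unfold boxSize; positivity
        linarith

/-- From some level on, admissible small boxes exist at every level. Either the current box has been
replaced before, and is then halved, or it is still there and the next step replaces it. The zero at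
the centre of the small box lies in the current box. -/
theorem exists_boxSize_le (hn : 0 < n) (hm : 0 < m) (hfin : (zeros u).Finite)
    (ht : ∀ k, IsTable (t k) (t' k) k (uk k))
    (huu : ∀ k i s, |u i s - uk k i s| ≤ 1 / 2 ^ k)
    (hu : ∀ i s, |u i s| ≤ payoffBound n m (t 0) (t' 0)) (N : ℕ) :
    (boxZeros u (boxSeq n m t t' N)).Nonempty ∧
      ∃ M, boxSize (boxSeq n m t t' M) ≤ boxSize (boxSeq n m t t' N) / 2 := by
  obtain ⟨hle, hiso, hodd⟩ := boxSeq_invariant hn hm ht huu hu N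
  have hpos : 0 < boxSize (boxSeq n m t t' N) := by unfold boxSize; positivity
  obtain ⟨k₁, hk₁, h⟩ := exists_small_box hn hm hfin hu
    (fun k => isLabeling_signLabel hn hm hu (huu k)) hiso hodd (half_pos hpos)
  -- A level that is fine enough and that the algorithm has not yet passed at stage `N`.
  obtain ⟨e, he, w, hw, h1, h2, h3, h4⟩ := h (max k₁ N) (le_max_left _ _)
  have hkk : (boxSeq n m t t' N).1 ≤ max k₁ N := hk₁.le.trans (le_max_left _ _)
  refine ⟨⟨e, he, ?_⟩, ?_⟩
  · have := (mem_fineBox (by positivity)).1 (h3 (gridFloor_mem_box he.1))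
    simpa only [gridFloor_div hkk] using this
  · rcases boxSize_antitone hn hm ht huu hu (le_max_right k₁ N) with heq | hlt
    · refine ⟨max k₁ N + 1, ?_⟩
      have hstep := boxStep_size_le hn hm hu (ht (max k₁ N)) (huu (max k₁ N))
        (boxSeq n m t t' (max k₁ N)) (e := gridFloor (max k₁ N) e) (w := w)
        (fun r => ⟨gridFloor_nonneg he.1 r, ?_⟩) hw h1 h2 (by rw [heq]; exact h3)
        (by rw [heq]; exact h4)
      · rw [heq] at hstep
        change boxSize (boxStep _ _ _ _ _ (boxSeq n m t t' (max k₁ N)) _) ≤ _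
        rwa [heq]
      · rw [gridFloor, Int.floor_le_iff]
        push_cast
        have := mul_le_mul_of_nonneg_right (zeros_le_one hm he (finProdFinEquiv.symm r))
          (by positivity : (0 : ℝ) ≤ 2 ^ max k₁ N)
        linarith
    · exact ⟨_, hlt⟩

/-- The initial size is (3 + 1) / 2^0 = 4, and it can be halved any number of times. -/
theorem exists_boxSize_lt (hn : 0 < n) (hm : 0 < m) (hfin : (zeros u).Finite)
    (ht : ∀ k, IsTable (t k) (t' k) k (uk k))
    (huu : ∀ k i s, |u i s - uk k i s| ≤ 1 / 2 ^ k)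
    (hu : ∀ i s, |u i s| ≤ payoffBound n m (t 0) (t' 0)) (j : ℕ) :
    ∃ N, boxSize (boxSeq n m t t' N) ≤ 4 / 2 ^ j := by
  induction j with
  | zero => exact ⟨0, by norm_num [boxSize, boxSeq]⟩
  | succ j ih =>
    obtain ⟨N, hN⟩ := ih
    obtain ⟨M, hM⟩ := (exists_boxSize_le hn hm hfin ht huu hu N).2
    refine ⟨M, hM.trans ?_⟩
    rw [pow_succ, ← div_div]
    linarith

/-- If each of the finitely many zeros dropped out at some stage, then at the latest of these stages
the box would contain none, although it always contains one. -/
theorem exists_mem_boxZeros (hn : 0 < n) (hm : 0 < m) (hfin : (zeros u).Finite)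
    (ht : ∀ k, IsTable (t k) (t' k) k (uk k))
    (huu : ∀ k i s, |u i s - uk k i s| ≤ 1 / 2 ^ k)
    (hu : ∀ i s, |u i s| ≤ payoffBound n m (t 0) (t' 0)) :
    ∃ e ∈ zeros u, ∀ N, e ∈ boxZeros u (boxSeq n m t t' N) := by
  by_contra! hno
  choose! F hF using hno
  obtain ⟨N, hN⟩ := (hfin.image F).bddAbove
  obtain ⟨e, he⟩ := (exists_boxSize_le hn hm hfin ht huu hu N).1
  exact hF e he.1 (boxZeros_antitone hn hm ht huu hu (hN ⟨e, he.1, rfl⟩) he)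

end Limit
end NashGame


namespace NashGame

/-! ### The search is primitive recursive -/

section Primitive

attribute [local fun_prop] Primrec Primrec.id Primrec.const Primrec.comp Primrec.pair Primrec.fst
  Primrec.snd

variable {α : Type*} [Primcodable α]

@[local fun_prop]
theorem primrec_fst {β γ : Type*} [Primcodable β] [Primcodable γ] {f : α → β × γ}
    (hf : Primrec f) : Primrec fun a => (f a).1 := Primrec.fst.comp hf

@[local fun_prop]
theorem primrec_snd {β γ : Type*} [Primcodable β] [Primcodable γ] {f : α → β × γ}
    (hf : Primrec f) : Primrec fun a => (f a).2 := Primrec.snd.comp hf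

@[local fun_prop]
theorem primrec_add {f g : α → ℕ} (hf : Primrec f) (hg : Primrec g) :
    Primrec fun a => f a + g a := Primrec.nat_add.comp hf hg

@[local fun_prop]
theorem primrec_sub {f g : α → ℕ} (hf : Primrec f) (hg : Primrec g) :
    Primrec fun a => f a - g a := Primrec.nat_sub.comp hf hg

@[local fun_prop]
theorem primrec_mul {f g : α → ℕ} (hf : Primrec f) (hg : Primrec g) :
    Primrec fun a => f a * g a := Primrec.nat_mul.comp hf hg

@[local fun_prop]
theorem primrec_div {f g : α → ℕ} (hf : Primrec f) (hg : Primrec g) :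
    Primrec fun a => f a / g a := Primrec.nat_div.comp hf hg

@[local fun_prop]
theorem primrec_mod {f g : α → ℕ} (hf : Primrec f) (hg : Primrec g) :
    Primrec fun a => f a % g a := Primrec.nat_mod.comp hf hg

@[local fun_prop]
theorem primrec_pow {f g : α → ℕ} (hf : Primrec f) (hg : Primrec g) :
    Primrec fun a => f a ^ g a := (Primrec₂.unpaired'.1 Nat.Primrec.pow).comp hf hg

@[local fun_prop]
theorem primrec_sum {N : α → ℕ} {f : α → ℕ → ℕ} (hN : Primrec N)
    (hf : Primrec fun p : α × ℕ => f p.1 p.2) :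
    Primrec fun a => ∑ z ∈ Finset.range (N a), f a z := by
  refine (Primrec.nat_rec' (g := fun _ => 0) (h := fun a q => q.2 + f a q.1) hN
    (Primrec.const 0) ?_).of_eq fun a => ?_
  · change Primrec fun p : α × ℕ × ℕ => p.2.2 + f p.1 p.2.1
    fun_prop
  · induction N a with
    | zero => rfl
    | succ k ih => rw [Finset.sum_range_succ, ← ih]

@[local fun_prop]
theorem primrec_prod {N : α → ℕ} {f : α → ℕ → ℕ} (hN : Primrec N)
    (hf : Primrec fun p : α × ℕ => f p.1 p.2) :
    Primrec fun a => ∏ z ∈ Finset.range (N a), f a z := by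
  refine (Primrec.nat_rec' (g := fun _ => 1) (h := fun a q => q.2 * f a q.1) hN
    (Primrec.const 1) ?_).of_eq fun a => ?_
  · change Primrec fun p : α × ℕ × ℕ => p.2.2 * f p.1 p.2.1
    fun_prop
  · induction N a with
    | zero => rfl
    | succ k ih => rw [Finset.prod_range_succ, ← ih]

theorem primrecPred_forall_lt {N : α → ℕ} {p : α → ℕ → Prop} (hN : Primrec N)
    (hp : PrimrecPred fun q : α × ℕ => p q.1 q.2) : PrimrecPred fun a => ∀ z < N a, p a z :=
  ((PrimrecRel.forall_mem_list (R := fun z a => p a z)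
    (hp.comp (Primrec.snd.pair Primrec.fst))).comp (Primrec.list_range.comp hN)
    Primrec.id).of_eq fun a => by simp only [List.mem_range, id]

theorem primrecPred_exists_lt {N : α → ℕ} {p : α → ℕ → Prop} (hN : Primrec N)
    (hp : PrimrecPred fun q : α × ℕ => p q.1 q.2) : PrimrecPred fun a => ∃ z < N a, p a z :=
  ((PrimrecRel.exists_mem_list (R := fun z a => p a z)
    (hp.comp (Primrec.snd.pair Primrec.fst))).comp (Primrec.list_range.comp hN)
    Primrec.id).of_eq fun a => by simp only [List.mem_range, id]

theorem primrecPred_imp {p q : α → Prop} (hp : PrimrecPred p) (hq : PrimrecPred q) :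
    PrimrecPred fun a => p a → q a :=
  (hp.not.or hq).of_eq fun _ => imp_iff_not_or.symm

theorem primrecPred_lt {f g : α → ℕ} (hf : Primrec f) (hg : Primrec g) :
    PrimrecPred fun a => f a < g a := Primrec.nat_lt.comp hf hg

theorem primrecPred_le {f g : α → ℕ} (hf : Primrec f) (hg : Primrec g) :
    PrimrecPred fun a => f a ≤ g a := Primrec.nat_le.comp hf hg

theorem primrecPred_eq {f g : α → ℕ} (hf : Primrec f) (hg : Primrec g) :
    PrimrecPred fun a => f a = g a := Primrec.eq.comp hf hg

variable {n m K T b k w k₀ w₀ i j r : α → ℕ} {t t' x : α → ℕ → ℕ → ℕ} {a c c₀ τ : α → ℕ → ℕ}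

@[local fun_prop]
theorem primrec_digit (hb : Primrec b) (hk : Primrec k) (hr : Primrec r) :
    Primrec fun p => digit (b p) (k p) (r p) := by
  unfold digit
  fun_prop

@[local fun_prop]
theorem primrec_gridBase (hk : Primrec k) : Primrec fun p => gridBase (k p) := by
  unfold gridBase
  fun_prop

@[local fun_prop]
theorem primrec_fieldLip (hn : Primrec n) (hm : Primrec m) (hb : Primrec b) :
    Primrec fun p => fieldLip (n p) (m p) (b p) := by
  unfold fieldLip payoffLip
  fun_prop

@[local fun_prop]
theorem primrec_payoffBound (hn : Primrec n) (hm : Primrec m)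
    (ht : Primrec fun p : α × ℕ × ℕ => t p.1 p.2.1 p.2.2)
    (ht' : Primrec fun p : α × ℕ × ℕ => t' p.1 p.2.1 p.2.2) :
    Primrec fun p => payoffBound (n p) (m p) (t p) (t' p) := by
  unfold payoffBound
  fun_prop

@[local fun_prop]
theorem primrec_natPayoff (hn : Primrec n) (hm : Primrec m)
    (ht : Primrec fun p : α × ℕ × ℕ => t p.1 p.2.1 p.2.2)
    (hx : Primrec fun p : α × ℕ × ℕ => x p.1 p.2.1 p.2.2) (hi : Primrec i) :
    Primrec fun p => natPayoff (n p) (m p) (t p) (x p) (i p) := by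
  unfold natPayoff
  fun_prop

@[local fun_prop]
theorem primrec_natDeviate (hK : Primrec K)
    (hx : Primrec fun p : α × ℕ × ℕ => x p.1 p.2.1 p.2.2) (hi : Primrec i) (hj : Primrec j)
    (hk : Primrec k) (hb : Primrec b) :
    Primrec fun p => natDeviate (K p) (x p) (i p) (j p) (k p) (b p) := by
  unfold natDeviate
  exact Primrec.ite (primrecPred_eq hk hi)
    (Primrec.ite (primrecPred_eq hb hj) hK (by fun_prop)) (by fun_prop)

@[local fun_prop]
theorem primrec_natGain (hn : Primrec n) (hm : Primrec m) (hK : Primrec K)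
    (ht : Primrec fun p : α × ℕ × ℕ => t p.1 p.2.1 p.2.2)
    (ht' : Primrec fun p : α × ℕ × ℕ => t' p.1 p.2.1 p.2.2)
    (hx : Primrec fun p : α × ℕ × ℕ => x p.1 p.2.1 p.2.2) (hi : Primrec i) (hj : Primrec j) :
    Primrec fun p => natGain (n p) (m p) (K p) (t p) (t' p) (x p) (i p) (j p) := by
  unfold natGain
  fun_prop

@[local fun_prop]
theorem primrec_fieldPos (hn : Primrec n) (hm : Primrec m) (hK : Primrec K)
    (ht : Primrec fun p : α × ℕ × ℕ => t p.1 p.2.1 p.2.2)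
    (ht' : Primrec fun p : α × ℕ × ℕ => t' p.1 p.2.1 p.2.2)
    (hx : Primrec fun p : α × ℕ × ℕ => x p.1 p.2.1 p.2.2) (hi : Primrec i) (hj : Primrec j) :
    Primrec fun p => fieldPos (n p) (m p) (K p) (t p) (t' p) (x p) (i p) (j p) := by
  unfold fieldPos
  fun_prop

@[local fun_prop]
theorem primrec_fieldNeg (hn : Primrec n) (hm : Primrec m) (hK : Primrec K)
    (ht : Primrec fun p : α × ℕ × ℕ => t p.1 p.2.1 p.2.2)
    (ht' : Primrec fun p : α × ℕ × ℕ => t' p.1 p.2.1 p.2.2)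
    (hx : Primrec fun p : α × ℕ × ℕ => x p.1 p.2.1 p.2.2) (hi : Primrec i) (hj : Primrec j) :
    Primrec fun p => fieldNeg (n p) (m p) (K p) (t p) (t' p) (x p) (i p) (j p) := by
  unfold fieldNeg
  fun_prop

theorem primrecPred_isNeg (hn : Primrec n) (hm : Primrec m) (hK : Primrec K)
    (ht : Primrec fun p : α × ℕ × ℕ => t p.1 p.2.1 p.2.2)
    (ht' : Primrec fun p : α × ℕ × ℕ => t' p.1 p.2.1 p.2.2)
    (ha : Primrec fun p : α × ℕ => a p.1 p.2) (hr : Primrec r) :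
    PrimrecPred fun p => IsNeg (n p) (m p) (K p) (t p) (t' p) (a p) (r p) :=
  primrecPred_lt (by fun_prop) (by fun_prop)

theorem primrecPred_isLarge (hn : Primrec n) (hm : Primrec m) (hK : Primrec K) (hT : Primrec T)
    (ht : Primrec fun p : α × ℕ × ℕ => t p.1 p.2.1 p.2.2)
    (ht' : Primrec fun p : α × ℕ × ℕ => t' p.1 p.2.1 p.2.2)
    (ha : Primrec fun p : α × ℕ => a p.1 p.2) (hr : Primrec r) :
    PrimrecPred fun p => IsLarge (n p) (m p) (K p) (T p) (t p) (t' p) (a p) (r p) :=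
  (primrecPred_lt (by fun_prop) (by fun_prop)).or (primrecPred_lt (by fun_prop) (by fun_prop))

@[local fun_prop]
theorem primrec_natLabel (hn : Primrec n) (hm : Primrec m) (hK : Primrec K)
    (ht : Primrec fun p : α × ℕ × ℕ => t p.1 p.2.1 p.2.2)
    (ht' : Primrec fun p : α × ℕ × ℕ => t' p.1 p.2.1 p.2.2)
    (ha : Primrec fun p : α × ℕ => a p.1 p.2) :
    Primrec fun p => natLabel (n p) (m p) (K p) (t p) (t' p) (a p) := by
  classical
  unfold natLabel
  refine (Primrec.nat_findGreatest (f := fun p => n p * m p)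
    (p := fun p c => 0 < c ∧ IsNeg (n p) (m p) (K p) (t p) (t' p) (a p) (c - 1)) (by fun_prop) ?_).of_eq fun p => by congr!
  exact (primrecPred_lt (by fun_prop) (by fun_prop)).and
    (primrecPred_isNeg (by fun_prop) (by fun_prop) (by fun_prop) (by fun_prop) (by fun_prop)
      (by fun_prop) (by fun_prop))

@[local fun_prop]
theorem primrec_natVertex (ha : Primrec fun p : α × ℕ => a p.1 p.2)
    (hτ : Primrec fun p : α × ℕ => τ p.1 p.2) (hi : Primrec i) (hr : Primrec r) :
    Primrec fun p => natVertex (a p) (τ p) (i p) (r p) :=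
  primrec_add (by fun_prop) (Primrec.ite (primrecPred_lt (by fun_prop) hi) (by fun_prop)
    (by fun_prop))

theorem primrecPred_natFull (hn : Primrec n) (hm : Primrec m) (hK : Primrec K)
    (ht : Primrec fun p : α × ℕ × ℕ => t p.1 p.2.1 p.2.2)
    (ht' : Primrec fun p : α × ℕ × ℕ => t' p.1 p.2.1 p.2.2)
    (ha : Primrec fun p : α × ℕ => a p.1 p.2) (hτ : Primrec fun p : α × ℕ => τ p.1 p.2) :
    PrimrecPred fun p => NatFull (n p) (m p) (K p) (t p) (t' p) (a p) (τ p) :=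
  primrecPred_forall_lt (by fun_prop) <| primrecPred_forall_lt (by fun_prop) <|
    primrecPred_imp (primrecPred_eq (by fun_prop) (by fun_prop))
      (primrecPred_eq (by fun_prop) (by fun_prop))

theorem primrecPred_isOrder (hk : Primrec k) (hτ : Primrec fun p : α × ℕ => τ p.1 p.2) :
    PrimrecPred fun p => IsOrder (k p) (τ p) :=
  primrecPred_forall_lt (by fun_prop) <| primrecPred_forall_lt (by fun_prop) <|
    primrecPred_imp (primrecPred_eq (by fun_prop) (by fun_prop))
      (primrecPred_eq (by fun_prop) (by fun_prop))

theorem primrecPred_inBox (hk : Primrec k) (ha : Primrec fun p : α × ℕ => a p.1 p.2)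
    (hc : Primrec fun p : α × ℕ => c p.1 p.2) (hw : Primrec w) :
    PrimrecPred fun p => InBox (k p) (a p) (c p) (w p) :=
  primrecPred_forall_lt (by fun_prop) <|
    (primrecPred_le (by fun_prop) (by fun_prop)).and (primrecPred_le (by fun_prop) (by fun_prop))

@[local fun_prop]
theorem primrec_natParity (hn : Primrec n) (hm : Primrec m) (hK : Primrec K)
    (ht : Primrec fun p : α × ℕ × ℕ => t p.1 p.2.1 p.2.2)
    (ht' : Primrec fun p : α × ℕ × ℕ => t' p.1 p.2.1 p.2.2) (hb : Primrec b)
    (hc : Primrec fun p : α × ℕ => c p.1 p.2) (hw : Primrec w) :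
    Primrec fun p => natParity (n p) (m p) (K p) (t p) (t' p) (b p) (c p) (w p) := by
  classical
  unfold natParity
  refine primrec_sum (by fun_prop) (Primrec.ite (primrecPred_inBox (by fun_prop) (by fun_prop)
    (by fun_prop) (by fun_prop)) (primrec_sum (by fun_prop) (Primrec.ite
      ((primrecPred_isOrder (by fun_prop) (by fun_prop)).and (primrecPred_natFull (by fun_prop)
        (by fun_prop) (by fun_prop) (by fun_prop) (by fun_prop) (by fun_prop) (by fun_prop)))
      (by fun_prop) (by fun_prop))) (by fun_prop))

theorem primrecPred_isSuccessor (hn : Primrec n) (hm : Primrec m) (hT : Primrec T)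
    (ht : Primrec fun p : α × ℕ × ℕ => t p.1 p.2.1 p.2.2)
    (ht' : Primrec fun p : α × ℕ × ℕ => t' p.1 p.2.1 p.2.2) (hk₀ : Primrec k₀)
    (hc₀ : Primrec fun p : α × ℕ => c₀ p.1 p.2) (hw₀ : Primrec w₀) (hk : Primrec k)
    (hc : Primrec fun p : α × ℕ => c p.1 p.2) (hw : Primrec w) :
    PrimrecPred fun p => IsSuccessor (n p) (m p) (T p) (t p) (t' p) (k₀ p) (c₀ p) (w₀ p) (k p)
      (c p) (w p) := by
  unfold IsSuccessor
  refine .and (primrecPred_forall_lt (by fun_prop) (primrecPred_lt (by fun_prop) (by fun_prop)))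
    (.and (primrecPred_forall_lt (by fun_prop) (primrecPred_imp
      (primrecPred_inBox (by fun_prop) (by fun_prop) (by fun_prop) (by fun_prop))
      (.and (primrecPred_inBox (by fun_prop) (by fun_prop) (by fun_prop) (by fun_prop))
        (primrecPred_imp (primrecPred_exists_lt (by fun_prop) (.or
          (primrecPred_eq (by fun_prop) (by fun_prop))
          (primrecPred_eq (by fun_prop) (by fun_prop))))
          (primrecPred_exists_lt (by fun_prop) (primrecPred_isLarge (by fun_prop) (by fun_prop)
            (by fun_prop) (by fun_prop) (by fun_prop) (by fun_prop) (by fun_prop)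
            (by fun_prop)))))))
      (.and (primrecPred_eq (by fun_prop) (by fun_prop))
        (primrecPred_le (by fun_prop) (by fun_prop))))

variable {S : α → ℕ × ℕ × ℕ}

theorem primrecPred_isSuccessorCode (hn : Primrec n) (hm : Primrec m) (hT : Primrec T)
    (ht : Primrec fun p : α × ℕ × ℕ => t p.1 p.2.1 p.2.2)
    (ht' : Primrec fun p : α × ℕ × ℕ => t' p.1 p.2.1 p.2.2) (hS : Primrec S) (hk : Primrec k)
    (hr : Primrec r) :
    PrimrecPred fun p => IsSuccessorCode (n p) (m p) (T p) (t p) (t' p) (S p) (k p) (r p) :=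
  primrecPred_isSuccessor hn hm hT ht ht' (by fun_prop) (by fun_prop) (by fun_prop) hk
    (by fun_prop) (by fun_prop)

@[local fun_prop]
theorem primrec_successorCode (hn : Primrec n) (hm : Primrec m) (hT : Primrec T)
    (ht : Primrec fun p : α × ℕ × ℕ => t p.1 p.2.1 p.2.2)
    (ht' : Primrec fun p : α × ℕ × ℕ => t' p.1 p.2.1 p.2.2) (hS : Primrec S) (hk : Primrec k) :
    Primrec fun p => successorCode (n p) (m p) (T p) (t p) (t' p) (S p) (k p) := by
  classical
  unfold successorCode
  refine (Primrec.nat_findGreatest (f := fun p => gridBase (k p) ^ (n p * m p + 1))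
    (p := fun p y => IsSuccessorCode (n p) (m p) (T p) (t p) (t' p) (S p) (k p) y)
    (by fun_prop) ?_).of_eq fun p => by congr!
  exact primrecPred_isSuccessorCode (by fun_prop) (by fun_prop) (by fun_prop) (by fun_prop)
    (by fun_prop) (by fun_prop) (by fun_prop) (by fun_prop)

@[local fun_prop]
theorem primrec_boxStep (hn : Primrec n) (hm : Primrec m) (hT : Primrec T)
    (ht : Primrec fun p : α × ℕ × ℕ => t p.1 p.2.1 p.2.2)
    (ht' : Primrec fun p : α × ℕ × ℕ => t' p.1 p.2.1 p.2.2) (hS : Primrec S) (hk : Primrec k) :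
    Primrec fun p => boxStep (n p) (m p) (T p) (t p) (t' p) (S p) (k p) := by
  classical
  unfold boxStep
  exact Primrec.ite (primrecPred_isSuccessorCode hn hm hT ht ht' hS hk (by fun_prop))
    (by fun_prop) (by fun_prop)

theorem primrec_boxSeq {t t' : α → ℕ → ℕ → ℕ → ℕ} (hn : Primrec n) (hm : Primrec m)
    (ht : Primrec fun p : α × ℕ × ℕ × ℕ => t p.1 p.2.1 p.2.2.1 p.2.2.2)
    (ht' : Primrec fun p : α × ℕ × ℕ × ℕ => t' p.1 p.2.1 p.2.2.1 p.2.2.2) (hk : Primrec k) :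
    Primrec fun p => boxSeq (n p) (m p) (t p) (t' p) (k p) := by
  unfold boxSeq
  refine Primrec.nat_rec' (h := fun p (q : ℕ × ℕ × ℕ × ℕ) => boxStep (n p) (m p)
    (5 * fieldLip (n p) (m p) (payoffBound (n p) (m p) (t p 0) (t' p 0))) (t p q.1) (t' p q.1)
    q.2 q.1) hk (Primrec.const _) ?_
  change Primrec fun p : α × ℕ × ℕ × ℕ × ℕ => boxStep (n p.1) (m p.1)
    (5 * fieldLip (n p.1) (m p.1) (payoffBound (n p.1) (m p.1) (t p.1 0) (t' p.1 0)))
    (t p.1 p.2.1) (t' p.1 p.2.1) p.2.2 p.2.1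
  fun_prop

end Primitive
end NashGame


namespace NashGame

/-! ### The method: reading a name and rounding the centre -/

section Method

/-- The positive parts of the approximate payoffs in an initial segment of a name. -/
def posTable (n m : ℕ) (l : List (List ℤ)) (k i s : ℕ) : ℕ :=
  ((l.getD k []).getD (s + m ^ n * i) 0).toNat

/-- The negative parts of the approximate payoffs in an initial segment of a name. -/
def negTable (n m : ℕ) (l : List (List ℤ)) (k i s : ℕ) : ℕ :=
  (-((l.getD k []).getD (s + m ^ n * i) 0)).toNat

/-- The centre of a box, rounded to multiples of `2 ^ (-κ)`, if the box is small enough. -/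
def boxOutput (n m κ : ℕ) (S : ℕ × ℕ × ℕ) : Option (List ℕ) :=
  if (S.2.2 + 1) * 2 ^ (κ + 1) ≤ 2 ^ S.1 then
    some ((List.range (n * m)).map fun r =>
      (2 * digit (gridBase S.1) S.2.1 r * 2 ^ κ + 2 ^ S.1) / (2 * 2 ^ S.1))
  else none

/-- The method that follows the sequence of boxes. -/
noncomputable def boxMethod : Method := fun x =>
  boxOutput x.1.1 x.1.2 x.2.1 (boxSeq x.1.1 x.1.2 (posTable x.1.1 x.1.2 x.2.2)
    (negTable x.1.1 x.1.2 x.2.2) x.2.2.length)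

section Primitive

attribute [local fun_prop] Primrec Primrec.id Primrec.const Primrec.comp Primrec.pair Primrec.fst
  Primrec.snd primrec_fst primrec_snd primrec_add primrec_mul primrec_div primrec_pow
  primrec_digit primrec_gridBase

/-- Integers are coded by 2 z for z ≥ 0 and by 2 z + 1 for -(z + 1), so parity and halving of the
code suffice. -/
theorem primrec_toNat : Primrec Int.toNat := by
  refine (Primrec.ite (primrecPred_eq (primrec_mod Primrec.encode (Primrec.const 2))
    (Primrec.const 0)) (primrec_div Primrec.encode (Primrec.const 2)) (Primrec.const 0)).of_eq
      fun z : ℤ => ?_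
  cases z with
  | ofNat z =>
    have h : Encodable.encode (Int.ofNat z) = 2 * z := rfl
    rw [h, if_pos (by omega)]
    change 2 * z / 2 = z
    omega
  | negSucc z =>
    have h : Encodable.encode (Int.negSucc z) = 2 * z + 1 := rfl
    rw [h, if_neg (by omega)]
    rfl

theorem primrec_toNat_neg : Primrec fun z : ℤ => (-z).toNat := by
  refine (Primrec.ite (primrecPred_eq (primrec_mod Primrec.encode (Primrec.const 2))
    (Primrec.const 0)) (Primrec.const 0) (primrec_add (primrec_div Primrec.encode
      (Primrec.const 2)) (Primrec.const 1))).of_eq fun z : ℤ => ?_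
  cases z with
  | ofNat z =>
    have h : Encodable.encode (Int.ofNat z) = 2 * z := rfl
    rw [h, if_pos (by omega), Int.ofNat_eq_natCast]
    omega
  | negSucc z =>
    have h : Encodable.encode (Int.negSucc z) = 2 * z + 1 := rfl
    rw [h, if_neg (by omega)]
    omega

theorem primrec_tables :
    (Primrec fun p : ((ℕ × ℕ) × ℕ × List (List ℤ)) × ℕ × ℕ × ℕ =>
      posTable p.1.1.1 p.1.1.2 p.1.2.2 p.2.1 p.2.2.1 p.2.2.2) ∧
    Primrec fun p : ((ℕ × ℕ) × ℕ × List (List ℤ)) × ℕ × ℕ × ℕ =>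
      negTable p.1.1.1 p.1.1.2 p.1.2.2 p.2.1 p.2.2.1 p.2.2.2 := by
  have hz : Primrec fun p : ((ℕ × ℕ) × ℕ × List (List ℤ)) × ℕ × ℕ × ℕ =>
      (p.1.2.2.getD p.2.1 []).getD (p.2.2.2 + p.1.1.2 ^ p.1.1.1 * p.2.2.1) 0 :=
    (Primrec.list_getD 0).comp ((Primrec.list_getD []).comp (by fun_prop) (by fun_prop))
      (by fun_prop)
  exact ⟨primrec_toNat.comp hz, primrec_toNat_neg.comp hz⟩

theorem primrec_boxOutput : Primrec fun p : (ℕ × ℕ) × ℕ × ℕ × ℕ × ℕ =>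
    boxOutput p.1.1 p.1.2 p.2.1 p.2.2 := by
  unfold boxOutput
  refine Primrec.ite (primrecPred_le (by fun_prop) (by fun_prop)) (Primrec.option_some.comp
    (Primrec.list_map (Primrec.list_range.comp (by fun_prop)) ?_)) (by fun_prop)
  change Primrec fun p : ((ℕ × ℕ) × ℕ × ℕ × ℕ × ℕ) × ℕ =>
    (2 * digit (gridBase p.1.2.2.1) p.1.2.2.2.1 p.2 * 2 ^ p.1.2.1 + 2 ^ p.1.2.2.1)
      / (2 * 2 ^ p.1.2.2.1)
  fun_prop

theorem computable_boxMethod : Computable boxMethod := by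
  refine Primrec.to_comp (primrec_boxOutput.comp (Primrec.pair Primrec.fst (Primrec.pair
    (by fun_prop) (primrec_boxSeq (by fun_prop) (by fun_prop) primrec_tables.1 primrec_tables.2
      (Primrec.list_length.comp (by fun_prop))))))

end Primitive

variable {n m : ℕ}

/-- The first `N` steps read only tables of levels below `N`; level 0, which supplies the payoff
bound, is among them as soon as there is a step. Hence a finite segment of a name determines these
steps. -/
theorem boxSeq_congr {t₁ t₁' t₂ t₂' : ℕ → ℕ → ℕ → ℕ} {N : ℕ} (h : ∀ k < N, t₁ k = t₂ k)
    (h' : ∀ k < N, t₁' k = t₂' k) : boxSeq n m t₁ t₁' N = boxSeq n m t₂ t₂' N := by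
  have key : ∀ M ≤ N, boxSeq n m t₁ t₁' M = boxSeq n m t₂ t₂' M := by
    intro M hM
    induction M with
    | zero => rfl
    | succ M ih =>
      change boxStep _ _ _ _ _ (boxSeq n m t₁ t₁' M) _ = boxStep _ _ _ _ _ (boxSeq n m t₂ t₂' M) _
      rw [ih (by omega), h 0 (by omega), h' 0 (by omega), h M (by omega), h' M (by omega)]
  exact key N le_rfl

/-- The tables of all levels that belong to a name. -/
def nameTable (n m : ℕ) (a : ℕ → List ℤ) (k i s : ℕ) : ℤ := (a k).getD (s + m ^ n * i) 0

theorem boxMethod_map (κ : ℕ) (a : ℕ → List ℤ) (N : ℕ) :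
    boxMethod ((n, m), κ, (List.range N).map a) = boxOutput n m κ (boxSeq n m
      (fun k i s => (nameTable n m a k i s).toNat) (fun k i s => (-nameTable n m a k i s).toNat)
      N) := by
  unfold boxMethod
  simp only [List.length_map, List.length_range]
  congr 1
  have : ∀ k < N, ((List.range N).map a).getD k [] = a k := fun k hk => by
    simp [List.getD_eq_getElem?_getD, hk]
  exact boxSeq_congr (fun k hk => by ext i s; simp only [posTable, nameTable, this k hk])
    (fun k hk => by ext i s; simp only [negTable, nameTable, this k hk])

/-- The quotient is the nearest integer to d 2^κ / 2^k. Rounding and the size of the box each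
contribute at most half of 1 / 2^κ. -/
theorem abs_sub_round_le {x s : ℝ} {d κ k : ℕ} (h : |x - d / 2 ^ k| ≤ s)
    (hs : s * 2 ^ (κ + 1) ≤ 1) :
    |x - ((2 * d * 2 ^ κ + 2 ^ k) / (2 * 2 ^ k) : ℕ) / 2 ^ κ| ≤ 1 / 2 ^ κ := by
  have hk : (0 : ℝ) < 2 ^ k := by positivity
  have hκ : (0 : ℝ) < 2 ^ κ := by positivity
  set y := (2 * d * 2 ^ κ + 2 ^ k) / (2 * 2 ^ k) with hy
  have h1 : y * (2 * 2 ^ k) ≤ 2 * d * 2 ^ κ + 2 ^ k := Nat.div_mul_le_self _ _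
  have h2 : 2 * d * 2 ^ κ + 2 ^ k < (y + 1) * (2 * 2 ^ k) := by
    rw [hy]
    have := Nat.lt_div_mul_add (a := 2 * d * 2 ^ κ + 2 ^ k) (b := 2 * 2 ^ k) (by positivity)
    rw [add_mul, one_mul]
    exact this
  have h1' : (y : ℝ) * (2 * 2 ^ k) ≤ 2 * d * 2 ^ κ + 2 ^ k := by exact_mod_cast h1
  have h2' : 2 * d * 2 ^ κ + 2 ^ k < ((y : ℝ) + 1) * (2 * 2 ^ k) := by exact_mod_cast h2
  have h3 : |(d : ℝ) / 2 ^ k - y / 2 ^ κ| ≤ 1 / 2 / 2 ^ κ := by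
    have e : (d : ℝ) / 2 ^ k - y / 2 ^ κ = (d * 2 ^ κ / 2 ^ k - y) / 2 ^ κ := by
      field_simp
    rw [e, abs_div, abs_of_pos hκ]
    gcongr
    have e2 : (d : ℝ) * 2 ^ κ / 2 ^ k - y = (d * 2 ^ κ - y * 2 ^ k) / 2 ^ k := by
      field_simp
    rw [e2, abs_div, abs_of_pos hk, div_le_iff₀ hk, abs_le]
    constructor <;> linarith
  have h4 : s ≤ 1 / 2 / 2 ^ κ := by
    rw [le_div_iff₀ hκ]
    rw [pow_succ] at hs
    linarith
  have h5 := abs_sub_le x (d / 2 ^ k) (y / 2 ^ κ)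
  have h6 : (1 : ℝ) / 2 ^ κ = 1 / 2 / 2 ^ κ + 1 / 2 / 2 ^ κ := by ring
  linarith

theorem boxOutput_approximates {u : Game n m} {S : ℕ × ℕ × ℕ} {e : Fin n × Fin m → ℝ}
    (he : e ∈ boxZeros u S) {κ : ℕ} {y : List ℕ} (hy : boxOutput n m κ S = some y) :
    Approximates y κ (WithLp.toLp 2 e : Vec n m) := by
  unfold boxOutput at hy
  split_ifs at hy with h
  obtain rfl := Option.some.inj hy
  refine ⟨by simp, fun i j => ?_⟩
  have hr := (finProdFinEquiv (i, j)).2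
  have hget : (((List.range (n * m)).map fun r =>
      (2 * digit (gridBase S.1) S.2.1 r * 2 ^ κ + 2 ^ S.1) / (2 * 2 ^ S.1)).getD
        (finProdFinEquiv (i, j)).val 0) = (2 * digit (gridBase S.1) S.2.1
          (finProdFinEquiv (i, j)).val * 2 ^ κ + 2 ^ S.1) / (2 * 2 ^ S.1) := by
    simp only [List.getD_eq_getElem?_getD, List.getElem?_map, List.getElem?_range hr,
      Option.map_some, Option.getD_some]
  rw [hget]
  refine abs_sub_round_le (abs_sub_le_boxSize he (i, j)) ?_
  rw [boxSize, div_mul_eq_mul_div, div_le_one (by positivity)]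
  exact_mod_cast h

theorem exists_boxOutput_eq {S : ℕ × ℕ × ℕ} {κ : ℕ} (h : boxSize S ≤ 4 / 2 ^ (κ + 3)) :
    ∃ y, boxOutput n m κ S = some y := by
  unfold boxOutput
  refine ⟨_, if_pos ?_⟩
  rw [boxSize, div_le_div_iff₀ (by positivity) (by positivity), pow_add] at h
  have : (((S.2.2 + 1) * 2 ^ (κ + 1) : ℕ) : ℝ) ≤ (2 ^ S.1 : ℕ) := by
    push_cast
    rw [pow_succ]
    linarith
  exact_mod_cast this

variable {u : Game n m} {a : ℕ → List ℤ}

/-- The approximating game of level `k` that a name provides. -/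
noncomputable def nameGame (a : ℕ → List ℤ) (k : ℕ) : Game n m := fun i s =>
  ((a k).getD (finProdFinEquiv (i, finFunctionFinEquiv s)).val 0 : ℝ) / 2 ^ k

theorem toNat_sub_toNat_neg_cast (z : ℤ) : (z.toNat : ℝ) - (-z).toNat = z := by
  have : (z.toNat : ℤ) - (-z).toNat = z := Int.toNat_sub_toNat_neg z
  exact_mod_cast congrArg (Int.cast : ℤ → ℝ) this

theorem isTable_nameTable (a : ℕ → List ℤ) (k : ℕ) :
    IsTable (fun i s => (nameTable n m a k i s).toNat) (fun i s => (-nameTable n m a k i s).toNat)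
      k (nameGame a k : Game n m) := by
  intro i s
  rw [toNat_sub_toNat_neg_cast, nameGame, div_mul_cancel₀ _ (by positivity)]
  rfl

theorem abs_le_payoffBound (ha : IsName u a) (i : Fin n) (s : Fin n → Fin m) :
    |u i s| ≤ payoffBound n m (fun i s => (nameTable n m a 0 i s).toNat)
      fun i s => (-nameTable n m a 0 i s).toNat := by
  have h := (ha 0).2 i s
  rw [pow_zero, div_one, div_one] at h
  have hz : (a 0).getD (finProdFinEquiv (i, finFunctionFinEquiv s)).val 0
    = nameTable n m a 0 i (finFunctionFinEquiv s).val := rfl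
  rw [hz] at h
  have h1 : (nameTable n m a 0 i (finFunctionFinEquiv s).val).toNat
      + (-nameTable n m a 0 i (finFunctionFinEquiv s).val).toNat
      ≤ ∑ i ∈ Finset.range n, ∑ s ∈ Finset.range (m ^ n),
        ((nameTable n m a 0 i s).toNat + (-nameTable n m a 0 i s).toNat) :=
    (Finset.single_le_sum (f := fun s => (nameTable n m a 0 i s).toNat
        + (-nameTable n m a 0 i s).toNat) (fun _ _ => Nat.zero_le _)
      (Finset.mem_range.2 (finFunctionFinEquiv s).2)).trans
    (Finset.single_le_sum (f := fun i => ∑ s ∈ Finset.range (m ^ n),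
        ((nameTable n m a 0 i s).toNat + (-nameTable n m a 0 i s).toNat))
      (fun _ _ => Nat.zero_le _) (Finset.mem_range.2 i.2))
  have h2 : |nameTable n m a 0 i (finFunctionFinEquiv s).val|
      ≤ (payoffBound n m (fun i s => (nameTable n m a 0 i s).toNat)
        (fun i s => (-nameTable n m a 0 i s).toNat) : ℤ) - 2 := by
    unfold payoffBound
    rw [abs_le]
    push_cast
    zify at h1
    omega
  have h3 : |(nameTable n m a 0 i (finFunctionFinEquiv s).val : ℝ)|
      ≤ (payoffBound n m (fun i s => (nameTable n m a 0 i s).toNat)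
        (fun i s => (-nameTable n m a 0 i s).toNat) : ℝ) - 2 := by exact_mod_cast h2
  have h4 := abs_sub_abs_le_abs_sub (u i s) (nameTable n m a 0 i (finFunctionFinEquiv s).val : ℝ)
  linarith

end Method
end NashGame

theorem mainTheorem1 :
    ∃ A : NashGame.Method, Computable A ∧
      ∀ (n m : ℕ), 2 ≤ n → 2 ≤ m →
        ∀ u : NashGame.Game n m, NashGame.SeqLocNonconst u →
          ∀ a : ℕ → List ℤ, NashGame.IsName u a →
            ∃ p : NashGame.Vec n m, p ∈ NashGame.profiles n m ∧
              NashGame.nashMap u p = p ∧ NashGame.IsNashEquilibrium u p ∧ A.Finds a p := by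
  refine ⟨NashGame.boxMethod, NashGame.computable_boxMethod, fun n m hn hm u hu a ha => ?_⟩
  have hn0 : 0 < n := by omega
  have hm0 : 0 < m := by omega
  have hfin := NashGame.finite_zeros hm0 hu
  have hname : ∀ k i s, |u i s - NashGame.nameGame a k i s| ≤ 1 / 2 ^ k := fun k => (ha k).2
  -- One zero in all boxes makes the answers for all precisions and all segments refer to the same
  -- profile.
  obtain ⟨e, he, hbox⟩ := NashGame.exists_mem_boxZeros hn0 hm0 hfin
    (NashGame.isTable_nameTable a) hname (NashGame.abs_le_payoffBound ha)
  obtain ⟨hp, hgain⟩ := NashGame.mem_profiles_of_field_eq_zero hm0 he.1 he.2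
  refine ⟨WithLp.toLp 2 e, hp, NashGame.nashMap_eq_of_gain_eq_zero hp hgain,
    NashGame.isNashEquilibrium_of_gain_eq_zero hp hgain, fun κ => ⟨?_, fun N y hy => ?_⟩⟩
  -- 4 / 2^(κ + 3) = 1 / 2^(κ + 1) is the size at which `boxOutput` answers.
  · obtain ⟨N, hN⟩ := NashGame.exists_boxSize_lt hn0 hm0 hfin (NashGame.isTable_nameTable a) hname
      (NashGame.abs_le_payoffBound ha) (κ + 3)
    obtain ⟨y, hy⟩ := NashGame.exists_boxOutput_eq (n := n) (m := m) hN
    exact ⟨N, y, by rw [NashGame.boxMethod_map]; exact hy⟩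
  · rw [NashGame.boxMethod_map] at hy
    exact NashGame.boxOutput_approximates (hbox N) hy
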